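/- Theorem 1.1. For a symmetric real $n\times n$ matrix $A$ with eigenvalues $\lambda_1(A),\dots,\lambda_n(A)$ (with multiplicity), let $\hat\mu(A)=\frac1n\sum_{j=1}^n\delta_{\lambda_j(A)}$. For a real sequence $(X_k)_{k\ge 0}$ let $T_n=[X_{|i-j|}]_{1\le i,j\le n}$. A *partition word* of length $2k$ is a word $w=w[1]\cdots w[2k]$ in $k$ letters in which every letter occurs exactly twice and the first occurrences of the letters are in alphabetic order; partition words of length $2k$ correspond to the pair partitions of $\{1,\dots,2k\}$. To $w$ attach the linear system in $x_0,\dots,x_{2k}$ $$(x_i-x_{i-1})+(x_j-x_{j-1})=0\qquad\text{for all } i<j \text{ with } w[i]=w[j].$$ It determines all variables from the $k+1$ undetermined ones, namely $x_0$ and the $k$ variables $x_i$ that follow the first occurrence $w[i]$ of a letter. Let $S(w)\subset[0,1]^{k+1}$ be the set of values of the undetermined variables for which all the variables $x_0,\dots,x_{2k}$ lie in $[0,1]$, and let $p_T(w)$ be the $(k+1)$-dimensional volume of $S(w)$. Let $A_{n,m}$ be the Eulerian number, that is, the number of permutations $\sigma$ of $\{1,\dots,n\}$ with $\sigma_i>\sigma_{i-1}$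 for exactly $m$ indices $i\in\{1,\dots,n\}$, where $\sigma_0=0$. (1) There is a (nonrandom) probability measure $\gamma_T$ on $\mathbb R$ such that, for every sequence $(X_k)_{k\ge0}$ of i.i.d. real-valued random variables with $\operatorname{Var}(X_1)=1$, with probability $1$ the measures $\hat\mu(T_n/\sqrt n)$ converge weakly to $\gamma_T$ as $n\to\infty$; in particular $\gamma_T$ does not depend on the distribution of $X_1$. The measure $\gamma_T$ is symmetric, has unbounded support, and for every $k\ge 0$ its moment of order $2k$ is finite and equals $$\int t^{2k}\,\gamma_T(dt)=\sum_{w:\,|w|=2k}p_T(w),$$ the sum being over all partition words $w$ of length $2k$. (2) For every partition word $w$ of length $2k$, the set $S(w)$ is the intersection of the cube $[0,1]^{k+1}$ with $k$ solids of the form $$\Big\{u\in[0,1]^{k+1}:\ \sum_{i\in A}u_i-\sum_{i\in B}u_i\in[0,1]\Big\},$$ with $A,B$ disjoint sets of coordinates (depending on the solid) and $|A|=|B|+1$; such a solid has volume $A_{n,m}/n!$ with $n=|A|+|B|$ (an odd number) and $m=|A|=(n+1)/2$. -/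

import Mathlib

open MeasureTheory ProbabilityTheory Filter Topology

open scoped ENNReal Nat

namespace ToeplitzSpectrum

/-- The symmetric Toeplitz matrix `[x_{|i-j|}]` of size `n`. -/
def toeplitz (n : ℕ) (x : ℕ → ℝ) : Matrix (Fin n) (Fin n) ℝ :=
  Matrix.of fun i j => x ((i : ℤ) - (j : ℤ)).natAbs

theorem toeplitz_isHermitian (n : ℕ) (x : ℕ → ℝ) : (toeplitz n x).IsHermitian := by
  ext i j
  simp only [toeplitz, Matrix.conjTranspose_apply, Matrix.of_apply, star_trivial]
  rw [← Int.natAbs_neg, neg_sub]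

/-- The rescaled matrix `T_n / √n`. -/
noncomputable def scaledToeplitz (n : ℕ) (x : ℕ → ℝ) : Matrix (Fin n) (Fin n) ℝ :=
  (√(n : ℝ))⁻¹ • toeplitz n x

theorem scaledToeplitz_isHermitian (n : ℕ) (x : ℕ → ℝ) : (scaledToeplitz n x).IsHermitian := by
  unfold scaledToeplitz Matrix.IsHermitian
  rw [Matrix.conjTranspose_smul, (toeplitz_isHermitian n x).eq, star_trivial]

/-- The empirical spectral measure `n⁻¹ ∑ j, δ_{λ_j(A)}` of a symmetric `n × n` matrix, `n ≥ 1`;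
eigenvalues are counted with multiplicity. -/
noncomputable def spectralMeasure {n : ℕ} [NeZero n] (A : Matrix (Fin n) (Fin n) ℝ)
    (hA : A.IsHermitian) : ProbabilityMeasure ℝ :=
  ⟨(n : ℝ≥0∞)⁻¹ • ∑ j, Measure.dirac (hA.eigenvalues j), ⟨by
    simp [ENNReal.inv_mul_cancel (Nat.cast_ne_zero.2 (NeZero.ne n)) (ENNReal.natCast_ne_top n)]⟩⟩

/-- Partition words of length `2k` in the alphabet `Fin k`: every letter occurs exactly twice, and
the first occurrences of the letters are in alphabetic order. They index the pair partitions of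
the `2k` positions. -/
def IsPartitionWord {k : ℕ} (w : Fin (2 * k) → Fin k) : Prop :=
  (∀ a, (Finset.univ.filter fun i => w i = a).card = 2) ∧
    ∀ a b, a < b → ∃ i, w i = a ∧ ∀ j, w j = b → i < j

instance {k : ℕ} : DecidablePred (IsPartitionWord (k := k)) := fun _ =>
  inferInstanceAs (Decidable (_ ∧ _))

/-- The finite set of all partition words of length `2k`. -/
def partitionWords (k : ℕ) : Finset (Fin (2 * k) → Fin k) :=
  Finset.univ.filter IsPartitionWord

/-- The linear system attached to `w` in the unknowns `x_0, …, x_{2k}`: whenever two distinct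
positions carry the same letter, the increments of `x` across these positions add up to zero.
Position `i : Fin (2 * k)` lies between the unknowns `x i.castSucc` and `x i.succ`. -/
def SolvesToeplitzSystem {k : ℕ} (w : Fin (2 * k) → Fin k) (x : Fin (2 * k + 1) → ℝ) : Prop :=
  ∀ i j, i < j → w i = w j → (x i.succ - x i.castSucc) + (x j.succ - x j.castSucc) = 0

/-- The unit cube `[0,1]^d`. -/
def unitCube (d : ℕ) : Set (Fin d → ℝ) :=
  {u | ∀ i, u i ∈ Set.Icc (0 : ℝ) 1}

/-- The section of the cube `[0,1]^{k+1}` attached to `w`. The coordinates of the cube are the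
`k + 1` undetermined variables: `u 0` is `x_0`, and `u a.succ` is the variable that follows the
first occurrence of the letter `a`. A point `u` belongs to the section when the solution `x` of
the system with these values has all its coordinates in `[0,1]`. -/
def toeplitzSection {k : ℕ} (w : Fin (2 * k) → Fin k) : Set (Fin (k + 1) → ℝ) :=
  {u | u ∈ unitCube (k + 1) ∧ ∃ x : Fin (2 * k + 1) → ℝ, SolvesToeplitzSystem w x ∧
    x 0 = u 0 ∧ (∀ i, (∀ j, w j = w i → i ≤ j) → x i.succ = u (w i).succ) ∧
    ∀ i, x i ∈ Set.Icc (0 : ℝ) 1}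

/-- The Toeplitz volume `p_T(w)`. -/
noncomputable def toeplitzVolume {k : ℕ} (w : Fin (2 * k) → Fin k) : ℝ :=
  volume.real (toeplitzSection w)

/-- The solid `{u ∈ [0,1]^d : ∑_{i ∈ A} u_i - ∑_{i ∈ B} u_i ∈ [0,1]}`. -/
def eulerianSolid {d : ℕ} (A B : Finset (Fin d)) : Set (Fin d → ℝ) :=
  {u | u ∈ unitCube d ∧ (∑ i ∈ A, u i) - ∑ i ∈ B, u i ∈ Set.Icc (0 : ℝ) 1}

/-- The Eulerian number `A_{n,m}`: the number of permutations `σ` of `n` letters with exactly `m`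
rises, the first position always counting as a rise. -/
def eulerianNumber (n m : ℕ) : ℕ :=
  (Finset.univ.filter fun σ : Equiv.Perm (Fin n) =>
    (Finset.univ.filter fun i : Fin n =>
      ∀ j : Fin n, (j : ℕ) + 1 = (i : ℕ) → σ j < σ i).card = m).card

end ToeplitzSpectrum

/-! Convergence is proved by the method of moments. For bounded noise of mean 0 and variance 1, the
trace of `T_n ^ r` is a sum over closed paths of products of variables indexed by step lengths. A
length occurring once kills the expectation; the paths whose lengths all occur at least twice, and
some more often, are negligible against `n ^ (1 + r/2)`; loops in which every length occurs exactly
twice have expectation 1. Such a loop induces a partition word `w`. Up to lower order its paired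
steps are opposite, since two equal nonzero steps would make their length determined by the closing
relation and cost a factor `n`. Opposite steps are precisely the linear system of `w`, so the count
is one of lattice points in a dilated section and yields `p_T(w)` (`tendsto_card_pairLoops`).
Similar counting bounds the variance of the normalised trace by `O(1/n)`, hence almost sure
convergence along the sizes `(m + 1) ^ 2` (`IsBoundedNoise.ae_tendsto_moments`).

There are at most `(2k) ^ k` words, each of volume at most 1, so the even moments are small against
`(2k)!` and control the characteristic function. This gives uniqueness of the limit and, since odd
moments vanish, its symmetry. Existence comes from tightness along one realisation of random signs.
For unbounded support the moment of order `2k` is bounded below by `k! / 2 ^ k`: walk out along one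
path, return along another with the same multiset of steps, and count such pairs by Cauchy–Schwarz.

The general case follows from perturbation bounds for characteristic functions of spectral measures,
resting on the overlap matrix of two eigenbases (`exists_overlap`). Zero padding fills the gaps
between square sizes; the mean is removed as a rank-one perturbation of cost `|t| |c| / √n`; a
Frobenius bound with the strong law of large numbers replaces the centered entries by bounded ones
close in `L²`.

For the second part, `x_t` is `u_0` plus the increments of the letters open at time `t`. A
complementation argument shows that its coefficients lie in `{-1, 0, 1}`
(`IsOccurrences.abs_subset_sum_le_one`), and they add up to 1. Variables after a first occurrence
are coordinates, so `k` conditions remain. For the volume of a solid, the map from points of the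
circle to their successive differences preserves Haar measure on the torus, and the representatives
of the differences sum to the last point plus the number of descents
(`sum_circleRep_circleIncrements`); the condition thus prescribes the number of rises. -/

namespace ToeplitzSpectrum

/-! ### Perturbation of spectra through eigenbasis overlaps -/

section Spectral

open Matrix

variable {n : ℕ} {A B : Matrix (Fin n) (Fin n) ℝ}

/-- A real symmetric matrix is diagonalized by an orthogonal matrix. -/
theorem exists_orthogonal_diagonalization (hA : A.IsHermitian) :
    ∃ U : Matrix (Fin n) (Fin n) ℝ, Uᵀ * U = 1 ∧ U * Uᵀ = 1 ∧
      A * U = U * diagonal hA.eigenvalues := by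
  have h1 := hA.eigenvectorUnitary.2
  rw [Matrix.mem_unitaryGroup_iff] at h1
  have h1' := hA.eigenvectorUnitary.2
  rw [Matrix.mem_unitaryGroup_iff'] at h1'
  have hs : star (hA.eigenvectorUnitary : Matrix (Fin n) (Fin n) ℝ) =
      (hA.eigenvectorUnitary : Matrix (Fin n) (Fin n) ℝ)ᵀ := by
    rw [Matrix.star_eq_conjTranspose, conjTranspose_eq_transpose_of_trivial]
  rw [hs] at h1 h1'
  refine ⟨hA.eigenvectorUnitary, h1', h1, ?_⟩
  ext i j
  have := congrFun (hA.mulVec_eigenvectorBasis j) i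
  rw [Matrix.mul_diagonal]
  simpa [Matrix.mulVec, dotProduct, Matrix.mul_apply, mul_comm] using this

theorem sum_sq_col_of_transpose_mul_self {U : Matrix (Fin n) (Fin n) ℝ} (h : Uᵀ * U = 1)
    (j : Fin n) : ∑ i, U i j ^ 2 = 1 := by
  have := congrFun (congrFun h j) j
  simpa [Matrix.mul_apply, sq] using this

theorem sum_sq_entries (M : Matrix (Fin n) (Fin n) ℝ) :
    ∑ i, ∑ j, M i j ^ 2 = (Mᵀ * M).trace := by
  rw [Finset.sum_comm]
  simp [Matrix.trace, Matrix.mul_apply, sq]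

/-- The overlap matrix of the eigenbases of two symmetric matrices. -/
theorem exists_overlap (hA : A.IsHermitian) (hB : B.IsHermitian) :
    ∃ U V O : Matrix (Fin n) (Fin n) ℝ, (Uᵀ * U = 1 ∧ U * Uᵀ = 1) ∧ (Vᵀ * V = 1 ∧ V * Vᵀ = 1) ∧
      (Oᵀ * O = 1 ∧ O * Oᵀ = 1) ∧
      ∀ i j, (hA.eigenvalues i - hB.eigenvalues j) * O i j = (Uᵀ * (A - B) * V) i j := by
  obtain ⟨U, hU, hU', hAU⟩ := exists_orthogonal_diagonalization hA
  obtain ⟨V, hV, hV', hBV⟩ := exists_orthogonal_diagonalization hB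
  refine ⟨U, V, Uᵀ * V, ⟨hU, hU'⟩, ⟨hV, hV'⟩, ⟨?_, ?_⟩, fun i j => ?_⟩
  · calc (Uᵀ * V)ᵀ * (Uᵀ * V) = Vᵀ * (U * Uᵀ) * V := by
          simp [Matrix.transpose_mul, Matrix.mul_assoc]
      _ = 1 := by rw [hU', Matrix.mul_one, hV]
  · calc (Uᵀ * V) * (Uᵀ * V)ᵀ = Uᵀ * (V * Vᵀ) * U := by
          simp [Matrix.transpose_mul, Matrix.mul_assoc]
      _ = 1 := by rw [hV', Matrix.mul_one, hU]
  · have hAt : Uᵀ * A = diagonal hA.eigenvalues * Uᵀ := by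
      have := congrArg Matrix.transpose hAU
      rw [Matrix.transpose_mul, Matrix.transpose_mul, Matrix.diagonal_transpose] at this
      rwa [← conjTranspose_eq_transpose_of_trivial A, hA.eq] at this
    have : Uᵀ * (A - B) * V
        = diagonal hA.eigenvalues * (Uᵀ * V) - (Uᵀ * V) * diagonal hB.eigenvalues := by
      rw [Matrix.mul_sub, Matrix.sub_mul, hAt, Matrix.mul_assoc, Matrix.mul_assoc Uᵀ B V, hBV,
        Matrix.mul_assoc]
    rw [this, Matrix.sub_apply, Matrix.diagonal_mul, Matrix.mul_diagonal]
    ring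

/-- The squared entries of an orthogonal matrix are doubly stochastic, so both sums can be spread
over pairs of eigenvalues with common weights. Two spectra are compared without ordering their
eigenvalues. -/
theorem sum_sub_sum_eq_overlap {O : Matrix (Fin n) (Fin n) ℝ} (hO : Oᵀ * O = 1)
    (hO' : O * Oᵀ = 1) (f g : Fin n → ℂ) :
    ∑ i, f i - ∑ j, g j = ∑ i, ∑ j, (f i - g j) * ((O i j ^ 2 : ℝ) : ℂ) := by
  have h1 : ∀ j, ∑ i, ((O i j ^ 2 : ℝ) : ℂ) = 1 := fun j => by
    rw [← Complex.ofReal_sum, sum_sq_col_of_transpose_mul_self hO, Complex.ofReal_one]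
  have h2 : ∀ i, ∑ j, ((O i j ^ 2 : ℝ) : ℂ) = 1 := fun i => by
    have := sum_sq_col_of_transpose_mul_self (U := Oᵀ) (by simpa using hO') i
    simp only [Matrix.transpose_apply] at this
    rw [← Complex.ofReal_sum, this, Complex.ofReal_one]
  simp only [sub_mul, Finset.sum_sub_distrib]
  congr 1
  · simp only [← Finset.mul_sum, h2, mul_one]
  · rw [Finset.sum_comm]
    simp only [← Finset.mul_sum, h1, mul_one]

/-- Linear statistics of Lipschitz functions are controlled by the Frobenius distance. -/
theorem norm_sum_eigenvalues_sub_le (hA : A.IsHermitian) (hB : B.IsHermitian) {f : ℝ → ℂ} {L : ℝ}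
    (hf : ∀ x y, ‖f x - f y‖ ≤ L * |x - y|) :
    ‖∑ i, f (hA.eigenvalues i) - ∑ i, f (hB.eigenvalues i)‖ ≤
      L * (√(∑ i, ∑ j, (A i j - B i j) ^ 2) * √n) := by
  obtain ⟨U, V, O, hU, hV, hO, h⟩ := exists_overlap hA hB
  have hL : 0 ≤ L := by simpa using (norm_nonneg _).trans (hf 0 1)
  rw [sum_sub_sum_eq_overlap hO.1 hO.2]
  set D := Uᵀ * (A - B) * V with hD
  have hDs : ∑ p : Fin n × Fin n, |D p.1 p.2| ^ 2 = ∑ i, ∑ j, (A i j - B i j) ^ 2 := by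
    rw [Fintype.sum_prod_type]
    simp only [sq_abs]
    rw [sum_sq_entries]
    have : ∑ i, ∑ j, (A i j - B i j) ^ 2 = ((A - B)ᵀ * (A - B)).trace := by
      rw [← sum_sq_entries]; simp
    rw [this, hD]
    calc ((Uᵀ * (A - B) * V)ᵀ * (Uᵀ * (A - B) * V)).trace
        = (Vᵀ * ((A - B)ᵀ * (U * Uᵀ) * (A - B)) * V).trace := by
          simp [Matrix.transpose_mul, Matrix.mul_assoc]
      _ = _ := by
          rw [hU.2, Matrix.mul_one, Matrix.trace_mul_cycle, hV.2, Matrix.one_mul]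
  have hOs : ∑ p : Fin n × Fin n, |O p.1 p.2| ^ 2 = n := by
    rw [Fintype.sum_prod_type, Finset.sum_comm]
    simp only [sq_abs, sum_sq_col_of_transpose_mul_self hO.1]
    simp
  calc ‖∑ i, ∑ j, (f (hA.eigenvalues i) - f (hB.eigenvalues j)) * ((O i j ^ 2 : ℝ) : ℂ)‖
      ≤ ∑ i, ∑ j, L * (|D i j| * |O i j|) := by
        refine (norm_sum_le _ _).trans (Finset.sum_le_sum fun i _ => ?_)
        refine (norm_sum_le _ _).trans (Finset.sum_le_sum fun j _ => ?_)
        -- One factor `O i j` turns the eigenvalue gap into the entry `D i j`; the other is kept for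
        -- Cauchy–Schwarz.
        rw [norm_mul, Complex.norm_real, ← h, abs_mul, Real.norm_eq_abs, abs_pow, sq]
        calc _ ≤ (L * |hA.eigenvalues i - hB.eigenvalues j|) * (|O i j| * |O i j|) :=
              mul_le_mul_of_nonneg_right (hf _ _) (by positivity)
          _ = _ := by ring
    _ = L * ∑ p : Fin n × Fin n, |D p.1 p.2| * |O p.1 p.2| := by
        rw [Fintype.sum_prod_type, Finset.mul_sum]
        simp only [Finset.mul_sum]
    _ ≤ L * (√(∑ p : Fin n × Fin n, |D p.1 p.2| ^ 2) * √(∑ p : Fin n × Fin n, |O p.1 p.2| ^ 2)) :=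
        mul_le_mul_of_nonneg_left (Real.sum_mul_le_sqrt_mul_sqrt _ _ _) hL
    _ = _ := by rw [hDs, hOs]

theorem sum_normSq_mulVec_of_orthogonal {O : Matrix (Fin n) (Fin n) ℝ} (hO : Oᵀ * O = 1)
    (β : Fin n → ℂ) : ∑ i, ‖∑ j, (O i j : ℂ) * β j‖ ^ 2 = ∑ j, ‖β j‖ ^ 2 := by
  have key : ∀ b : Fin n → ℝ, ∑ i, (∑ j, O i j * b j) ^ 2 = ∑ j, b j ^ 2 := by
    intro b
    have h : (O *ᵥ b) ⬝ᵥ (O *ᵥ b) = b ⬝ᵥ b := by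
      rw [Matrix.dotProduct_mulVec, Matrix.vecMul_mulVec, hO, Matrix.vecMul_one]
    simpa [dotProduct, Matrix.mulVec, sq] using h
  have hn : ∀ z : ℂ, ‖z‖ ^ 2 = z.re ^ 2 + z.im ^ 2 := fun z => by
    rw [Complex.sq_norm, Complex.normSq_apply]; ring
  simp only [hn, Complex.re_sum, Complex.im_sum, Complex.re_ofReal_mul, Complex.im_ofReal_mul,
    Finset.sum_add_distrib, key]

/-- `O` preserves the norm of `β`, and the arithmetic-geometric mean inequality does the rest. It
loses nothing in the application, where `α` and `β` have equal norms. -/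
theorem norm_bilinear_of_orthogonal_le {O : Matrix (Fin n) (Fin n) ℝ} (hO : Oᵀ * O = 1)
    (α β : Fin n → ℂ) :
    ‖∑ i, ∑ j, α i * (O i j : ℂ) * β j‖ ≤ (∑ i, ‖α i‖ ^ 2 + ∑ j, ‖β j‖ ^ 2) / 2 := by
  rw [← sum_normSq_mulVec_of_orthogonal hO β, ← Finset.sum_add_distrib, Finset.sum_div]
  refine (norm_sum_le _ _).trans (Finset.sum_le_sum fun i _ => ?_)
  simp only [mul_assoc]
  rw [← Finset.mul_sum, norm_mul]
  nlinarith [sq_nonneg (‖α i‖ - ‖∑ j, (O i j : ℂ) * β j‖)]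

/-- Duhamel's formula: the gap `a - b` splits off, and what remains is a product of a function of
`a` and a function of `b`. This product structure makes the double sum over eigenvalues a bilinear
form. -/
theorem cexp_sub_cexp_eq_integral (a b : ℝ) :
    Complex.exp (a * Complex.I) - Complex.exp (b * Complex.I) =
      ((a - b : ℝ) * Complex.I) * ∫ s in (0 : ℝ)..1,
        Complex.exp ((s * a : ℝ) * Complex.I) * Complex.exp (((1 - s) * b : ℝ) * Complex.I) := by
  have hd : ∀ s ∈ Set.uIcc (0 : ℝ) 1, HasDerivAt
      (fun s : ℝ => Complex.exp ((s * a : ℝ) * Complex.I) *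
        Complex.exp (((1 - s) * b : ℝ) * Complex.I))
      (((a - b : ℝ) * Complex.I) * (Complex.exp ((s * a : ℝ) * Complex.I) *
        Complex.exp (((1 - s) * b : ℝ) * Complex.I))) s := by
    intro s _
    have h1 : HasDerivAt (fun s : ℝ => (((s * a : ℝ) : ℂ)) * Complex.I) ((a : ℂ) * Complex.I) s := by
      have : HasDerivAt (fun s : ℝ => s * a) a s := by simpa using (hasDerivAt_id s).mul_const a
      exact this.ofReal_comp.mul_const _
    have h2 : HasDerivAt (fun s : ℝ => ((((1 - s) * b : ℝ) : ℂ)) * Complex.I)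
        (((-b : ℝ) : ℂ) * Complex.I) s := by
      have : HasDerivAt (fun s : ℝ => (1 - s) * b) (-b) s := by
        simpa using ((hasDerivAt_id s).const_sub 1).mul_const b
      exact this.ofReal_comp.mul_const _
    refine (h1.cexp.mul h2.cexp).congr_deriv ?_
    push_cast
    ring
  have hc : Continuous fun s : ℝ => ((a - b : ℝ) * Complex.I) *
      (Complex.exp ((s * a : ℝ) * Complex.I) *
        Complex.exp (((1 - s) * b : ℝ) * Complex.I)) := by fun_prop
  have := intervalIntegral.integral_eq_sub_of_hasDerivAt hd (hc.intervalIntegrable _ _)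
  rw [intervalIntegral.integral_const_mul] at this
  rw [this]
  simp

/-- Adding a multiple of the all-ones matrix changes the trace of `exp (i t A)` by at most
`|t| |c| n`. -/
theorem norm_sum_cexp_eigenvalues_sub_le (hA : A.IsHermitian) (hB : B.IsHermitian) (c t : ℝ)
    (hAB : ∀ i j, A i j - B i j = c) :
    ‖∑ i, Complex.exp ((t * hA.eigenvalues i : ℝ) * Complex.I) -
      ∑ i, Complex.exp ((t * hB.eigenvalues i : ℝ) * Complex.I)‖ ≤ |t| * |c| * n := by
  obtain ⟨U, V, O, hU, hV, hO, h⟩ := exists_overlap hA hB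
  -- Column sums of an orthogonal matrix are the coordinates of the all-ones vector in its basis, so
  -- their squares add up to `n`. The vectors `p` and `q` below are of this kind, and `A - B` is `c`
  -- times their tensor product.
  have hsq : ∀ {W : Matrix (Fin n) (Fin n) ℝ}, W * Wᵀ = 1 → ∑ i, (∑ k, W k i) ^ 2 = n := by
    intro W hW
    have : ((fun _ => 1 : Fin n → ℝ) ᵥ* W) ⬝ᵥ ((fun _ => 1 : Fin n → ℝ) ᵥ* W) = n := by
      rw [← Matrix.dotProduct_mulVec, Matrix.mulVec_vecMul, hW]
      simp [dotProduct]
    simpa [dotProduct, Matrix.vecMul, sq] using this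
  set p : Fin n → ℝ := fun i => ∑ k, U k i
  set q : Fin n → ℝ := fun j => ∑ k, V k j
  have hpq : ∀ i j, (hA.eigenvalues i - hB.eigenvalues j) * O i j = c * (p i * q j) := by
    intro i j
    rw [h, Matrix.mul_apply]
    simp only [Matrix.mul_apply, Matrix.sub_apply, hAB, Matrix.transpose_apply, p, q]
    rw [Finset.sum_mul_sum, Finset.sum_comm, Finset.mul_sum]
    simp only [Finset.sum_mul, Finset.mul_sum]
    exact Finset.sum_congr rfl fun k _ => Finset.sum_congr rfl fun l _ => by ring
  set e : ℝ → ℝ → ℂ := fun s a => Complex.exp ((s * a : ℝ) * Complex.I)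
  have he : ∀ s a, ‖e s a‖ = 1 := fun s a => Complex.norm_exp_ofReal_mul_I _
  rw [sum_sub_sum_eq_overlap hO.1 hO.2]
  have hterm : ∀ i j, (Complex.exp ((t * hA.eigenvalues i : ℝ) * Complex.I) -
      Complex.exp ((t * hB.eigenvalues j : ℝ) * Complex.I)) * ((O i j ^ 2 : ℝ) : ℂ) =
      ∫ s in (0 : ℝ)..1, ((t * c : ℝ) * Complex.I) * ((e s (t * hA.eigenvalues i) * p i) *
        (O i j : ℂ) * (e (1 - s) (t * hB.eigenvalues j) * q j)) := by
    intro i j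
    rw [cexp_sub_cexp_eq_integral, mul_assoc, ← intervalIntegral.integral_mul_const,
      ← intervalIntegral.integral_const_mul]
    congr 1
    funext s
    have := congrArg (fun x : ℝ => (x : ℂ)) (hpq i j)
    push_cast at this ⊢
    simp only [e]
    push_cast
    linear_combination ((t : ℂ) * Complex.I * Complex.exp (s * (t * hA.eigenvalues i) * Complex.I) *
      Complex.exp ((1 - s) * (t * hB.eigenvalues j) * Complex.I) * O i j) * this
  simp only [hterm]
  have hint : ∀ i j, IntervalIntegrable (fun s : ℝ => ((t * c : ℝ) * Complex.I) *
      ((e s (t * hA.eigenvalues i) * p i) * (O i j : ℂ) *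
        (e (1 - s) (t * hB.eigenvalues j) * q j))) volume 0 1 := by
    intro i j
    apply Continuous.intervalIntegrable
    simp only [e]
    fun_prop
  have hint' : ∀ i, IntervalIntegrable (fun s : ℝ => ∑ j, ((t * c : ℝ) * Complex.I) *
      ((e s (t * hA.eigenvalues i) * p i) * (O i j : ℂ) *
        (e (1 - s) (t * hB.eigenvalues j) * q j))) volume 0 1 := by
    intro i
    apply Continuous.intervalIntegrable
    simp only [e]
    fun_prop
  rw [← Finset.sum_congr rfl fun i _ => intervalIntegral.integral_finsetSum fun j _ => hint i j,
    ← intervalIntegral.integral_finsetSum fun i _ => hint' i]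
  have hb := intervalIntegral.norm_integral_le_of_norm_le_const (a := (0 : ℝ)) (b := 1)
    (C := |t| * |c| * n) (f := fun s : ℝ => ∑ i, ∑ j, ((t * c : ℝ) * Complex.I) *
      ((e s (t * hA.eigenvalues i) * p i) * (O i j : ℂ) *
        (e (1 - s) (t * hB.eigenvalues j) * q j))) ?_
  · simpa using hb
  intro s _
  simp only [← Finset.mul_sum]
  rw [norm_mul]
  have h1 : ‖((t * c : ℝ) : ℂ) * Complex.I‖ = |t| * |c| := by
    rw [norm_mul, Complex.norm_real, Complex.norm_I, mul_one, Real.norm_eq_abs, abs_mul]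
  rw [h1]
  refine mul_le_mul_of_nonneg_left ?_ (by positivity)
  -- The exponentials are unimodular, so both vectors have squared norm `n` and the bound is `(n +
  -- n) / 2`.
  refine (norm_bilinear_of_orthogonal_le hO.1 _ _).trans (le_of_eq ?_)
  simp only [norm_mul, he, one_mul, Complex.norm_real, Real.norm_eq_abs, sq_abs]
  rw [hsq hU.2, hsq hV.2]
  ring

end Spectral

/-! ### Empirical spectral measures and their characteristic functions -/

section EmpiricalMeasure

open Matrix

variable {n : ℕ} {A : Matrix (Fin n) (Fin n) ℝ}

theorem integrable_spectralMeasure [NeZero n] {E : Type*} [NormedAddCommGroup E]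
    (hA : A.IsHermitian) (f : ℝ → E) :
    Integrable f (spectralMeasure A hA : Measure ℝ) := by
  change Integrable f ((n : ℝ≥0∞)⁻¹ • ∑ j, Measure.dirac (hA.eigenvalues j))
  refine Integrable.smul_measure ?_ (by simp [NeZero.ne n])
  rw [integrable_finsetSum_measure]
  exact fun i _ => integrable_dirac (by simp)

theorem integral_spectralMeasure [NeZero n] {E : Type*} [NormedAddCommGroup E] [NormedSpace ℝ E]
    [CompleteSpace E] (hA : A.IsHermitian) (f : ℝ → E) :
    ∫ x, f x ∂(spectralMeasure A hA : Measure ℝ) = (n : ℝ)⁻¹ • ∑ j, f (hA.eigenvalues j) := by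
  change ∫ x, f x ∂((n : ℝ≥0∞)⁻¹ • ∑ j, Measure.dirac (hA.eigenvalues j)) = _
  rw [integral_smul_measure, integral_finsetSum_measure fun i _ => integrable_dirac (by simp)]
  simp

theorem charFun_spectralMeasure [NeZero n] (hA : A.IsHermitian) (t : ℝ) :
    charFun (spectralMeasure A hA : Measure ℝ) t =
      (n : ℝ)⁻¹ • ∑ j, Complex.exp ((t * hA.eigenvalues j : ℝ) * Complex.I) := by
  rw [charFun_apply_real, integral_spectralMeasure]
  simp

theorem trace_pow_eq_sum_eigenvalues_pow (hA : A.IsHermitian) (r : ℕ) :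
    (A ^ r).trace = ∑ j, hA.eigenvalues j ^ r := by
  obtain ⟨U, hU, hU', h⟩ := exists_orthogonal_diagonalization hA
  have hr : ∀ r, A ^ r * U = U * diagonal hA.eigenvalues ^ r := by
    intro r
    induction r with
    | zero => simp
    | succ r ih => rw [pow_succ, Matrix.mul_assoc, h, ← Matrix.mul_assoc, ih, Matrix.mul_assoc,
        ← pow_succ]
  have : (A ^ r).trace = (A ^ r * (U * Uᵀ)).trace := by rw [hU', Matrix.mul_one]
  rw [this, ← Matrix.mul_assoc, hr, Matrix.trace_mul_comm, ← Matrix.mul_assoc, hU, Matrix.one_mul,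
    Matrix.diagonal_pow]
  simp [Matrix.trace]

theorem integral_pow_spectralMeasure [NeZero n] (hA : A.IsHermitian) (r : ℕ) :
    ∫ x, x ^ r ∂(spectralMeasure A hA : Measure ℝ) = (n : ℝ)⁻¹ * (A ^ r).trace := by
  rw [integral_spectralMeasure, trace_pow_eq_sum_eigenvalues_pow hA, smul_eq_mul]

theorem norm_cexp_mul_I_sub_le (t x y : ℝ) :
    ‖Complex.exp ((t * x : ℝ) * Complex.I) - Complex.exp ((t * y : ℝ) * Complex.I)‖ ≤
      |t| * |x - y| := by
  have h : Complex.exp ((t * x : ℝ) * Complex.I) - Complex.exp ((t * y : ℝ) * Complex.I) =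
      Complex.exp ((t * y : ℝ) * Complex.I) *
        (Complex.exp (Complex.I * ((t * (x - y) : ℝ) : ℂ)) - 1) := by
    rw [mul_sub, ← Complex.exp_add, mul_one]
    congr 2
    push_cast
    ring
  rw [h, norm_mul, Complex.norm_exp_ofReal_mul_I, one_mul, ← abs_mul]
  exact Real.norm_exp_I_mul_ofReal_sub_one_le

/-- The empirical spectral measure of `T_n / √n`. -/
noncomputable abbrev toeplitzMeasure (n : ℕ) [NeZero n] (x : ℕ → ℝ) : ProbabilityMeasure ℝ :=
  spectralMeasure (scaledToeplitz n x) (scaledToeplitz_isHermitian n x)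

/-- Within one row of a Toeplitz matrix, a given distance to the diagonal is attained in at most two
columns. -/
theorem sum_natAbs_sub_le {z : ℕ → ℝ} (hz : ∀ k, 0 ≤ z k) (i : Fin n) :
    ∑ j : Fin n, z ((i : ℤ) - (j : ℤ)).natAbs ≤ 2 * ∑ k ∈ Finset.range n, z k := by
  rw [← Finset.sum_fiberwise_of_maps_to (s := Finset.univ) (t := Finset.range n)
    (g := fun j : Fin n => ((i : ℤ) - (j : ℤ)).natAbs) (fun j _ => by
      have := i.2; have := j.2; simp only [Finset.mem_range]; omega), Finset.mul_sum]
  refine Finset.sum_le_sum fun k _ => ?_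
  rw [Finset.sum_congr rfl (g := fun _ => z k) fun j hj => by rw [(Finset.mem_filter.1 hj).2],
    Finset.sum_const, nsmul_eq_mul]
  refine mul_le_mul_of_nonneg_right ?_ (hz k)
  have : (Finset.univ.filter fun j : Fin n => ((i : ℤ) - (j : ℤ)).natAbs = k).card ≤
      ({(k : ℤ), -(k : ℤ)} : Finset ℤ).card := by
    refine Finset.card_le_card_of_injOn (fun j => (i : ℤ) - (j : ℤ)) (fun j hj => ?_)
      (fun a _ b _ h => ?_)
    · have := (Finset.mem_filter.1 hj).2
      simp only [Finset.coe_insert, Finset.coe_singleton, Set.mem_insert_iff,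
        Set.mem_singleton_iff]
      omega
    · simp only at h; exact Fin.ext (by omega)
  exact_mod_cast this.trans Finset.card_le_two

theorem norm_charFun_spectralMeasure_sub_le [NeZero n] {B : Matrix (Fin n) (Fin n) ℝ}
    (hA : A.IsHermitian) (hB : B.IsHermitian) (t : ℝ) :
    ‖charFun (spectralMeasure A hA : Measure ℝ) t - charFun (spectralMeasure B hB : Measure ℝ) t‖ ≤
      |t| * √((n : ℝ)⁻¹ * ∑ i, ∑ j, (A i j - B i j) ^ 2) := by
  have hn : (0 : ℝ) < n := Nat.cast_pos.2 (NeZero.pos n)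
  rw [charFun_spectralMeasure, charFun_spectralMeasure, ← smul_sub, norm_smul,
    Real.norm_of_nonneg (by positivity)]
  have := norm_sum_eigenvalues_sub_le hA hB
    (f := fun x => Complex.exp ((t * x : ℝ) * Complex.I)) (norm_cexp_mul_I_sub_le t)
  refine (mul_le_mul_of_nonneg_left this (by positivity)).trans (le_of_eq ?_)
  rw [Real.sqrt_mul (by positivity), Real.sqrt_inv]
  have h2 : (n : ℝ)⁻¹ = (√n)⁻¹ * (√n)⁻¹ := by rw [← mul_inv, Real.mul_self_sqrt hn.le]
  have h3 : √(n : ℝ) ≠ 0 := (Real.sqrt_pos.2 hn).ne'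
  rw [h2]
  field_simp

/-- The Frobenius distance is reduced to a sample mean of squared differences, the form to which the
strong law of large numbers applies. -/
theorem norm_charFun_toeplitzMeasure_sub_le [NeZero n] (x y : ℕ → ℝ) (t : ℝ) :
    ‖charFun (toeplitzMeasure n x : Measure ℝ) t - charFun (toeplitzMeasure n y : Measure ℝ) t‖ ≤
      |t| * √(2 * ((∑ k ∈ Finset.range n, (x k - y k) ^ 2) / n)) := by
  have hn : (0 : ℝ) < n := Nat.cast_pos.2 (NeZero.pos n)
  refine (norm_charFun_spectralMeasure_sub_le _ _ t).trans ?_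
  refine mul_le_mul_of_nonneg_left (Real.sqrt_le_sqrt ?_) (abs_nonneg t)
  have hsq : (√(n : ℝ))⁻¹ ^ 2 = (n : ℝ)⁻¹ := by rw [inv_pow, Real.sq_sqrt hn.le]
  have h1 : ∀ i j : Fin n, (scaledToeplitz n x i j - scaledToeplitz n y i j) ^ 2 =
      (n : ℝ)⁻¹ * (x ((i : ℤ) - (j : ℤ)).natAbs - y ((i : ℤ) - (j : ℤ)).natAbs) ^ 2 := by
    intro i j
    simp only [scaledToeplitz, toeplitz, Matrix.smul_apply, Matrix.of_apply, smul_eq_mul]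
    rw [← mul_sub, mul_pow, hsq]
  simp only [h1, ← Finset.mul_sum]
  have h2 : ∑ i : Fin n, ∑ j : Fin n,
      (x ((i : ℤ) - (j : ℤ)).natAbs - y ((i : ℤ) - (j : ℤ)).natAbs) ^ 2 ≤
      ∑ i : Fin n, 2 * ∑ k ∈ Finset.range n, (x k - y k) ^ 2 :=
    Finset.sum_le_sum fun i _ => sum_natAbs_sub_le (z := fun k => (x k - y k) ^ 2)
      (fun k => sq_nonneg _) i
  rw [Finset.sum_const, Finset.card_univ, Fintype.card_fin, nsmul_eq_mul] at h2
  calc (n : ℝ)⁻¹ * ((n : ℝ)⁻¹ * _) ≤ (n : ℝ)⁻¹ * ((n : ℝ)⁻¹ * (n * (2 * ∑ k ∈ Finset.range n,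
        (x k - y k) ^ 2))) := by gcongr
    _ = _ := by field_simp

/-- This removes the mean of the entries. The Frobenius bound would not tend to zero here; the trace
bound for multiples of the all-ones matrix does, because the scaling leaves the multiple `c / √n`.
-/
theorem norm_charFun_toeplitzMeasure_add_const_sub_le [NeZero n] (x : ℕ → ℝ) (c t : ℝ) :
    ‖charFun (toeplitzMeasure n fun k => x k + c : Measure ℝ) t -
      charFun (toeplitzMeasure n x : Measure ℝ) t‖ ≤ |t| * |c| / √n := by
  have hn : (0 : ℝ) < n := Nat.cast_pos.2 (NeZero.pos n)
  rw [charFun_spectralMeasure, charFun_spectralMeasure, ← smul_sub, norm_smul,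
    Real.norm_of_nonneg (by positivity)]
  have := norm_sum_cexp_eigenvalues_sub_le (scaledToeplitz_isHermitian n fun k => x k + c)
    (scaledToeplitz_isHermitian n x) ((√n)⁻¹ * c) t (fun i j => by
      simp only [scaledToeplitz, toeplitz, Matrix.smul_apply, Matrix.of_apply, smul_eq_mul]
      ring)
  refine (mul_le_mul_of_nonneg_left this (by positivity)).trans (le_of_eq ?_)
  have h1 : (n : ℝ)⁻¹ * n = 1 := inv_mul_cancel₀ hn.ne'
  rw [abs_mul, abs_of_nonneg (show 0 ≤ (√(n : ℝ))⁻¹ by positivity)]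
  linear_combination (|t| * |c| * (√(n : ℝ))⁻¹) * h1

/-- Padding by zeros multiplies the characteristic polynomial by `X ^ m`; the spectra are compared
as multisets of its roots. -/
theorem sum_eigenvalues_fromBlocks_zero {m : ℕ} (hA : A.IsHermitian)
    {B : Matrix (Fin (n + m)) (Fin (n + m)) ℝ} (hB : B.IsHermitian)
    (h : B = Matrix.reindex finSumFinEquiv finSumFinEquiv (Matrix.fromBlocks A 0 0 0))
    (f : ℝ → ℂ) :
    ∑ i, f (hB.eigenvalues i) = ∑ i, f (hA.eigenvalues i) + m * f 0 := by
  have h1 : B.charpoly = A.charpoly * Polynomial.X ^ m := by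
    rw [h, Matrix.charpoly_reindex, Matrix.charpoly_fromBlocks_zero₁₂]
    simp [Matrix.charpoly_zero]
  have h2 := congrArg Polynomial.roots h1
  rw [Polynomial.roots_mul (mul_ne_zero A.charpoly_monic.ne_zero
      (pow_ne_zero _ Polynomial.X_ne_zero)), hB.roots_charpoly_eq_eigenvalues,
    hA.roots_charpoly_eq_eigenvalues, Polynomial.roots_X_pow] at h2
  have h3 := congrArg (fun s => (Multiset.map f s).sum) h2
  simpa [Function.comp_def, Finset.sum, Multiset.map_map, Multiset.nsmul_singleton] using h3

/-- The smaller matrix, with its own scaling, is padded by zeros to the larger size. The square root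
bounds the Frobenius cost of the change of scale in the corner and of the missing border; the last
term accounts for the `m` additional zero eigenvalues. -/
theorem norm_charFun_toeplitzMeasure_add_size_sub_le {N m : ℕ} [NeZero N] [NeZero (N + m)]
    {x : ℕ → ℝ} {C : ℝ} (hx : ∀ k, |x k| ≤ C) (t : ℝ) :
    ‖charFun (toeplitzMeasure (N + m) x : Measure ℝ) t -
      charFun (toeplitzMeasure N x : Measure ℝ) t‖ ≤
        |t| * √(3 * C ^ 2 * ((m : ℝ) / (N + m : ℕ))) + 2 * ((m : ℝ) / (N + m : ℕ)) := by
  have hN : (0 : ℝ) < N := Nat.cast_pos.2 (NeZero.pos N)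
  have hn : (0 : ℝ) < (N + m : ℕ) := Nat.cast_pos.2 (NeZero.pos (N + m))
  have hnR : ((N + m : ℕ) : ℝ) = N + m := by push_cast; ring
  set S := scaledToeplitz N x with hS
  have hSh := scaledToeplitz_isHermitian N x
  set B := Matrix.reindex finSumFinEquiv finSumFinEquiv
    (Matrix.fromBlocks S (0 : Matrix (Fin N) (Fin m) ℝ) 0 0) with hBdef
  have hB : B.IsHermitian := by
    rw [hBdef]
    ext i j
    have := congrFun (congrFun (Matrix.IsHermitian.fromBlocks (A := S) (B := (0 : Matrix (Fin N)
      (Fin m) ℝ)) (C := 0) (D := 0) hSh (by simp) (by simp)) (finSumFinEquiv.symm i))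
      (finSumFinEquiv.symm j)
    simpa using this
  have hT := scaledToeplitz_isHermitian (N + m) x
  have key := norm_charFun_spectralMeasure_sub_le hT hB t
  have hC : 0 ≤ C := (abs_nonneg _).trans (hx 0)
  have hx2 : ∀ k, x k ^ 2 ≤ C ^ 2 := fun k => sq_le_sq' (by linarith [neg_abs_le (x k), hx k])
    ((le_abs_self _).trans (hx k))
  have hsqn : (√((N + m : ℕ) : ℝ))⁻¹ ^ 2 = ((N + m : ℕ) : ℝ)⁻¹ := by rw [inv_pow, Real.sq_sqrt hn.le]
  have hfrob : ∑ i, ∑ j, (scaledToeplitz (N + m) x i j - B i j) ^ 2 ≤ 3 * C ^ 2 * m := by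
    rw [Fin.sum_univ_add]
    simp only [Fin.sum_univ_add]
    have e1 : ∀ i j : Fin N, (scaledToeplitz (N + m) x (Fin.castAdd m i) (Fin.castAdd m j) -
        B (Fin.castAdd m i) (Fin.castAdd m j)) ^ 2 ≤ C ^ 2 * ((√N)⁻¹ - (√((N + m : ℕ) : ℝ))⁻¹) ^ 2 := by
      intro i j
      have : scaledToeplitz (N + m) x (Fin.castAdd m i) (Fin.castAdd m j) -
        B (Fin.castAdd m i) (Fin.castAdd m j) =
          x ((i : ℤ) - (j : ℤ)).natAbs * ((√((N + m : ℕ) : ℝ))⁻¹ - (√N)⁻¹) := by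
        simp [hBdef, hS, scaledToeplitz, toeplitz]; ring
      rw [this, mul_pow, ← neg_sub (√N)⁻¹, neg_sq]
      exact mul_le_mul_of_nonneg_right (hx2 _) (sq_nonneg _)
    have e2 : ∀ k, ((√((N + m : ℕ) : ℝ))⁻¹ * x k) ^ 2 ≤ C ^ 2 * ((N + m : ℕ) : ℝ)⁻¹ := by
      intro k
      rw [mul_pow, hsqn, mul_comm]
      exact mul_le_mul_of_nonneg_right (hx2 _) (by positivity)
    have f1 : ∑ i : Fin N, (∑ j : Fin N, (scaledToeplitz (N + m) x (Fin.castAdd m i) (Fin.castAdd m j) -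
        B (Fin.castAdd m i) (Fin.castAdd m j)) ^ 2 + ∑ j : Fin m, (scaledToeplitz (N + m) x
        (Fin.castAdd m i) (Fin.natAdd N j) - B (Fin.castAdd m i) (Fin.natAdd N j)) ^ 2) ≤
        ∑ i : Fin N, (∑ j : Fin N, C ^ 2 * ((√N)⁻¹ - (√((N + m : ℕ) : ℝ))⁻¹) ^ 2 +
          ∑ j : Fin m, C ^ 2 * ((N + m : ℕ) : ℝ)⁻¹) := by
      refine Finset.sum_le_sum fun i _ => add_le_add (Finset.sum_le_sum fun j _ => e1 i j)
        (Finset.sum_le_sum fun j _ => ?_)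
      refine le_trans (le_of_eq ?_) (e2 (((Fin.castAdd m i : Fin (N + m)) : ℤ) -
        ((Fin.natAdd N j : Fin (N + m)) : ℤ)).natAbs)
      simp [hBdef, scaledToeplitz, toeplitz]
    have f2 : ∑ i : Fin m, (∑ j : Fin N, (scaledToeplitz (N + m) x (Fin.natAdd N i) (Fin.castAdd m j) -
        B (Fin.natAdd N i) (Fin.castAdd m j)) ^ 2 + ∑ j : Fin m, (scaledToeplitz (N + m) x
        (Fin.natAdd N i) (Fin.natAdd N j) - B (Fin.natAdd N i) (Fin.natAdd N j)) ^ 2) ≤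
        ∑ i : Fin m, (∑ j : Fin N, C ^ 2 * ((N + m : ℕ) : ℝ)⁻¹ +
          ∑ j : Fin m, C ^ 2 * ((N + m : ℕ) : ℝ)⁻¹) := by
      refine Finset.sum_le_sum fun i _ => add_le_add (Finset.sum_le_sum fun j _ => ?_)
        (Finset.sum_le_sum fun j _ => ?_)
      · refine le_trans (le_of_eq ?_) (e2 (((Fin.natAdd N i : Fin (N + m)) : ℤ) -
          ((Fin.castAdd m j : Fin (N + m)) : ℤ)).natAbs)
        simp [hBdef, scaledToeplitz, toeplitz]
      · refine le_trans (le_of_eq ?_) (e2 (((Fin.natAdd N i : Fin (N + m)) : ℤ) -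
          ((Fin.natAdd N j : Fin (N + m)) : ℤ)).natAbs)
        simp [hBdef, scaledToeplitz, toeplitz]
    refine (add_le_add f1 f2).trans ?_
    simp only [Finset.sum_const, Finset.card_univ, Fintype.card_fin, nsmul_eq_mul]
    set a := √(N : ℝ) with ha
    set b := √((N + m : ℕ) : ℝ) with hb
    have hap : 0 < a := Real.sqrt_pos.2 hN
    have hbp : 0 < b := Real.sqrt_pos.2 hn
    have haN : (N : ℝ) = a ^ 2 := (Real.sq_sqrt hN.le).symm
    have hbn : ((N + m : ℕ) : ℝ) = b ^ 2 := (Real.sq_sqrt hn.le).symm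
    have hab : a ≤ b := Real.sqrt_le_sqrt (by rw [hnR]; linarith [Nat.cast_nonneg (α := ℝ) m])
    have hm : (m : ℝ) = b ^ 2 - a ^ 2 := by rw [← haN, ← hbn, hnR]; ring
    rw [haN, hbn, hm]
    -- The corner: after cancellation this is `(b - a) ^ 2 ≤ b ^ 2 - a ^ 2`, valid for `0 < a ≤ b`.
    -- The border contributes the other two of the three units of `C ^ 2 * m`.
    have hmain : a ^ 2 * (a ^ 2 * (C ^ 2 * (a⁻¹ - b⁻¹) ^ 2)) ≤ C ^ 2 * (b ^ 2 - a ^ 2) := by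
      have : a ^ 2 * (a ^ 2 * (C ^ 2 * (a⁻¹ - b⁻¹) ^ 2)) = C ^ 2 * ((a / b) ^ 2 * (b - a) ^ 2) := by
        field_simp
      rw [this]
      refine mul_le_mul_of_nonneg_left ?_ (sq_nonneg C)
      have h1 : (a / b) ^ 2 ≤ 1 := pow_le_one₀ (by positivity) ((div_le_one hbp).2 hab)
      calc (a / b) ^ 2 * (b - a) ^ 2 ≤ 1 * (b - a) ^ 2 :=
            mul_le_mul_of_nonneg_right h1 (sq_nonneg _)
        _ ≤ _ := by nlinarith
    have hr : a ^ 2 * ((b ^ 2 - a ^ 2) * (C ^ 2 * (b ^ 2)⁻¹)) + (b ^ 2 - a ^ 2) * (a ^ 2 *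
        (C ^ 2 * (b ^ 2)⁻¹) + (b ^ 2 - a ^ 2) * (C ^ 2 * (b ^ 2)⁻¹)) ≤
        2 * (C ^ 2 * (b ^ 2 - a ^ 2)) := by
      have h0 : 0 ≤ b ^ 2 - a ^ 2 := by nlinarith
      have : a ^ 2 * ((b ^ 2 - a ^ 2) * (C ^ 2 * (b ^ 2)⁻¹)) + (b ^ 2 - a ^ 2) * (a ^ 2 *
        (C ^ 2 * (b ^ 2)⁻¹) + (b ^ 2 - a ^ 2) * (C ^ 2 * (b ^ 2)⁻¹)) =
        C ^ 2 * (b ^ 2 - a ^ 2) * (a ^ 2 / b ^ 2 + 1) := by field_simp; ring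
      rw [this]
      have h1 : a ^ 2 / b ^ 2 ≤ 1 := (div_le_one (by positivity)).2 (by nlinarith)
      nlinarith [mul_nonneg (sq_nonneg C) h0]
    nlinarith
  have hBchar : charFun (spectralMeasure B hB : Measure ℝ) t =
      ((N : ℝ) / (N + m : ℕ) : ℝ) * charFun (toeplitzMeasure N x : Measure ℝ) t + ((m : ℝ) / (N + m : ℕ) : ℝ) := by
    rw [charFun_spectralMeasure, charFun_spectralMeasure,
      sum_eigenvalues_fromBlocks_zero hSh hB hBdef
        (fun y => Complex.exp ((t * y : ℝ) * Complex.I))]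
    simp only [mul_zero, Complex.ofReal_zero, zero_mul, Complex.exp_zero, mul_one,
      Complex.real_smul]
    have : (N : ℂ) ≠ 0 := by exact_mod_cast hN.ne'
    have : ((N + m : ℕ) : ℂ) ≠ 0 := by exact_mod_cast hn.ne'
    have aux : ∀ E : ℂ, ((N + m : ℕ) : ℂ)⁻¹ * (E + m) =
        N / ((N + m : ℕ) : ℂ) * ((N : ℂ)⁻¹ * E) + m / ((N + m : ℕ) : ℂ) := fun E => by
      field_simp
    simp only [Complex.ofReal_inv, Complex.ofReal_natCast, Complex.ofReal_div]
    exact aux _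
  have hlast : ‖charFun (spectralMeasure B hB : Measure ℝ) t -
      charFun (toeplitzMeasure N x : Measure ℝ) t‖ ≤ 2 * ((m : ℝ) / (N + m : ℕ)) := by
    have hNn : (N : ℝ) / (N + m : ℕ) = 1 - m / (N + m : ℕ) := by rw [eq_sub_iff_add_eq, ← add_div, ← hnR,
      div_self hn.ne']
    have : charFun (spectralMeasure B hB : Measure ℝ) t - charFun (toeplitzMeasure N x :
        Measure ℝ) t = ((m : ℝ) / (N + m : ℕ) : ℝ) * (1 - charFun (toeplitzMeasure N x : Measure ℝ) t) := by
      rw [hBchar, hNn]; simp only [Complex.ofReal_sub, Complex.ofReal_one]; ring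
    rw [this, norm_mul, Complex.norm_real, Real.norm_of_nonneg (by positivity), mul_comm]
    refine mul_le_mul_of_nonneg_right ?_ (by positivity)
    refine (norm_sub_le _ _).trans ?_
    rw [norm_one]
    linarith [norm_charFun_le_one (μ := (toeplitzMeasure N x : Measure ℝ)) t]
  have hmid : |t| * √(((N + m : ℕ) : ℝ)⁻¹ * ∑ i, ∑ j, (scaledToeplitz (N + m) x i j - B i j) ^ 2) ≤
      |t| * √(3 * C ^ 2 * ((m : ℝ) / (N + m : ℕ))) := by
    refine mul_le_mul_of_nonneg_left (Real.sqrt_le_sqrt ?_) (abs_nonneg t)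
    calc ((N + m : ℕ) : ℝ)⁻¹ * _ ≤ ((N + m : ℕ) : ℝ)⁻¹ * (3 * C ^ 2 * m) := by gcongr
      _ = _ := by ring
  calc _ ≤ _ := norm_sub_le_norm_sub_add_norm_sub _
        (charFun (spectralMeasure B hB : Measure ℝ) t) _
    _ ≤ _ := add_le_add (key.trans hmid) hlast

end EmpiricalMeasure

/-! ### Traces of powers as sums over closed paths -/

section TraceExpansion

variable {n : ℕ}

theorem matrix_pow_apply_eq_sum (M : Matrix (Fin n) (Fin n) ℝ) (r : ℕ) (a b : Fin n) :
    (M ^ r) a b = ∑ x : Fin (r + 1) → Fin n,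
      if x 0 = a ∧ x (Fin.last r) = b then ∏ i : Fin r, M (x i.castSucc) (x i.succ) else 0 := by
  induction r generalizing a with
  | zero =>
    rw [← (Equiv.funUnique (Fin 1) (Fin n)).symm.sum_comp]
    simp [Matrix.one_apply, ite_and]
  | succ r ih =>
    rw [pow_succ', Matrix.mul_apply, ← (Fin.consEquiv fun _ : Fin (r + 2) => Fin n).sum_comp,
      Fintype.sum_prod_type]
    simp only [ih, Finset.mul_sum]
    conv_lhs => rw [Finset.sum_comm]
    conv_rhs => rw [Finset.sum_comm]
    refine Finset.sum_congr rfl fun y _ => ?_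
    simp only [Fin.consEquiv_apply, Fin.cons_zero, Fin.prod_univ_succ, Fin.castSucc_zero,
      ← Fin.succ_last, Fin.cons_succ, ← Fin.succ_castSucc, mul_ite, mul_zero, ite_and]
    simp

/-- The closed paths `x 0, …, x r` in `Fin n`. -/
def loops (n r : ℕ) : Finset (Fin (r + 1) → Fin n) :=
  Finset.univ.filter fun x => x 0 = x (Fin.last r)

/-- The steps of a path. -/
def steps {n r : ℕ} (x : Fin (r + 1) → Fin n) (i : Fin r) : ℤ :=
  (x i.castSucc : ℤ) - (x i.succ : ℤ)

/-- The absolute values of the steps of a path. -/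
def label {n r : ℕ} (x : Fin (r + 1) → Fin n) (i : Fin r) : ℕ :=
  (steps x i).natAbs

theorem trace_toeplitz_pow (X : ℕ → ℝ) (r : ℕ) :
    (toeplitz n X ^ r).trace = ∑ x ∈ loops n r, ∏ i, X (label x i) := by
  simp only [Matrix.trace, Matrix.diag_apply, matrix_pow_apply_eq_sum]
  rw [Finset.sum_comm, loops, Finset.sum_filter]
  refine Finset.sum_congr rfl fun x _ => ?_
  simp only [ite_and, Finset.sum_ite_eq, Finset.mem_univ, if_true]
  simp only [eq_comm (a := x (Fin.last r))]
  rfl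

end TraceExpansion

/-! ### Counting integer vectors and paths by their labels -/

section Counting

variable {I : Type*} [Fintype I] [DecidableEq I]

/-- The set of nonzero absolute values of an integer vector. -/
def nonzeroLabels (s : I → ℤ) : Finset ℕ :=
  (Finset.univ.image fun i => (s i).natAbs).erase 0

/-- `a` with a sign. -/
def signed (b : Bool) (a : ℤ) : ℤ := if b then a else -a

theorem exists_signed (a : ℤ) : ∃ b, a = signed b a.natAbs := by
  rcases Int.natAbs_eq a with h | h
  · exact ⟨true, h⟩
  · exact ⟨false, h⟩

theorem exists_enumeration {n q : ℕ} (hn : 0 < n) (L : Finset ℕ) (hL : L.card ≤ q)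
    (hLn : ∀ v ∈ L, v < n) : ∃ e : Fin q → Fin n, ∀ v ∈ L, ∃ c, (e c : ℕ) = v := by
  let g := L.equivFin
  refine ⟨fun c => if h : (c : ℕ) < L.card then ⟨g.symm ⟨c, h⟩, hLn _ (g.symm ⟨c, h⟩).2⟩
    else ⟨0, hn⟩, fun v hv => ⟨⟨g ⟨v, hv⟩, (g ⟨v, hv⟩).2.trans_le hL⟩, ?_⟩⟩
  simp

/-- A coordinate is zero or plus or minus one of `q` listed values: `2 * q + 1` patterns per
coordinate, and `n ^ q` lists. -/
theorem card_le_of_card_nonzeroLabels_le {n q : ℕ} (hn : 0 < n) (S : Finset (I → ℤ))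
    (hS : ∀ s ∈ S, (∀ i, (s i).natAbs < n) ∧ (nonzeroLabels s).card ≤ q) :
    S.card ≤ (2 * q + 1) ^ Fintype.card I * n ^ q := by
  classical
  let dec : (I → Option (Fin q × Bool)) × (Fin q → Fin n) → I → ℤ := fun p i =>
    match p.1 i with
    | none => 0
    | some (c, b) => signed b (p.2 c : ℕ)
  have hsub : S ⊆ Finset.univ.image dec := by
    intro s hs
    obtain ⟨hlt, hq⟩ := hS s hs
    obtain ⟨e, he⟩ := exists_enumeration hn (nonzeroLabels s) hq (fun v hv => by
      obtain ⟨i, -, rfl⟩ := Finset.mem_image.1 (Finset.mem_of_mem_erase hv)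
      exact hlt i)
    have : ∀ i, ∃ o : Option (Fin q × Bool), s i = match o with
        | none => 0
        | some (c, b) => signed b (e c : ℕ) := by
      intro i
      by_cases h0 : s i = 0
      · exact ⟨none, h0⟩
      · obtain ⟨c, hc⟩ := he (s i).natAbs (by simp [nonzeroLabels, h0])
        obtain ⟨b, hb⟩ := exists_signed (s i)
        exact ⟨some (c, b), by simp only [hc]; exact hb⟩
    choose o ho using this
    exact Finset.mem_image.2 ⟨(o, e), Finset.mem_univ _, funext fun i => (ho i).symm⟩
  refine (Finset.card_le_card hsub).trans (Finset.card_image_le.trans ?_)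
  simp only [Finset.card_univ, Fintype.card_prod, Fintype.card_fun, Fintype.card_option,
    Fintype.card_fin, Fintype.card_bool]
  rw [mul_comm q 2]

/-- A linear relation between the labels saves one factor `n`. -/
theorem card_le_of_card_nonzeroLabels_erase_le {n q : ℕ} (hn : 0 < n) (S : Finset (I → ℤ))
    (J : Finset I)
    (hS : ∀ s ∈ S, (∀ i, (s i).natAbs < n) ∧ ∑ i ∈ J, s i = 0 ∧
      ∃ v : ℕ, ((nonzeroLabels s).erase v).card ≤ q ∧
        ∑ i ∈ J with (s i).natAbs = v, s i ≠ 0) :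
    S.card ≤ (2 * q + 3) ^ Fintype.card I * n ^ q := by
  classical
  -- A coordinate is coded as zero, a signed listed label, or a sign marking the distinguished label
  -- `v`, which makes `2 * q + 3` patterns. The value of `v` is not part of the code.
  let val : Option (Fin q × Bool) ⊕ Bool → (Fin q → Fin n) → ℤ → ℤ := fun o e v =>
    match o with
    | Sum.inl none => 0
    | Sum.inl (some (c, b)) => signed b (e c : ℕ)
    | Sum.inr b => signed b v
  have hex : ∀ s ∈ S, ∃ p : (I → Option (Fin q × Bool) ⊕ Bool) × (Fin q → Fin n), ∃ v : ℤ,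
      (∀ i, s i = val (p.1 i) p.2 v) ∧ ∑ i ∈ J with (p.1 i).isRight, val (p.1 i) p.2 1 ≠ 0 := by
    intro s hs
    obtain ⟨hlt, -, v, hq, hv⟩ := hS s hs
    obtain ⟨e, he⟩ := exists_enumeration hn ((nonzeroLabels s).erase v) hq (fun v hv => by
      obtain ⟨i, -, rfl⟩ := Finset.mem_image.1
        (Finset.mem_of_mem_erase (Finset.mem_of_mem_erase hv))
      exact hlt i)
    have : ∀ i, ∃ o : Option (Fin q × Bool) ⊕ Bool, s i = val o e v ∧
        (o.isRight ↔ (s i).natAbs = v) := by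
      intro i
      obtain ⟨b, hb⟩ := exists_signed (s i)
      by_cases hiv : (s i).natAbs = v
      · exact ⟨Sum.inr b, by simp only [val]; rw [← hiv]; exact hb, by simpa using hiv⟩
      by_cases h0 : s i = 0
      · exact ⟨Sum.inl none, h0, by simpa using hiv⟩
      · obtain ⟨c, hc⟩ := he (s i).natAbs (by simp [nonzeroLabels, h0, hiv])
        exact ⟨Sum.inl (some (c, b)), by simp only [val, hc]; exact hb, by simpa using hiv⟩
    choose o ho ho' using this
    refine ⟨(o, e), v, ho, fun h0 => hv ?_⟩
    have hfil : (J.filter fun i => (s i).natAbs = v) = J.filter fun i => (o i).isRight :=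
      Finset.filter_congr fun i _ => (ho' i).symm
    rw [hfil, Finset.sum_congr rfl (g := fun i => (v : ℤ) * val (o i) e 1), ← Finset.mul_sum]
    · simp only at h0
      rw [h0, mul_zero]
    · intro i hi
      have := (Finset.mem_filter.1 hi).2
      rw [ho i]
      rcases hoi : o i with a | b
      · rw [hoi] at this; simp at this
      · simp only [val, signed]; split_ifs <;> ring
  have : Nonempty (Fin n) := ⟨⟨0, hn⟩⟩
  choose! f v hf hf' using hex
  -- Vectors with the same code differ by a multiple of the sign pattern on the marked coordinates.
  -- The signs have nonzero sum over `J`, so the relation `∑ i ∈ J, s i = 0` forces the multiple to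
  -- vanish.
  have hinj : Set.InjOn f (S : Set (I → ℤ)) := by
    intro s hs s' hs' hss
    have hJ : ∑ i ∈ J, s i - ∑ i ∈ J, s' i = 0 := by rw [(hS s hs).2.1, (hS s' hs').2.1, sub_zero]
    have hdiff : ∀ i, s i - s' i = if ((f s).1 i).isRight
        then (v s - v s') * val ((f s).1 i) (f s).2 1 else 0 := by
      intro i
      rw [hf s hs i, hf s' hs' i, ← hss]
      rcases (f s).1 i with (_ | ⟨c, b⟩) | b
      · simp [val]
      · simp [val]
      · simp only [val, signed, Sum.isRight_inr, if_true]; split_ifs <;> ring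
    have hv : v s = v s' := by
      rw [← Finset.sum_sub_distrib] at hJ
      simp only [hdiff] at hJ
      rw [← Finset.sum_filter, ← Finset.mul_sum] at hJ
      exact sub_eq_zero.1 ((mul_eq_zero.1 hJ).resolve_right (hf' s hs))
    funext i
    have := hdiff i
    rw [hv, sub_self, zero_mul, ite_self] at this
    exact sub_eq_zero.1 this
  refine (Finset.card_le_card_of_injOn f (fun _ _ => Finset.mem_coe.2 (Finset.mem_univ _)) hinj).trans ?_
  simp only [Finset.card_univ, Fintype.card_prod, Fintype.card_fun, Fintype.card_option,
    Fintype.card_fin, Fintype.card_bool, Fintype.card_sum]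
  rw [mul_comm q 2]

variable {n r : ℕ}

theorem natAbs_steps_lt (x : Fin (r + 1) → Fin n) (i : Fin r) : (steps x i).natAbs < n := by
  have := (x i.castSucc).2
  have := (x i.succ).2
  simp only [steps]
  omega

theorem sum_steps (x : Fin (r + 1) → Fin n) :
    ∑ i, steps x i = (x 0 : ℤ) - (x (Fin.last r) : ℤ) := by
  induction r with
  | zero => simp
  | succ r ih =>
    rw [Fin.sum_univ_succ]
    have := ih (fun i => x i.succ)
    have h2 : ∀ i : Fin r, steps x i.succ = steps (fun i => x i.succ) i := fun i => by
      simp [steps]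
    simp only [h2]
    rw [this]
    simp [steps]

theorem sum_steps_eq_zero {x : Fin (r + 1) → Fin n} (hx : x ∈ loops n r) :
    ∑ i, steps x i = 0 := by
  rw [sum_steps, (Finset.mem_filter.1 hx).2, sub_self]

/-- A path is determined by its starting point and its steps. -/
theorem eq_of_steps_eq {x y : Fin (r + 1) → Fin n} (h0 : x 0 = y 0) (h : steps x = steps y) :
    x = y := by
  funext i
  induction i using Fin.induction with
  | zero => exact h0
  | succ i ih =>
    have := congrFun h i
    simp only [steps, ih] at this
    exact Fin.ext (by omega)

theorem card_paths_le (S : Finset (Fin (r + 1) → Fin n)) :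
    S.card ≤ n * (S.image steps).card := by
  have : S.card ≤ ((Finset.univ : Finset (Fin n)) ×ˢ (S.image steps)).card := by
    refine Finset.card_le_card_of_injOn (fun x => (x 0, steps x)) (fun x hx => ?_)
      (fun x _ y _ h => ?_)
    · simp only [Finset.coe_product, Set.mem_prod, Finset.coe_univ, Set.mem_univ, true_and]
      exact Finset.mem_coe.2 (Finset.mem_image_of_mem _ hx)
    · simp only [Prod.mk.injEq] at h
      exact eq_of_steps_eq h.1 h.2
  simpa using this

theorem card_path_pairs_le (S : Finset ((Fin (r + 1) → Fin n) × (Fin (r + 1) → Fin n))) :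
    S.card ≤ n * n * (S.image fun p => Sum.elim (steps p.1) (steps p.2)).card := by
  have : S.card ≤ ((Finset.univ : Finset (Fin n × Fin n)) ×ˢ
      (S.image fun p => Sum.elim (steps p.1) (steps p.2))).card := by
    refine Finset.card_le_card_of_injOn
      (fun p => ((p.1 0, p.2 0), Sum.elim (steps p.1) (steps p.2))) (fun x hx => ?_)
      (fun x _ y _ h => ?_)
    · simp only [Finset.coe_product, Set.mem_prod, Finset.coe_univ, Set.mem_univ, true_and]
      exact Finset.mem_coe.2 (Finset.mem_image_of_mem _ hx)
    · simp only [Prod.mk.injEq] at h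
      refine Prod.ext (eq_of_steps_eq h.1.1 (funext fun i => ?_))
        (eq_of_steps_eq h.1.2 (funext fun i => ?_))
      · exact congrFun h.2 (Sum.inl i)
      · exact congrFun h.2 (Sum.inr i)
  simpa using this

end Counting

/-! ### Multiplicities of labels -/

section Labels

variable {I : Type*} [Fintype I]

/-- The number of indices that carry the same label as `i`. -/
def multiplicity (l : I → ℕ) (i : I) : ℕ :=
  (Finset.univ.filter fun j => l j = l i).card

theorem card_eq_sum_card_labelClass (l : I → ℕ) :
    Fintype.card I = ∑ v ∈ Finset.univ.image l, (Finset.univ.filter fun j => l j = v).card := by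
  rw [← Finset.card_univ]
  exact Finset.card_eq_sum_card_image l _

theorem two_mul_card_image_le {l : I → ℕ} (h : ∀ i, 2 ≤ multiplicity l i) :
    2 * (Finset.univ.image l).card ≤ Fintype.card I := by
  rw [card_eq_sum_card_labelClass l, mul_comm, ← smul_eq_mul]
  refine Finset.card_nsmul_le_sum _ _ _ fun v hv => ?_
  obtain ⟨i, -, rfl⟩ := Finset.mem_image.1 hv
  exact h i

theorem two_mul_card_image_lt {l : I → ℕ} (h : ∀ i, 2 ≤ multiplicity l i)
    (h' : ∃ i, multiplicity l i ≠ 2) :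
    2 * (Finset.univ.image l).card < Fintype.card I := by
  obtain ⟨i₀, hi₀⟩ := h'
  rw [card_eq_sum_card_labelClass l, mul_comm, ← smul_eq_mul, ← Finset.sum_const]
  refine Finset.sum_lt_sum (fun v hv => ?_) ⟨l i₀, by simp, lt_of_le_of_ne (h i₀) (Ne.symm hi₀)⟩
  obtain ⟨i, -, rfl⟩ := Finset.mem_image.1 hv
  exact h i

theorem two_mul_card_image_eq {l : I → ℕ} (h : ∀ i, multiplicity l i = 2) :
    2 * (Finset.univ.image l).card = Fintype.card I := by
  rw [card_eq_sum_card_labelClass l, mul_comm, ← smul_eq_mul, ← Finset.sum_const]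
  refine Finset.sum_congr rfl fun v hv => ?_
  obtain ⟨i, -, rfl⟩ := Finset.mem_image.1 hv
  exact (h i).symm

end Labels

/-! ### Expectations of products of bounded noise -/

/-- An i.i.d. sequence of centered random variables with unit variance that are bounded by `C`. -/
structure IsBoundedNoise {Ω : Type*} [MeasurableSpace Ω] (Y : ℕ → Ω → ℝ) (P : Measure Ω)
    (C : ℝ) : Prop where
  measurable : ∀ i, Measurable (Y i)
  indep : iIndepFun Y P
  ident : ∀ i, IdentDistrib (Y i) (Y 1) P P
  bound : ∀ i ω, |Y i ω| ≤ C
  mean : ∫ ω, Y 1 ω ∂P = 0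
  var : ∫ ω, Y 1 ω ^ 2 ∂P = 1

section Expectation

variable {Ω : Type*} [MeasurableSpace Ω] {P : Measure Ω} [IsProbabilityMeasure P]
  {Y : ℕ → Ω → ℝ} {C : ℝ} {I : Type*} [Fintype I]

theorem IsBoundedNoise.integrable_prod (h : IsBoundedNoise Y P C) (l : I → ℕ) :
    Integrable (fun ω => ∏ i, Y (l i) ω) P := by
  refine Integrable.of_bound (C := C ^ Fintype.card I)
    (Finset.measurable_fun_prod _ fun i _ => h.measurable _).aestronglyMeasurable
    (Eventually.of_forall fun ω => ?_)
  rw [norm_prod, ← Finset.card_univ, ← Finset.prod_const]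
  exact Finset.prod_le_prod (fun _ _ => norm_nonneg _) fun i _ => h.bound _ _

theorem IsBoundedNoise.abs_integral_prod_le (h : IsBoundedNoise Y P C) (l : I → ℕ) :
    |∫ ω, ∏ i, Y (l i) ω ∂P| ≤ C ^ Fintype.card I := by
  have := norm_integral_le_of_norm_le_const (μ := P) (f := fun ω => ∏ i, Y (l i) ω)
    (C := C ^ Fintype.card I) (Eventually.of_forall fun ω => by
      rw [norm_prod, ← Finset.card_univ, ← Finset.prod_const]
      exact Finset.prod_le_prod (fun _ _ => norm_nonneg _) fun i _ => h.bound _ _)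
  simpa using this

/-- Equal labels are grouped into powers of distinct independent variables, each distributed as `Y
1`. -/
theorem IsBoundedNoise.integral_prod (h : IsBoundedNoise Y P C) (l : I → ℕ) :
    ∫ ω, ∏ i, Y (l i) ω ∂P = ∏ v ∈ Finset.univ.image l,
      ∫ ω, Y 1 ω ^ (Finset.univ.filter fun i => l i = v).card ∂P := by
  have h1 : ∀ ω, ∏ i, Y (l i) ω = ∏ v : (Finset.univ.image l : Finset ℕ),
      Y v ω ^ (Finset.univ.filter fun i => l i = v).card := by
    intro ω
    rw [Finset.prod_comp (fun v => Y v ω) l]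
    exact (Finset.prod_coe_sort (Finset.univ.image l) (fun v : ℕ =>
      Y v ω ^ (Finset.univ.filter fun i => l i = v).card)).symm
  simp only [h1]
  have hind : iIndepFun (fun v : (Finset.univ.image l : Finset ℕ) => Y v) P :=
    h.indep.precomp Subtype.val_injective
  have hprod := hind.integral_fun_prod_comp (f := fun (v : (Finset.univ.image l : Finset ℕ))
      (x : ℝ) => x ^ (Finset.univ.filter fun i => l i = (v : ℕ)).card)
    (fun v => (h.measurable _).aemeasurable) (fun v => by fun_prop)
  rw [hprod, ← Finset.prod_coe_sort (Finset.univ.image l) (fun v : ℕ =>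
    ∫ ω, Y 1 ω ^ (Finset.univ.filter fun i => l i = v).card ∂P)]
  refine Fintype.prod_congr _ _ fun v => ?_
  have := (h.ident v).comp (u := fun x : ℝ => x ^ (Finset.univ.filter fun i => l i = v).card)
    (by fun_prop)
  exact this.integral_eq

theorem IsBoundedNoise.integral_prod_eq_zero (h : IsBoundedNoise Y P C) {l : I → ℕ}
    (hl : ∃ i, multiplicity l i = 1) : ∫ ω, ∏ i, Y (l i) ω ∂P = 0 := by
  obtain ⟨i, hi⟩ := hl
  rw [h.integral_prod]
  refine Finset.prod_eq_zero (Finset.mem_image_of_mem l (Finset.mem_univ i)) ?_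
  rw [multiplicity] at hi
  simp [hi, h.mean]

theorem IsBoundedNoise.integral_prod_eq_one (h : IsBoundedNoise Y P C) {l : I → ℕ}
    (hl : ∀ i, multiplicity l i = 2) : ∫ ω, ∏ i, Y (l i) ω ∂P = 1 := by
  rw [h.integral_prod]
  refine Finset.prod_eq_one fun v hv => ?_
  obtain ⟨i, -, rfl⟩ := Finset.mem_image.1 hv
  have := hl i
  rw [multiplicity] at this
  simp [this, h.var]

theorem IsBoundedNoise.integral_prod_mul_prod (h : IsBoundedNoise Y P C) {l l' : I → ℕ}
    (hl : ∀ i j, l i ≠ l' j) :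
    ∫ ω, (∏ i, Y (l i) ω) * ∏ i, Y (l' i) ω ∂P =
      (∫ ω, ∏ i, Y (l i) ω ∂P) * ∫ ω, ∏ i, Y (l' i) ω ∂P := by
  have h1 := h.integral_prod (Sum.elim l l')
  simp only [Fintype.prod_sum_type, Sum.elim_inl, Sum.elim_inr] at h1
  rw [h1, h.integral_prod, h.integral_prod]
  have himg : Finset.univ.image (Sum.elim l l') = Finset.univ.image l ∪ Finset.univ.image l' := by
    ext v; simp [Sum.exists]
  have hdisj : Disjoint (Finset.univ.image l) (Finset.univ.image l') := by
    rw [Finset.disjoint_left]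
    rintro v hv hv'
    obtain ⟨i, -, rfl⟩ := Finset.mem_image.1 hv
    obtain ⟨j, -, hj⟩ := Finset.mem_image.1 hv'
    exact hl i j hj.symm
  have hcard : ∀ v, (Finset.univ.filter fun i => Sum.elim l l' i = v).card =
      (Finset.univ.filter fun i => l i = v).card + (Finset.univ.filter fun i => l' i = v).card := by
    intro v
    rw [Finset.card_filter, Fintype.sum_sum_type, Finset.card_filter, Finset.card_filter]
    rfl
  rw [himg, Finset.prod_union hdisj]
  congr 1
  · refine Finset.prod_congr rfl fun v hv => ?_
    rw [hcard, Finset.filter_false_of_mem (p := fun i => l' i = v), Finset.card_empty, add_zero]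
    rintro j - rfl
    exact Finset.disjoint_left.1 hdisj hv (Finset.mem_image_of_mem _ (Finset.mem_univ _))
  · refine Finset.prod_congr rfl fun v hv => ?_
    rw [hcard, Finset.filter_false_of_mem (p := fun i => l i = v), Finset.card_empty, zero_add]
    rintro j - rfl
    exact Finset.disjoint_left.1 hdisj (Finset.mem_image_of_mem _ (Finset.mem_univ _)) hv

end Expectation

/-! ### Counting loops and linked pairs of loops -/

section LoopCounts

variable {n r : ℕ}

/-- The loops in which every label occurs exactly twice. -/
def pairLoops (n r : ℕ) : Finset (Fin (r + 1) → Fin n) :=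
  (loops n r).filter fun x => ∀ i, multiplicity (label x) i = 2

theorem multiplicity_pos {I : Type*} [Fintype I] (l : I → ℕ) (i : I) : 0 < multiplicity l i :=
  Finset.card_pos.2 ⟨i, by simp⟩

theorem nonzeroLabels_subset {I : Type*} [Fintype I] (s : I → ℤ) :
    nonzeroLabels s ⊆ Finset.univ.image fun i => (s i).natAbs :=
  Finset.erase_subset _ _

/-- Paths with few distinct labels are few. -/
theorem card_paths_le_of_card_labels_le (hn : 0 < n) {q : ℕ} (S : Finset (Fin (r + 1) → Fin n))
    (hS : ∀ x ∈ S, (Finset.univ.image (label x)).card ≤ q) :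
    S.card ≤ (2 * q + 1) ^ r * n ^ (q + 1) := by
  refine (card_paths_le S).trans ?_
  have := card_le_of_card_nonzeroLabels_le (q := q) hn (S.image steps) (fun s hs => by
    obtain ⟨x, hx, rfl⟩ := Finset.mem_image.1 hs
    exact ⟨natAbs_steps_lt x, (Finset.card_le_card (nonzeroLabels_subset _)).trans (hS x hx)⟩)
  rw [Fintype.card_fin] at this
  calc n * _ ≤ n * ((2 * q + 1) ^ r * n ^ q) := Nat.mul_le_mul_left _ this
    _ = _ := by ring

/-- Pairs of loops that share a label and in which no label is isolated. -/
def linkedLoopPairs (n r : ℕ) : Finset ((Fin (r + 1) → Fin n) × (Fin (r + 1) → Fin n)) :=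
  (loops n r ×ˢ loops n r).filter fun p =>
    (∀ i, 2 ≤ multiplicity (Sum.elim (label p.1) (label p.2)) i) ∧
      ∃ i j, label p.1 i = label p.2 j

theorem card_linkedLoopPairs_le (hn : 0 < n) :
    (linkedLoopPairs n r).card ≤ 2 * (2 * r + 3) ^ (2 * r) * n ^ (r + 1) := by
  classical
  rcases Nat.eq_zero_or_pos r with rfl | hr
  · have : linkedLoopPairs n 0 = ∅ := by
      refine Finset.filter_eq_empty_iff.2 ?_
      rintro p - ⟨-, i, -⟩
      exact i.elim0
    rw [this]; simp
  set L := linkedLoopPairs n r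
  let st : ((Fin (r + 1) → Fin n) × (Fin (r + 1) → Fin n)) → (Fin r ⊕ Fin r → ℤ) :=
    fun p => Sum.elim (steps p.1) (steps p.2)
  have hlt : ∀ p i, (st p i).natAbs < n := by
    rintro p (i | i)
    · exact natAbs_steps_lt p.1 i
    · exact natAbs_steps_lt p.2 i
  have hst : ∀ p, (fun i => (st p i).natAbs) = Sum.elim (label p.1) (label p.2) := by
    intro p; funext i; rcases i with i | i <;> rfl
  have hle : ∀ p ∈ L, 2 * (Finset.univ.image fun i => (st p i).natAbs).card ≤ 2 * r := by
    intro p hp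
    rw [hst]
    have := two_mul_card_image_le (Finset.mem_filter.1 hp).2.1
    rw [Fintype.card_sum, Fintype.card_fin] at this
    omega
  -- No isolated label leaves at most `r` labels. Either at most `r - 1` of them are nonzero, or
  -- there are `r`, all nonzero and each occurring exactly twice. Both cases leave two starting
  -- points and `r - 1` free labels.
  set L1 := L.filter fun p => (nonzeroLabels (st p)).card ≤ r - 1
  set L2 := L.filter fun p => ¬ (nonzeroLabels (st p)).card ≤ r - 1
  have hL : L.card = L1.card + L2.card := (Finset.card_filter_add_card_filter_not _).symm
  have hr1 : n * n * n ^ (r - 1) = n ^ (r + 1) := by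
    obtain ⟨k, rfl⟩ : ∃ k, r = k + 1 := ⟨r - 1, by omega⟩
    simp; ring
  have h1 : L1.card ≤ (2 * r + 3) ^ (2 * r) * n ^ (r + 1) := by
    refine (card_path_pairs_le L1).trans ?_
    have := card_le_of_card_nonzeroLabels_le (q := r - 1) hn (L1.image st) (fun s hs => by
      obtain ⟨p, hp, rfl⟩ := Finset.mem_image.1 hs
      exact ⟨hlt p, (Finset.mem_filter.1 hp).2⟩)
    rw [Fintype.card_sum, Fintype.card_fin, ← two_mul] at this
    calc n * n * _ ≤ n * n * ((2 * (r - 1) + 1) ^ (2 * r) * n ^ (r - 1)) :=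
          Nat.mul_le_mul_left _ this
      _ = (2 * (r - 1) + 1) ^ (2 * r) * n ^ (r + 1) := by rw [← hr1]; ring
      _ ≤ _ := Nat.mul_le_mul_right _ (Nat.pow_le_pow_left (by omega) _)
  have h2 : L2.card ≤ (2 * r + 3) ^ (2 * r) * n ^ (r + 1) := by
    refine (card_path_pairs_le L2).trans ?_
    -- The relation is that the first loop closes. The shared label occurs once in each loop, so a
    -- single nonzero step of the first loop carries it, and that step is determined by the others.
    have := card_le_of_card_nonzeroLabels_erase_le (q := r - 1) hn (L2.image st)
      (Finset.univ.filter fun i => i.isLeft) (fun s hs => by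
      obtain ⟨p, hp, rfl⟩ := Finset.mem_image.1 hs
      obtain ⟨hpL, hp2⟩ := Finset.mem_filter.1 hp
      obtain ⟨hloops, hmult, i, j, hij⟩ := Finset.mem_filter.1 hpL
      have hbound := hle p hpL
      have hcard := Finset.card_le_card (nonzeroLabels_subset (st p))
      have heq : nonzeroLabels (st p) = Finset.univ.image fun i => (st p i).natAbs :=
        Finset.eq_of_subset_of_card_le (nonzeroLabels_subset (st p)) (by omega)
      have hmult2 : ∀ i, multiplicity (Sum.elim (label p.1) (label p.2)) i = 2 := by
        by_contra hcon
        push Not at hcon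
        have := two_mul_card_image_lt hmult hcon
        rw [← hst, Fintype.card_sum, Fintype.card_fin] at this
        omega
      have hmem : label p.1 i ∈ nonzeroLabels (st p) := by
        rw [heq]; exact Finset.mem_image.2 ⟨Sum.inl i, Finset.mem_univ _, rfl⟩
      refine ⟨hlt p, ?_, label p.1 i, ?_, ?_⟩
      · rw [Finset.sum_filter, Fintype.sum_sum_type]
        simpa [st] using sum_steps_eq_zero (Finset.mem_product.1 hloops).1
      · rw [Finset.card_erase_of_mem hmem]; omega
      · have hcls : (Finset.univ.filter fun k => Sum.elim (label p.1) (label p.2) k = label p.1 i) =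
            {Sum.inl i, Sum.inr j} := by
          symm
          refine Finset.eq_of_subset_of_card_le (fun k hk => ?_) ?_
          · simp only [Finset.mem_insert, Finset.mem_singleton] at hk
            rcases hk with rfl | rfl
            · simp
            · simp [hij]
          · rw [Finset.card_pair (by simp)]
            exact (hmult2 (Sum.inl i)).le
        have : (Finset.univ.filter fun i : Fin r ⊕ Fin r => i.isLeft).filter
            (fun k => (st p k).natAbs = label p.1 i) = {Sum.inl i} := by
          ext k
          have hk := Finset.ext_iff.1 hcls k
          simp only [Finset.mem_filter, Finset.mem_univ, true_and, Finset.mem_insert,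
            Finset.mem_singleton] at hk ⊢
          rw [congrFun (hst p) k, hk]
          rcases k with k | k <;> simp
        rw [this, Finset.sum_singleton]
        intro h0
        refine (Finset.mem_erase.1 hmem).1 ?_
        simp only [label, Int.natAbs_eq_zero]
        exact h0)
    rw [Fintype.card_sum, Fintype.card_fin, ← two_mul] at this
    calc n * n * _ ≤ n * n * ((2 * (r - 1) + 3) ^ (2 * r) * n ^ (r - 1)) :=
          Nat.mul_le_mul_left _ this
      _ = (2 * (r - 1) + 3) ^ (2 * r) * n ^ (r + 1) := by rw [← hr1]; ring
      _ ≤ _ := Nat.mul_le_mul_right _ (Nat.pow_le_pow_left (by omega) _)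
  rw [hL]
  calc _ ≤ (2 * r + 3) ^ (2 * r) * n ^ (r + 1) + (2 * r + 3) ^ (2 * r) * n ^ (r + 1) :=
        add_le_add h1 h2
    _ = _ := by ring

end LoopCounts

/-! ### Mean and variance of traces, almost sure convergence of moments -/

section TraceMoments

variable {Ω : Type*} [MeasurableSpace Ω] {P : Measure Ω} [IsProbabilityMeasure P]
  {Y : ℕ → Ω → ℝ} {C : ℝ}

theorem pairLoops_eq_empty_of_odd {n r : ℕ} (hr : Odd r) : pairLoops n r = ∅ := by
  refine Finset.filter_eq_empty_iff.2 fun x _ h => ?_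
  have := two_mul_card_image_eq h
  rw [Fintype.card_fin] at this
  exact Nat.not_even_iff_odd.2 hr ⟨_, by rw [← this]; ring⟩

theorem one_lt_multiplicity_of_ne_one {I : Type*} [Fintype I] {l : I → ℕ}
    (h : ¬ ∃ i, multiplicity l i = 1) (i : I) : 2 ≤ multiplicity l i := by
  have h1 := multiplicity_pos l i
  have h2 : multiplicity l i ≠ 1 := fun h2 => h ⟨i, h2⟩
  omega

/-- The loops with no isolated label that are not pair loops. -/
theorem card_degenerateLoops_le {n : ℕ} (hn : 0 < n) (r : ℕ) :
    ((loops n r).filter fun x => (∀ i, 2 ≤ multiplicity (label x) i) ∧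
      ¬ ∀ i, multiplicity (label x) i = 2).card ≤ (2 * r + 1) ^ r * n ^ ((r + 1) / 2) := by
  rcases Nat.eq_zero_or_pos r with rfl | hr
  · rw [Finset.card_eq_zero.2]
    · exact Nat.zero_le _
    · refine Finset.filter_eq_empty_iff.2 fun x _ h => h.2 fun i => i.elim0
  -- Fewer than `r / 2` labels means at most `(r - 1) / 2` of them in integer division; the starting
  -- point adds one to the exponent.
  refine (card_paths_le_of_card_labels_le (q := (r - 1) / 2) hn _ fun x hx => ?_).trans ?_
  · obtain ⟨-, h1, h2⟩ := Finset.mem_filter.1 hx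
    push Not at h2
    have := two_mul_card_image_lt h1 h2
    rw [Fintype.card_fin] at this
    omega
  · rw [show (r - 1) / 2 + 1 = (r + 1) / 2 by omega]
    exact Nat.mul_le_mul_right _ (Nat.pow_le_pow_left (by omega) _)

theorem IsBoundedNoise.bound_nonneg (h : IsBoundedNoise Y P C) : 0 ≤ C := by
  have : Nonempty Ω := by
    by_contra hne
    rw [not_nonempty_iff] at hne
    have := measure_univ (μ := P)
    simp [Measure.eq_zero_of_isEmpty] at this
  obtain ⟨ω⟩ := this
  exact (abs_nonneg _).trans (h.bound 0 ω)

theorem IsBoundedNoise.integrable_trace (h : IsBoundedNoise Y P C) (n r : ℕ) :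
    Integrable (fun ω => (toeplitz n (fun k => Y k ω) ^ r).trace) P := by
  simp only [trace_toeplitz_pow]
  exact integrable_finsetSum _ fun x _ => h.integrable_prod _

/-- Loops with an isolated label contribute zero and pair loops contribute one; the error comes from
the few degenerate loops, each bounded by `C ^ r`. -/
theorem IsBoundedNoise.abs_integral_trace_sub_le (h : IsBoundedNoise Y P C) {n : ℕ} (hn : 0 < n)
    (r : ℕ) :
    |∫ ω, (toeplitz n (fun k => Y k ω) ^ r).trace ∂P - (pairLoops n r).card| ≤
      C ^ r * (2 * r + 1) ^ r * n ^ ((r + 1) / 2) := by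
  have hC := h.bound_nonneg
  simp only [trace_toeplitz_pow]
  rw [integral_finsetSum _ fun x _ => h.integrable_prod _, pairLoops, Finset.card_filter,
    Nat.cast_sum, ← Finset.sum_sub_distrib]
  have hterm : ∀ x ∈ loops n r, |∫ ω, ∏ i, Y (label x i) ω ∂P -
      ((if ∀ i, multiplicity (label x) i = 2 then 1 else 0 : ℕ) : ℝ)| ≤
      if (∀ i, 2 ≤ multiplicity (label x) i) ∧ ¬ ∀ i, multiplicity (label x) i = 2
        then C ^ r else 0 := by
    intro x _
    by_cases h2 : ∀ i, multiplicity (label x) i = 2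
    · rw [h.integral_prod_eq_one h2]; simp [h2]
    · by_cases h1 : ∃ i, multiplicity (label x) i = 1
      · rw [h.integral_prod_eq_zero h1]
        simp only [h2, if_false]
        simp only [Nat.cast_zero, sub_zero, abs_zero]
        split_ifs <;> positivity
      · have := h.abs_integral_prod_le (label x)
        rw [Fintype.card_fin] at this
        simpa [h2, one_lt_multiplicity_of_ne_one h1] using this
  refine (Finset.abs_sum_le_sum_abs _ _).trans ((Finset.sum_le_sum hterm).trans ?_)
  rw [← Finset.sum_filter, Finset.sum_const, nsmul_eq_mul, mul_comm, mul_assoc]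
  refine mul_le_mul_of_nonneg_left ?_ (by positivity)
  exact_mod_cast card_degenerateLoops_le hn r

/-- A covariance vanishes by independence if the two loops share no label, and by centering if some
label is isolated in the pair. Only linked pairs remain, and the bound is smaller by a factor `n`
than the squared normalisation `n ^ (r + 2)`. -/
theorem IsBoundedNoise.integral_sq_trace_sub_le (h : IsBoundedNoise Y P C) {n : ℕ} (hn : 0 < n)
    (r : ℕ) :
    ∫ ω, ((toeplitz n (fun k => Y k ω) ^ r).trace -
      ∫ ω', (toeplitz n (fun k => Y k ω') ^ r).trace ∂P) ^ 2 ∂P ≤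
      2 * C ^ (2 * r) * (2 * (2 * r + 3) ^ (2 * r)) * n ^ (r + 1) := by
  have hC := h.bound_nonneg
  set f : (Fin (r + 1) → Fin n) → Ω → ℝ := fun x ω => ∏ i, Y (label x i) ω
  have hf : ∀ x, Integrable (f x) P := fun x => h.integrable_prod _
  have hff : ∀ x y, Integrable (fun ω => f x ω * f y ω) P := by
    intro x y
    have := h.integrable_prod (Sum.elim (label x) (label y))
    simpa only [Fintype.prod_sum_type, Sum.elim_inl, Sum.elim_inr] using this
  set e : (Fin (r + 1) → Fin n) → ℝ := fun x => ∫ ω, f x ω ∂P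
  have hint : ∀ x y, Integrable (fun ω => (f x ω - e x) * (f y ω - e y)) P := by
    intro x y
    have : (fun ω => (f x ω - e x) * (f y ω - e y)) =
        fun ω => f x ω * f y ω - e y * f x ω - e x * f y ω + e x * e y := by
      funext ω; ring
    rw [this]
    exact ((((hff x y).sub ((hf x).const_mul _)).sub ((hf y).const_mul _)).add
      (integrable_const _))
  have hcov : ∀ x y, ∫ ω, (f x ω - e x) * (f y ω - e y) ∂P =
      ∫ ω, f x ω * f y ω ∂P - e x * e y := by
    intro x y
    have : (fun ω => (f x ω - e x) * (f y ω - e y)) =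
        fun ω => f x ω * f y ω - e y * f x ω - e x * f y ω + e x * e y := by
      funext ω; ring
    have i1 : Integrable (fun ω => f x ω * f y ω - e y * f x ω) P :=
      (hff x y).sub ((hf x).const_mul _)
    have i2 : Integrable (fun ω => f x ω * f y ω - e y * f x ω - e x * f y ω) P :=
      i1.sub ((hf y).const_mul _)
    rw [this, integral_add i2 (integrable_const _), integral_sub i1 ((hf y).const_mul _),
      integral_sub (hff x y) ((hf x).const_mul _), integral_const_mul, integral_const_mul]
    simp only [integral_const, probReal_univ, one_smul]
    change _ - e y * e x - e x * e y + e x * e y = _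
    ring
  have hexp : ∀ ω, ((toeplitz n (fun k => Y k ω) ^ r).trace -
      ∫ ω', (toeplitz n (fun k => Y k ω') ^ r).trace ∂P) ^ 2 =
      ∑ p ∈ loops n r ×ˢ loops n r, (f p.1 ω - e p.1) * (f p.2 ω - e p.2) := by
    intro ω
    simp only [trace_toeplitz_pow]
    rw [integral_finsetSum _ fun x _ => h.integrable_prod _, ← Finset.sum_sub_distrib, sq,
      Finset.sum_mul_sum, Finset.sum_product]
  simp only [hexp]
  rw [integral_finsetSum _ fun p _ => hint p.1 p.2]
  simp only [hcov]
  have hterm : ∀ p ∈ loops n r ×ˢ loops n r, ∫ ω, f p.1 ω * f p.2 ω ∂P - e p.1 * e p.2 ≤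
      if (∀ i, 2 ≤ multiplicity (Sum.elim (label p.1) (label p.2)) i) ∧
        ∃ i j, label p.1 i = label p.2 j then 2 * C ^ (2 * r) else 0 := by
    intro p _
    by_cases h1 : ∃ i j, label p.1 i = label p.2 j
    swap
    · push Not at h1
      rw [h.integral_prod_mul_prod h1, sub_self]
      split_ifs <;> positivity
    have hprod : ∫ ω, f p.1 ω * f p.2 ω ∂P =
        ∫ ω, ∏ i, Y (Sum.elim (label p.1) (label p.2) i) ω ∂P := by
      simp only [Fintype.prod_sum_type, Sum.elim_inl, Sum.elim_inr, f]
    have hm : ∀ v, (Finset.univ.filter fun i => Sum.elim (label p.1) (label p.2) i = v).card =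
        (Finset.univ.filter fun i => label p.1 i = v).card +
          (Finset.univ.filter fun i => label p.2 i = v).card := by
      intro v
      rw [Finset.card_filter, Fintype.sum_sum_type, Finset.card_filter, Finset.card_filter]
      rfl
    by_cases h2 : ∃ i, multiplicity (Sum.elim (label p.1) (label p.2)) i = 1
    · have h3 : e p.1 * e p.2 = 0 := by
        obtain ⟨i | i, hi⟩ := h2
        · have : multiplicity (label p.1) i = 1 := by
            have hpos := multiplicity_pos (label p.1) i
            have hi' : multiplicity (label p.1) i +
                (Finset.univ.filter fun j => label p.2 j = label p.1 i).card = 1 :=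
              (hm _).symm.trans hi
            omega
          rw [show e p.1 = 0 from h.integral_prod_eq_zero ⟨i, this⟩, zero_mul]
        · have : multiplicity (label p.2) i = 1 := by
            have hpos := multiplicity_pos (label p.2) i
            have hi' : (Finset.univ.filter fun j => label p.1 j = label p.2 i).card +
                multiplicity (label p.2) i = 1 :=
              (hm _).symm.trans hi
            omega
          rw [show e p.2 = 0 from h.integral_prod_eq_zero ⟨i, this⟩, mul_zero]
      rw [hprod, h.integral_prod_eq_zero h2, h3, sub_self]
      split_ifs <;> positivity
    · rw [if_pos ⟨one_lt_multiplicity_of_ne_one h2, h1⟩, hprod]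
      have b1 := h.abs_integral_prod_le (Sum.elim (label p.1) (label p.2))
      have b2 := h.abs_integral_prod_le (label p.1)
      have b3 := h.abs_integral_prod_le (label p.2)
      rw [Fintype.card_sum, Fintype.card_fin, ← two_mul] at b1
      rw [Fintype.card_fin] at b2 b3
      have b4 : |e p.1 * e p.2| ≤ C ^ (2 * r) := by
        rw [abs_mul, two_mul, pow_add]
        exact mul_le_mul b2 b3 (abs_nonneg _) (by positivity)
      linarith [le_abs_self (∫ ω, ∏ i, Y (Sum.elim (label p.1) (label p.2) i) ω ∂P),
        neg_abs_le (e p.1 * e p.2)]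
  refine (Finset.sum_le_sum hterm).trans ?_
  rw [← Finset.sum_filter, Finset.sum_const, nsmul_eq_mul, mul_comm, mul_assoc (2 * C ^ (2 * r))]
  refine mul_le_mul_of_nonneg_left ?_ (by positivity)
  exact_mod_cast card_linkedLoopPairs_le (r := r) hn

/-- The moments of the limit law: `M k` is the moment of order `2k`, the odd moments vanish. -/
def evenMoments (M : ℕ → ℝ) (r : ℕ) : ℝ := if Even r then M (r / 2) else 0

theorem integral_pow_toeplitzMeasure (n : ℕ) [NeZero n] (x : ℕ → ℝ) (r : ℕ) :
    ∫ t, t ^ r ∂(toeplitzMeasure n x : Measure ℝ) =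
      (n * √(n : ℝ) ^ r)⁻¹ * (toeplitz n x ^ r).trace := by
  rw [integral_pow_spectralMeasure, scaledToeplitz, smul_pow, Matrix.trace_smul, smul_eq_mul,
    mul_inv, inv_pow, mul_assoc]

/-- The degenerate loops number `O(n ^ ((r + 1) / 2))`, which loses at least a factor `√n` against
the normalisation; only the density of pair loops survives. -/
theorem IsBoundedNoise.tendsto_integral_moment (h : IsBoundedNoise Y P C) {M : ℕ → ℝ}
    (hM : ∀ k, Tendsto (fun n : ℕ => ((pairLoops (n + 1) (2 * k)).card : ℝ) / (n + 1 : ℕ) ^ (k + 1))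
      atTop (𝓝 (M k))) (r : ℕ) :
    Tendsto (fun n : ℕ => ∫ ω, ∫ t, t ^ r ∂(toeplitzMeasure (n + 1) fun k => Y k ω : Measure ℝ) ∂P)
      atTop (𝓝 (evenMoments M r)) := by
  have hC := h.bound_nonneg
  simp only [integral_pow_toeplitzMeasure, integral_const_mul]
  have hsmall : Tendsto (fun n : ℕ => (((n + 1 : ℕ) : ℝ) * √((n + 1 : ℕ) : ℝ) ^ r)⁻¹ *
      (∫ ω, (toeplitz (n + 1) (fun k => Y k ω) ^ r).trace ∂P - (pairLoops (n + 1) r).card))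
      atTop (𝓝 0) := by
    have hlim : Tendsto (fun n : ℕ => C ^ r * (2 * r + 1) ^ r * (√((n + 1 : ℕ) : ℝ))⁻¹) atTop
        (𝓝 (C ^ r * (2 * r + 1) ^ r * 0)) := by
      refine Tendsto.const_mul _ (Tendsto.inv_tendsto_atTop ?_)
      exact Real.tendsto_sqrt_atTop.comp
        (tendsto_natCast_atTop_atTop.comp (tendsto_add_atTop_nat 1))
    rw [mul_zero] at hlim
    refine squeeze_zero_norm (fun n => ?_) hlim
    have hn : (0 : ℝ) < (n + 1 : ℕ) := Nat.cast_pos.2 n.succ_pos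
    set a := √((n + 1 : ℕ) : ℝ) with ha
    have hap : 1 ≤ a := Real.one_le_sqrt.2 (by push_cast; linarith [Nat.cast_nonneg (α := ℝ) n])
    have haa : ((n + 1 : ℕ) : ℝ) = a ^ 2 := (Real.sq_sqrt hn.le).symm
    rw [norm_mul, Real.norm_of_nonneg (by positivity), Real.norm_eq_abs]
    have := h.abs_integral_trace_sub_le n.succ_pos r
    rw [Nat.succ_eq_add_one, haa, ← pow_mul] at this
    rw [haa]
    calc _ ≤ (a ^ 2 * a ^ r)⁻¹ * (C ^ r * (2 * r + 1) ^ r * a ^ (2 * ((r + 1) / 2))) :=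
          mul_le_mul_of_nonneg_left this (by positivity)
      _ ≤ (a ^ 2 * a ^ r)⁻¹ * (C ^ r * (2 * r + 1) ^ r * a ^ (r + 1)) := by
          gcongr
          omega
      _ = _ := by field_simp; ring
  have hmain : Tendsto (fun n : ℕ => (((n + 1 : ℕ) : ℝ) * √((n + 1 : ℕ) : ℝ) ^ r)⁻¹ *
      (pairLoops (n + 1) r).card) atTop (𝓝 (evenMoments M r)) := by
    rcases Nat.even_or_odd r with hr | hr
    · obtain ⟨k, rfl⟩ := hr
      rw [← two_mul]
      have he : evenMoments M (2 * k) = M k := by simp [evenMoments]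
      rw [he]
      refine (hM k).congr fun n => ?_
      rw [pow_mul, Real.sq_sqrt (Nat.cast_nonneg _), ← pow_succ', div_eq_inv_mul]
    · rw [evenMoments, if_neg (Nat.not_even_iff_odd.2 hr)]
      refine tendsto_const_nhds.congr fun n => ?_
      rw [pairLoops_eq_empty_of_odd hr]
      simp
  have := hsmall.add hmain
  rw [zero_add] at this
  refine this.congr fun n => ?_
  ring

/-- By Tonelli the series of squares has finite expectation, hence converges almost surely, and its
terms tend to zero. -/
theorem ae_tendsto_zero_of_summable_integral_sq {f : ℕ → Ω → ℝ}
    (hf : ∀ m, Integrable (fun ω => f m ω ^ 2) P) (hs : Summable fun m => ∫ ω, f m ω ^ 2 ∂P) :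
    ∀ᵐ ω ∂P, Tendsto (fun m => f m ω) atTop (𝓝 0) := by
  have h1 : ∫⁻ ω, ∑' m, ENNReal.ofReal (f m ω ^ 2) ∂P ≠ ∞ := by
    rw [lintegral_tsum fun m => (hf m).aemeasurable.ennreal_ofReal]
    simp only [← ofReal_integral_eq_lintegral_ofReal (hf _)
      (Eventually.of_forall fun ω => sq_nonneg _)]
    rw [← ENNReal.ofReal_tsum_of_nonneg (fun m => integral_nonneg fun ω => sq_nonneg _) hs]
    exact ENNReal.ofReal_ne_top
  have h2 := ae_lt_top' (AEMeasurable.tsum fun m => (hf m).aemeasurable.ennreal_ofReal) h1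
  filter_upwards [h2] with ω hω
  have h3 := ENNReal.summable_toReal hω.ne
  have h4 := h3.tendsto_atTop_zero
  have h5 : Tendsto (fun m => f m ω ^ 2) atTop (𝓝 0) := by
    refine h4.congr fun m => ENNReal.toReal_ofReal (sq_nonneg _)
  have h6 := (Real.continuous_sqrt.tendsto 0).comp h5
  simp only [Real.sqrt_zero] at h6
  rw [tendsto_zero_iff_abs_tendsto_zero]
  refine h6.congr fun m => ?_
  simp [Real.sqrt_sq_eq_abs]

/-- Almost surely, all moments of the spectral measures of sizes `(m + 1) ^ 2` converge. -/
theorem IsBoundedNoise.ae_tendsto_moments (h : IsBoundedNoise Y P C) {M : ℕ → ℝ}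
    (hM : ∀ k, Tendsto (fun n : ℕ => ((pairLoops (n + 1) (2 * k)).card : ℝ) / (n + 1 : ℕ) ^ (k + 1))
      atTop (𝓝 (M k))) :
    ∀ᵐ ω ∂P, ∀ r, Tendsto
      (fun m : ℕ => ∫ t, t ^ r ∂(toeplitzMeasure ((m + 1) ^ 2) fun k => Y k ω : Measure ℝ))
      atTop (𝓝 (evenMoments M r)) := by
  have hC := h.bound_nonneg
  rw [ae_all_iff]
  intro r
  set g : ℕ → Ω → ℝ := fun m ω =>
    ∫ t, t ^ r ∂(toeplitzMeasure ((m + 1) ^ 2) fun k => Y k ω : Measure ℝ)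
  set K : ℝ := 2 * C ^ (2 * r) * (2 * (2 * r + 3) ^ (2 * r))
  have hK : 0 ≤ K := by positivity
  have hg : ∀ m ω, g m ω - ∫ ω', g m ω' ∂P = ((((m + 1) ^ 2 : ℕ) : ℝ) *
      √(((m + 1) ^ 2 : ℕ) : ℝ) ^ r)⁻¹ * ((toeplitz ((m + 1) ^ 2) (fun k => Y k ω) ^ r).trace -
        ∫ ω', (toeplitz ((m + 1) ^ 2) (fun k => Y k ω') ^ r).trace ∂P) := by
    intro m ω
    simp only [g, integral_pow_toeplitzMeasure, integral_const_mul]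
    ring
  have hbound : ∀ n ω, |(toeplitz n (fun k => Y k ω) ^ r).trace| ≤ (loops n r).card * C ^ r := by
    intro n ω
    rw [trace_toeplitz_pow]
    refine (Finset.abs_sum_le_sum_abs _ _).trans ?_
    rw [← nsmul_eq_mul]
    refine Finset.sum_le_card_nsmul _ _ _ fun x _ => ?_
    rw [Finset.abs_prod]
    calc ∏ i, |Y (label x i) ω| ≤ ∏ _i : Fin r, C :=
          Finset.prod_le_prod (fun _ _ => abs_nonneg _) fun i _ => h.bound _ _
      _ = C ^ r := by simp
  have hint : ∀ m, Integrable (fun ω => (g m ω - ∫ ω', g m ω' ∂P) ^ 2) P := by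
    intro m
    simp only [hg, mul_pow]
    refine Integrable.const_mul ?_ _
    set N := (m + 1) ^ 2
    have hmeas := (h.integrable_trace N r).aestronglyMeasurable
    refine Integrable.of_bound (C := ((loops N r).card * C ^ r +
      |∫ ω', (toeplitz N (fun k => Y k ω') ^ r).trace ∂P|) ^ 2) ?_
      (Eventually.of_forall fun ω => ?_)
    · exact (hmeas.sub aestronglyMeasurable_const).pow 2
    · rw [norm_pow, Real.norm_eq_abs]
      exact pow_le_pow_left₀ (abs_nonneg _)
        ((abs_sub _ _).trans (add_le_add_left (hbound N ω) _)) 2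
  -- The normalised variance is `O(1/n)`, which is not summable over all sizes but becomes `O(1/(m +
  -- 1)²)` along squares.
  have hsq : ∀ m : ℕ, ∫ ω, (g m ω - ∫ ω', g m ω' ∂P) ^ 2 ∂P ≤ K * (1 / (m + 1 : ℝ) ^ 2) := by
    intro m
    simp only [hg, mul_pow, integral_const_mul]
    have := h.integral_sq_trace_sub_le (n := (m + 1) ^ 2) (by positivity) r
    refine (mul_le_mul_of_nonneg_left this (by positivity)).trans (le_of_eq ?_)
    set a : ℝ := (m + 1 : ℝ) with ha
    have hap : 0 < a := by positivity
    have e1 : (((m + 1) ^ 2 : ℕ) : ℝ) = a ^ 2 := by push_cast; rfl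
    rw [e1, Real.sqrt_sq hap.le]
    change _ * (K * _) = _
    field_simp
    ring_nf
  have hsum : Summable fun m => ∫ ω, (g m ω - ∫ ω', g m ω' ∂P) ^ 2 ∂P := by
    refine Summable.of_nonneg_of_le (fun m => integral_nonneg fun ω => sq_nonneg _) hsq
      (Summable.mul_left K ?_)
    have := (summable_nat_add_iff 1).2 (Real.summable_one_div_nat_pow.2 one_lt_two)
    simpa using this
  have hae := ae_tendsto_zero_of_summable_integral_sq hint hsum
  have hexp := h.tendsto_integral_moment hM r
  have hexp' : Tendsto (fun m => ∫ ω', g m ω' ∂P) atTop (𝓝 (evenMoments M r)) := by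
    have hsub : Tendsto (fun m : ℕ => (m + 1) ^ 2 - 1) atTop atTop := by
      refine tendsto_atTop_mono (fun m => ?_) tendsto_id
      simp only [id]
      have : m + 1 ≤ (m + 1) ^ 2 := Nat.le_self_pow two_ne_zero _
      omega
    refine (hexp.comp hsub).congr fun m => ?_
    have hN : (m + 1) ^ 2 - 1 + 1 = (m + 1) ^ 2 := Nat.sub_add_cancel (Nat.one_le_pow _ _ (by simp))
    simp only [Function.comp, g, integral_pow_toeplitzMeasure]
    rw [hN]
  filter_upwards [hae] with ω hω
  have := hω.add hexp'
  rw [zero_add] at this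
  exact this.congr fun m => sub_add_cancel _ _

end TraceMoments

/-! ### Partition words and their linear systems -/

section Words

variable {k : ℕ} {w : Fin (2 * k) → Fin k} {fst snd : Fin k → Fin (2 * k)}

/-- `fst a < snd a` are the two occurrences of the letter `a` in the partition word `w`. -/
structure IsOccurrences (w : Fin (2 * k) → Fin k) (fst snd : Fin k → Fin (2 * k)) : Prop where
  iff : ∀ i a, w i = a ↔ i = fst a ∨ i = snd a
  lt : ∀ a, fst a < snd a
  mono : StrictMono fst

theorem IsPartitionWord.exists_occurrences (hw : IsPartitionWord w) :
    ∃ fst snd, IsOccurrences w fst snd := by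
  have h : ∀ a, ∃ p : Fin (2 * k) × Fin (2 * k), p.1 < p.2 ∧
      ∀ i, w i = a ↔ i = p.1 ∨ i = p.2 := by
    intro a
    obtain ⟨i, j, hij, he⟩ := Finset.card_eq_two.1 (hw.1 a)
    have he' : ∀ l, w l = a ↔ l = i ∨ l = j := fun l => by
      have := Finset.ext_iff.1 he l
      simpa using this
    rcases lt_or_gt_of_ne hij with h | h
    · exact ⟨(i, j), h, he'⟩
    · exact ⟨(j, i), h, fun l => by rw [he' l, or_comm]⟩
  choose p hp hp' using h
  refine ⟨fun a => (p a).1, fun a => (p a).2, fun i a => hp' a i, hp, fun a b hab => ?_⟩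
  obtain ⟨i, hi, hlt⟩ := hw.2 a b hab
  have h1 : (p a).1 ≤ i := by
    rcases (hp' a i).1 hi with h | h
    · exact h.ge
    · exact h ▸ (hp a).le
  exact h1.trans_lt (hlt _ ((hp' b _).2 (Or.inl rfl)))

namespace IsOccurrences

theorem apply_fst (h : IsOccurrences w fst snd) (a : Fin k) : w (fst a) = a :=
  (h.iff _ _).2 (Or.inl rfl)

theorem apply_snd (h : IsOccurrences w fst snd) (a : Fin k) : w (snd a) = a :=
  (h.iff _ _).2 (Or.inr rfl)

theorem first_iff (h : IsOccurrences w fst snd) (i : Fin (2 * k)) :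
    (∀ j, w j = w i → i ≤ j) ↔ i = fst (w i) := by
  constructor
  · intro hi
    rcases (h.iff i (w i)).1 rfl with h1 | h1
    · exact h1
    · have h2 := hi (fst (w i)) (h.apply_fst _)
      have h3 := h.lt (w i)
      rw [← h1] at h3
      exact absurd h2 (not_le.2 h3)
  · intro hi j hj
    rcases (h.iff j (w i)).1 hj with h1 | h1
    · rw [h1, ← hi]
    · rw [h1, hi, h.apply_fst]; exact (h.lt _).le

end IsOccurrences

/-- The letter `b` has occurred exactly once among the first `t` positions. -/
def IsOpen (fst snd : Fin k → Fin (2 * k)) (t : ℕ) (b : Fin k) : Prop :=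
  (fst b : ℕ) < t ∧ t ≤ (snd b : ℕ)

instance (t : ℕ) : DecidablePred (IsOpen fst snd t) := fun _ =>
  inferInstanceAs (Decidable (_ ∧ _))

/-- The increment attached to a letter, as a linear form in the undetermined variables. -/
noncomputable def increment (fst snd : Fin k → Fin (2 * k)) (a : Fin k) : Fin (k + 1) → ℤ :=
  Pi.single a.succ 1 - Pi.single 0 1 - ∑ b : Fin k,
    if _h : b < a then (if IsOpen fst snd (fst a) b then increment fst snd b else 0) else 0
termination_by a.val
decreasing_by exact _h

/-- The variable `x_t`, as a linear form in the undetermined variables. -/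
noncomputable def variableForm (fst snd : Fin k → Fin (2 * k)) (t : ℕ) : Fin (k + 1) → ℤ :=
  Pi.single 0 1 + ∑ b ∈ Finset.univ.filter (IsOpen fst snd t), increment fst snd b

/-- The guard `b < a`, present for termination, is automatic: a letter open at the first occurrence
of `a` started earlier, and first occurrences are in alphabetic order. -/
theorem IsOccurrences.increment_eq (h : IsOccurrences w fst snd) (a : Fin k) :
    increment fst snd a = Pi.single a.succ 1 - variableForm fst snd (fst a) := by
  rw [increment, variableForm, Finset.sum_filter, ← sub_sub]
  congr 1
  refine Finset.sum_congr rfl fun b _ => ?_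
  by_cases hb : b < a
  · simp [hb]
  · rw [dif_neg hb, if_neg]
    exact fun ho => hb (h.mono.lt_iff_lt.1 ho.1)

theorem IsOccurrences.isOpen_succ_iff (h : IsOccurrences w fst snd) (i : Fin (2 * k)) {b : Fin k}
    (hb : b ≠ w i) : IsOpen fst snd (i + 1) b ↔ IsOpen fst snd i b := by
  have h1 : (fst b : ℕ) ≠ i := fun he => hb (by rw [← Fin.ext he, h.apply_fst])
  have h2 : (snd b : ℕ) ≠ i := fun he => hb (by rw [← Fin.ext he, h.apply_snd])
  simp only [IsOpen]
  omega

theorem IsOccurrences.isOpen_fst (h : IsOccurrences w fst snd) (a : Fin k) :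
    ¬ IsOpen fst snd (fst a) a ∧ IsOpen fst snd (fst a + 1) a := by
  have := Fin.lt_def.1 (h.lt a)
  simp only [IsOpen]
  omega

theorem IsOccurrences.isOpen_snd (h : IsOccurrences w fst snd) (a : Fin k) :
    IsOpen fst snd (snd a) a ∧ ¬ IsOpen fst snd (snd a + 1) a := by
  have := Fin.lt_def.1 (h.lt a)
  simp only [IsOpen]
  omega

/-- Passing position `i` changes the status of the letter `w i` only: its increment enters at the
first occurrence and leaves at the second. The opposite signs are the linear system. -/
theorem IsOccurrences.variableForm_succ (h : IsOccurrences w fst snd) (i : Fin (2 * k)) :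
    variableForm fst snd (i + 1) - variableForm fst snd i =
      if i = fst (w i) then increment fst snd (w i) else -increment fst snd (w i) := by
  have key : variableForm fst snd (i + 1) - variableForm fst snd i =
      (if IsOpen fst snd (i + 1) (w i) then increment fst snd (w i) else 0) -
        (if IsOpen fst snd i (w i) then increment fst snd (w i) else 0) := by
    rw [variableForm, variableForm, add_sub_add_left_eq_sub, Finset.sum_filter, Finset.sum_filter,
      ← Finset.sum_sub_distrib]
    refine Finset.sum_eq_single (w i) (fun b _ hb => ?_) (fun hn => absurd (Finset.mem_univ _) hn)
    simp only [h.isOpen_succ_iff i hb, sub_self]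
  rw [key]
  rcases (h.iff i (w i)).1 rfl with he | he
  · have := h.isOpen_fst (w i)
    rw [← he] at this
    rw [if_pos this.2, if_neg this.1, if_pos he, sub_zero]
  · have := h.isOpen_snd (w i)
    have hne : i ≠ fst (w i) := fun hf => (h.lt (w i)).ne (hf.symm.trans he)
    rw [← he] at this
    rw [if_neg this.2, if_pos this.1, if_neg hne, zero_sub]

theorem IsOccurrences.variableForm_fst_succ (h : IsOccurrences w fst snd) (a : Fin k) :
    variableForm fst snd (fst a + 1) = Pi.single a.succ 1 := by
  have := h.variableForm_succ (fst a)
  rw [h.apply_fst, if_pos rfl, h.increment_eq, sub_eq_sub_iff_add_eq_add] at this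
  simpa using this

theorem variableForm_zero : variableForm fst snd 0 = Pi.single 0 1 := by
  rw [variableForm, Finset.filter_false_of_mem, Finset.sum_empty, add_zero]
  exact fun b _ hb => absurd hb.1 (Nat.not_lt_zero _)

/-- Triangularity: an increment is built from variables introduced earlier. It isolates the
coefficient of a newly introduced variable in `abs_subset_sum_le_one`. -/
theorem IsOccurrences.increment_apply_eq_zero (h : IsOccurrences w fst snd) (a : Fin k)
    (c : Fin (k + 1)) (hc : a.succ < c) : increment fst snd a c = 0 := by
  induction a using WellFoundedLT.induction with
  | _ a ih =>
    have h0 : c ≠ 0 := ne_of_gt ((Fin.succ_pos a).trans hc)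
    have hs : c ≠ a.succ := ne_of_gt hc
    rw [h.increment_eq, variableForm, Pi.sub_apply, Pi.add_apply, Finset.sum_apply,
      Pi.single_eq_of_ne h0, Pi.single_eq_of_ne hs, Finset.sum_eq_zero, add_zero, sub_zero]
    intro b hb
    have hba : b < a := h.mono.lt_iff_lt.1 (Finset.mem_filter.1 hb).2.1
    exact ih b hba ((Fin.succ_lt_succ_iff.2 hba).trans hc)

/-- An increment is a difference of two variables, and each variable has coefficient sum one, since
translating `u` translates the whole solution. -/
theorem IsOccurrences.sum_increment (h : IsOccurrences w fst snd) (a : Fin k) :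
    ∑ c, increment fst snd a c = 0 := by
  induction a using WellFoundedLT.induction with
  | _ a ih =>
    rw [h.increment_eq a]
    simp only [variableForm, Pi.sub_apply, Pi.add_apply, Finset.sum_apply,
      Finset.sum_sub_distrib, Finset.sum_add_distrib]
    rw [Finset.sum_comm, Finset.sum_eq_zero (s := Finset.univ.filter _)]
    · simp
    · intro b hb
      exact ih b (h.mono.lt_iff_lt.1 (Finset.mem_filter.1 hb).2.1)

theorem IsOccurrences.sum_variableForm (h : IsOccurrences w fst snd) (t : ℕ) :
    ∑ c, variableForm fst snd t c = 1 := by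
  simp only [variableForm, Pi.add_apply, Finset.sum_apply, Finset.sum_add_distrib]
  rw [Finset.sum_comm, Finset.sum_eq_zero (s := Finset.univ.filter _)]
  · simp
  · exact fun b _ => h.sum_increment b

/-- All subset sums of the increments of the open letters have coefficients in `{-1, 0, 1}`. -/
theorem IsOccurrences.abs_subset_sum_le_one (h : IsOccurrences w fst snd) (t : ℕ)
    (S : Finset (Fin k)) (hS : ∀ b ∈ S, IsOpen fst snd t b) (ε : ℤ) (hε : ε = 0 ∨ ε = 1)
    (c : Fin (k + 1)) :
    |ε * (Pi.single 0 1 : Fin (k + 1) → ℤ) c + ∑ b ∈ S, increment fst snd b c| ≤ 1 := by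
  have hsingle : ∀ d : Fin (k + 1), |ε * (Pi.single d 1 : Fin (k + 1) → ℤ) c| ≤ 1 := by
    intro d
    by_cases hd : c = d
    · subst hd; rcases hε with rfl | rfl <;> simp
    · rw [Pi.single_eq_of_ne hd]; simp
  induction t generalizing S ε with
  | zero =>
    rw [Finset.eq_empty_of_forall_notMem fun b hb => Nat.not_lt_zero _ (hS b hb).1]
    simpa using hsingle 0
  | succ t ih =>
    by_cases ht : t < 2 * k
    swap
    · have hempty : S = ∅ := Finset.eq_empty_of_forall_notMem fun b hb => by
        have := (hS b hb).2; have := (snd b).2; omega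
      rw [hempty]
      simpa using hsingle 0
    set i : Fin (2 * k) := ⟨t, ht⟩ with hi
    have hopen : ∀ b ∈ S, b ≠ w i → IsOpen fst snd t b := fun b hb hne =>
      (h.isOpen_succ_iff i hne).1 (hS b hb)
    by_cases ha : w i ∈ S
    swap
    · exact ih S (fun b hb => hopen b hb fun he => ha (he ▸ hb)) ε hε hsingle
    have hif : i = fst (w i) := by
      rcases (h.iff i (w i)).1 rfl with he | he
      · exact he
      · have := h.isOpen_snd (w i)
        rw [← he] at this
        exact absurd (hS _ ha) this.2
    set O := Finset.univ.filter (IsOpen fst snd t)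
    have hsub : S.erase (w i) ⊆ O := fun b hb => Finset.mem_filter.2 ⟨Finset.mem_univ _,
      hopen b (Finset.mem_of_mem_erase hb) (Finset.ne_of_mem_erase hb)⟩
    have hinc : increment fst snd (w i) = Pi.single (w i).succ 1 - variableForm fst snd t := by
      rw [h.increment_eq, ← hif]
    -- The letter just opened has increment `u_a - x_t`, where `x_t` is `u_0` plus the increments of
    -- all open letters `O`. A sum containing it thus becomes `u_a` minus the complementary sum,
    -- with `1 - ε` and `O \ S` in place of `ε` and `S`. Hence the induction over all subsets and
    -- both values of `ε`.
    have hsum : ε * (Pi.single 0 1 : Fin (k + 1) → ℤ) c + ∑ b ∈ S, increment fst snd b c =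
        (Pi.single (w i).succ 1 : Fin (k + 1) → ℤ) c -
          ((1 - ε) * (Pi.single 0 1 : Fin (k + 1) → ℤ) c +
            ∑ b ∈ O \ S.erase (w i), increment fst snd b c) := by
      rw [← Finset.add_sum_erase S _ ha, hinc, variableForm]
      have := Finset.sum_sdiff (f := fun b => increment fst snd b c) hsub
      simp only [Pi.sub_apply, Pi.add_apply, Finset.sum_apply]
      linarith
    rw [hsum]
    by_cases hc : c = (w i).succ
    · have h0 : ∑ b ∈ O \ S.erase (w i), increment fst snd b c = 0 := by
        refine Finset.sum_eq_zero fun b hb => ?_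
        have hb' := (Finset.mem_filter.1 (Finset.mem_sdiff.1 hb).1).2
        refine h.increment_apply_eq_zero b c ?_
        rw [hc, Fin.succ_lt_succ_iff]
        refine h.mono.lt_iff_lt.1 ?_
        rw [← hif]
        exact hb'.1
      rw [h0, hc, Pi.single_eq_same, Pi.single_eq_of_ne (Fin.succ_ne_zero _)]
      simp
    · rw [Pi.single_eq_of_ne hc, zero_sub, abs_neg]
      have hε' : 1 - ε = 0 ∨ 1 - ε = 1 := by omega
      refine ih _ (fun b hb => (Finset.mem_filter.1 (Finset.mem_sdiff.1 hb).1).2) (1 - ε) hε' ?_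
      intro d
      by_cases hd : c = d
      · subst hd; rcases hε' with he | he <;> simp [he]
      · rw [Pi.single_eq_of_ne hd]; simp

theorem IsOccurrences.abs_variableForm_le_one (h : IsOccurrences w fst snd) (t : ℕ)
    (c : Fin (k + 1)) : |variableForm fst snd t c| ≤ 1 := by
  have := h.abs_subset_sum_le_one t (Finset.univ.filter (IsOpen fst snd t))
    (fun b hb => (Finset.mem_filter.1 hb).2) 1 (Or.inr rfl) c
  simpa [variableForm, Finset.sum_apply] using this

/-- The solution of the linear system with undetermined variables `u`. -/
noncomputable def solution (fst snd : Fin k → Fin (2 * k)) (u : Fin (k + 1) → ℝ) (t : ℕ) : ℝ :=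
  ∑ c, (variableForm fst snd t c : ℝ) * u c

theorem solution_zero (u : Fin (k + 1) → ℝ) : solution fst snd u 0 = u 0 := by
  simp [solution, variableForm_zero, Pi.single_apply]

theorem IsOccurrences.solution_fst_succ (h : IsOccurrences w fst snd) (u : Fin (k + 1) → ℝ)
    (a : Fin k) : solution fst snd u (fst a + 1) = u a.succ := by
  simp [solution, h.variableForm_fst_succ, Pi.single_apply]

theorem IsOccurrences.solution_snd_succ (h : IsOccurrences w fst snd) (u : Fin (k + 1) → ℝ)
    (a : Fin k) : solution fst snd u (snd a + 1) - solution fst snd u (snd a) =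
      -(solution fst snd u (fst a + 1) - solution fst snd u (fst a)) := by
  have h1 := h.variableForm_succ (fst a)
  have h2 := h.variableForm_succ (snd a)
  rw [h.apply_fst, if_pos rfl] at h1
  rw [h.apply_snd, if_neg (h.lt a).ne', ← h1] at h2
  simp only [solution, ← Finset.sum_sub_distrib, ← sub_mul, ← Finset.sum_neg_distrib, ← neg_mul]
  refine Finset.sum_congr rfl fun c _ => ?_
  have := congrFun h2 c
  simp only [Pi.sub_apply, Pi.neg_apply] at this
  congr 1
  exact_mod_cast this

theorem IsOccurrences.pair_cases (h : IsOccurrences w fst snd) {i j : Fin (2 * k)} (hij : i < j)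
    (hw : w i = w j) : i = fst (w i) ∧ j = snd (w i) := by
  have hl := h.lt (w i)
  rcases (h.iff i (w i)).1 rfl with h1 | h1 <;> rcases (h.iff j (w i)).1 hw.symm with h2 | h2
  · exact absurd (h1.trans h2.symm) hij.ne
  · exact ⟨h1, h2⟩
  · rw [h1, h2] at hij
    rw [← h1] at hij hl
    exact absurd hij (by rw [← h2] at hl ⊢; exact not_lt.2 hl.le)
  · exact absurd (h1.trans h2.symm) hij.ne

theorem IsOccurrences.solves_solution (h : IsOccurrences w fst snd) (u : Fin (k + 1) → ℝ) :
    SolvesToeplitzSystem w fun t => solution fst snd u t := by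
  intro i j hij hw
  obtain ⟨h1, h2⟩ := h.pair_cases hij hw
  have := h.solution_snd_succ u (w i)
  rw [← h1, ← h2] at this
  simp only [Fin.val_succ, Fin.val_castSucc]
  linarith

theorem IsOccurrences.eq_solution (h : IsOccurrences w fst snd) {u : Fin (k + 1) → ℝ}
    {x : Fin (2 * k + 1) → ℝ} (hx : SolvesToeplitzSystem w x) (h0 : x 0 = u 0)
    (hf : ∀ a, x (fst a).succ = u a.succ) (t : Fin (2 * k + 1)) :
    x t = solution fst snd u t := by
  suffices H : ∀ m, ∀ t : Fin (2 * k + 1), (t : ℕ) ≤ m → x t = solution fst snd u t from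
    H t t le_rfl
  intro m
  induction m with
  | zero =>
    intro t ht
    have : t = 0 := Fin.ext (by simpa using ht)
    rw [this, h0, Fin.val_zero, solution_zero]
  | succ m ih =>
    intro t ht
    rcases Nat.lt_or_ge t (m + 1) with hlt | hge
    · exact ih t (by omega)
    obtain ⟨i, rfl⟩ : ∃ i : Fin (2 * k), t = i.succ :=
      ⟨⟨m, by have := t.2; omega⟩, Fin.ext (by simp; omega)⟩
    have him : (i : ℕ) = m := by simp only [Fin.val_succ] at ht hge; omega
    rcases (h.iff i (w i)).1 rfl with he | he
    · rw [he, hf, Fin.val_succ, h.solution_fst_succ]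
    · have hlt := h.lt (w i)
      rw [← he] at hlt
      have hs := hx (fst (w i)) i hlt (h.apply_fst _)
      have hs' := h.solution_snd_succ u (w i)
      rw [← he] at hs'
      have e1 := ih i.castSucc (by simp [him])
      have e2 := ih (fst (w i)).castSucc (by
        have := Fin.lt_def.1 hlt; simp only [Fin.val_castSucc]; omega)
      have e3 := ih (fst (w i)).succ (by
        have := Fin.lt_def.1 hlt; simp only [Fin.val_succ]; omega)
      rw [e1, e2, e3] at hs
      simp only [Fin.val_succ, Fin.val_castSucc] at hs ⊢
      linarith

theorem IsOccurrences.mem_toeplitzSection_iff (h : IsOccurrences w fst snd)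
    (u : Fin (k + 1) → ℝ) :
    u ∈ toeplitzSection w ↔ u ∈ unitCube (k + 1) ∧
      ∀ t : Fin (2 * k + 1), solution fst snd u t ∈ Set.Icc (0 : ℝ) 1 := by
  constructor
  · rintro ⟨hu, x, hx, h0, hf, hxI⟩
    refine ⟨hu, fun t => ?_⟩
    rw [← h.eq_solution hx h0 (fun a => ?_) t]
    · exact hxI t
    · have := hf (fst a) ((h.first_iff _).2 (by rw [h.apply_fst]))
      rwa [h.apply_fst] at this
  · rintro ⟨hu, hs⟩
    refine ⟨hu, fun t => solution fst snd u t, h.solves_solution u, solution_zero u, ?_, hs⟩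
    intro i hi
    have := (h.first_iff i).1 hi
    have h2 := h.solution_fst_succ u (w i)
    rw [← this] at h2
    simpa using h2

/-- The coordinates that enter the linear form of the variable after the second occurrence of `a`
with a plus sign. -/
noncomputable def plusSet (fst snd : Fin k → Fin (2 * k)) (a : Fin k) : Finset (Fin (k + 1)) :=
  Finset.univ.filter fun c => variableForm fst snd (snd a + 1) c = 1

/-- The coordinates that enter with a minus sign. -/
noncomputable def minusSet (fst snd : Fin k → Fin (2 * k)) (a : Fin k) : Finset (Fin (k + 1)) :=
  Finset.univ.filter fun c => variableForm fst snd (snd a + 1) c = -1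

theorem disjoint_plusSet_minusSet (a : Fin k) :
    Disjoint (plusSet fst snd a) (minusSet fst snd a) := by
  rw [Finset.disjoint_left]
  intro c h1 h2
  have h1' := (Finset.mem_filter.1 h1).2
  have h2' := (Finset.mem_filter.1 h2).2
  omega

theorem IsOccurrences.variableForm_eq_ite (h : IsOccurrences w fst snd) (a : Fin k)
    (c : Fin (k + 1)) : variableForm fst snd (snd a + 1) c =
      (if c ∈ plusSet fst snd a then 1 else 0) - (if c ∈ minusSet fst snd a then 1 else 0) := by
  have := h.abs_variableForm_le_one (snd a + 1) c
  rw [abs_le] at this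
  simp only [plusSet, minusSet, Finset.mem_filter, Finset.mem_univ, true_and]
  split_ifs <;> omega

theorem IsOccurrences.card_plusSet (h : IsOccurrences w fst snd) (a : Fin k) :
    (plusSet fst snd a).card = (minusSet fst snd a).card + 1 := by
  have := h.sum_variableForm (snd a + 1)
  simp only [h.variableForm_eq_ite, Finset.sum_sub_distrib] at this
  simp only [Finset.sum_ite_mem, Finset.univ_inter, Finset.sum_const] at this
  simp only [nsmul_eq_mul, mul_one] at this
  omega

theorem IsOccurrences.solution_snd (h : IsOccurrences w fst snd) (u : Fin (k + 1) → ℝ)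
    (a : Fin k) : solution fst snd u (snd a + 1) =
      ∑ c ∈ plusSet fst snd a, u c - ∑ c ∈ minusSet fst snd a, u c := by
  simp only [solution, h.variableForm_eq_ite]
  push_cast
  simp only [sub_mul, Finset.sum_sub_distrib, ite_mul, one_mul, zero_mul, Finset.sum_ite_mem,
    Finset.univ_inter]

/-- The cube section of a partition word is an intersection of solids. -/
theorem IsOccurrences.toeplitzSection_eq (h : IsOccurrences w fst snd) :
    toeplitzSection w = unitCube (k + 1) ∩
      ⋂ a, eulerianSolid (plusSet fst snd a) (minusSet fst snd a) := by
  ext u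
  rw [h.mem_toeplitzSection_iff, Set.mem_inter_iff, Set.mem_iInter]
  refine and_congr_right fun hu => ⟨fun hs a => ⟨hu, ?_⟩, fun hs t => ?_⟩
  · rw [← h.solution_snd]
    simpa using hs (snd a).succ
  · induction t using Fin.cases with
    | zero => rw [Fin.val_zero, solution_zero]; exact hu 0
    | succ i =>
      rw [Fin.val_succ]
      -- After a first occurrence the variable is a coordinate of the cube; only second occurrences
      -- impose a condition.
      rcases (h.iff i (w i)).1 rfl with he | he
      · rw [he, h.solution_fst_succ]; exact hu _
      · rw [he, h.solution_snd]; exact (hs _).2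

end Words

/-! ### Section volumes as densities of lattice points -/

section SectionVolume

variable {k : ℕ} {w : Fin (2 * k) → Fin k} {fst snd : Fin k → Fin (2 * k)}

theorem unitCube_eq (d : ℕ) : unitCube d = Set.Icc (0 : Fin d → ℝ) 1 := by
  ext u
  simp only [unitCube, Set.mem_ofPred_eq, Set.mem_Icc, Pi.le_def, Pi.zero_apply, Pi.one_apply]
  exact ⟨fun h => ⟨fun i => (h i).1, fun i => (h i).2⟩, fun h i => ⟨h.1 i, h.2 i⟩⟩

theorem volume_unitCube (d : ℕ) : volume (unitCube d) = 1 := by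
  rw [unitCube_eq, Real.volume_Icc_pi]
  simp

theorem continuous_solution (t : ℕ) : Continuous fun u => solution fst snd u t := by
  unfold solution
  fun_prop

theorem IsOccurrences.toeplitzSection_eq_inter (h : IsOccurrences w fst snd) :
    toeplitzSection w = Set.Icc (0 : Fin (k + 1) → ℝ) 1 ∩
      ⋂ t : Fin (2 * k + 1), (fun u => solution fst snd u t) ⁻¹' Set.Icc 0 1 := by
  ext u
  rw [h.mem_toeplitzSection_iff, unitCube_eq]
  simp

theorem IsOccurrences.isClosed_toeplitzSection (h : IsOccurrences w fst snd) :
    IsClosed (toeplitzSection w) := by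
  rw [h.toeplitzSection_eq_inter]
  exact isClosed_Icc.inter (isClosed_iInter fun t =>
    isClosed_Icc.preimage (continuous_solution t))

theorem IsOccurrences.convex_toeplitzSection (h : IsOccurrences w fst snd) :
    Convex ℝ (toeplitzSection w) := by
  rw [h.toeplitzSection_eq_inter]
  refine (convex_Icc _ _).inter (convex_iInter fun t => ?_)
  refine (convex_Icc (0 : ℝ) 1).is_linear_preimage ⟨fun u v => ?_, fun c u => ?_⟩
  · simp [solution, mul_add, Finset.sum_add_distrib]
  · simp only [solution, Pi.smul_apply, smul_eq_mul, Finset.mul_sum]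
    exact Finset.sum_congr rfl fun i _ => by ring

theorem IsOccurrences.isBounded_toeplitzSection (h : IsOccurrences w fst snd) :
    Bornology.IsBounded (toeplitzSection w) := by
  rw [h.toeplitzSection_eq_inter]
  exact (Metric.isBounded_Icc _ _).subset Set.inter_subset_left

theorem toeplitzVolume_le_one (w : Fin (2 * k) → Fin k) : toeplitzVolume w ≤ 1 := by
  have h1 : toeplitzSection w ⊆ unitCube (k + 1) := fun u hu => hu.1
  have := measureReal_mono (μ := volume) h1 (by rw [volume_unitCube]; simp)
  refine this.trans (le_of_eq ?_)
  simp [measureReal_def, volume_unitCube]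

theorem toeplitzVolume_nonneg (w : Fin (2 * k) → Fin k) : 0 ≤ toeplitzVolume w :=
  measureReal_nonneg

/-- The paths in `Fin N` that solve the linear system of the word `w`. -/
def solutionPaths (w : Fin (2 * k) → Fin k) (N : ℕ) : Finset (Fin (2 * k + 1) → Fin N) :=
  Finset.univ.filter fun x => ∀ i j, i < j → w i = w j → steps x i + steps x j = 0

theorem solves_of_mem_solutionPaths {N : ℕ} {x : Fin (2 * k + 1) → Fin N}
    (hx : x ∈ solutionPaths w N) (c : ℝ) :
    SolvesToeplitzSystem w fun t => c * ((x t : ℕ) : ℝ) := by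
  intro i j hij hw
  have := (Finset.mem_filter.1 hx).2 i j hij hw
  simp only [steps] at this
  have h2 : (((x i.castSucc : ℕ) : ℝ) - ((x i.succ : ℕ) : ℝ)) +
      (((x j.castSucc : ℕ) : ℝ) - ((x j.succ : ℕ) : ℝ)) = 0 := by exact_mod_cast this
  linear_combination -c * h2

/-- The undetermined variables of a path, rescaled by `n`. -/
noncomputable def undetermined (fst : Fin k → Fin (2 * k)) (n : ℕ)
    (x : Fin (2 * k + 1) → Fin (n + 1)) : Fin (k + 1) → ℝ :=
  Fin.cons ((n : ℝ)⁻¹ * ((x 0 : ℕ) : ℝ)) fun a => (n : ℝ)⁻¹ * ((x (fst a).succ : ℕ) : ℝ)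

theorem IsOccurrences.solution_undetermined (h : IsOccurrences w fst snd) {n : ℕ}
    {x : Fin (2 * k + 1) → Fin (n + 1)} (hx : x ∈ solutionPaths w (n + 1))
    (t : Fin (2 * k + 1)) :
    (n : ℝ)⁻¹ * ((x t : ℕ) : ℝ) = solution fst snd (undetermined fst n x) t :=
  h.eq_solution (u := undetermined fst n x) (solves_of_mem_solutionPaths hx _) rfl
    (fun _ => rfl) t

theorem IsOccurrences.undetermined_injOn (h : IsOccurrences w fst snd) {n : ℕ} (hn : n ≠ 0) :
    Set.InjOn (undetermined fst n) (solutionPaths w (n + 1) : Set _) := by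
  intro x hx y hy hxy
  funext t
  have h1 := h.solution_undetermined hx t
  rw [hxy, ← h.solution_undetermined hy t] at h1
  have hn' : (n : ℝ)⁻¹ ≠ 0 := inv_ne_zero (Nat.cast_ne_zero.2 hn)
  have := mul_left_cancel₀ hn' h1
  exact Fin.ext (by exact_mod_cast this)

theorem scaled_mem_Icc {n : ℕ} (y : Fin (n + 1)) :
    (n : ℝ)⁻¹ * ((y : ℕ) : ℝ) ∈ Set.Icc (0 : ℝ) 1 := by
  refine ⟨by positivity, ?_⟩
  have : ((y : ℕ) : ℝ) ≤ n := by exact_mod_cast Nat.lt_succ_iff.1 y.2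
  calc (n : ℝ)⁻¹ * ((y : ℕ) : ℝ) ≤ (n : ℝ)⁻¹ * n := by gcongr
    _ ≤ 1 := inv_mul_le_one

-- The linear forms have integer coefficients, so at a lattice point of mesh `1 / n` all variables
-- are multiples of `1 / n`. In `[0, 1]` there are `n + 1` such values, whence paths in `Fin (n +
-- 1)`.
open scoped Pointwise in
theorem IsOccurrences.image_undetermined (h : IsOccurrences w fst snd) {n : ℕ} [NeZero n] :
    toeplitzSection w ∩ (((n : ℝ)⁻¹ • Submodule.span ℤ (Set.range (Pi.basisFun ℝ (Fin (k + 1)))) :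
      Submodule ℤ (Fin (k + 1) → ℝ)) : Set (Fin (k + 1) → ℝ)) =
      undetermined fst n '' (solutionPaths w (n + 1) : Set _) := by
  have hn : (n : ℝ) ≠ 0 := Nat.cast_ne_zero.2 (NeZero.ne n)
  ext u
  rw [Set.mem_inter_iff, SetLike.mem_coe, BoxIntegral.unitPartition.mem_smul_span_iff, h.mem_toeplitzSection_iff]
  constructor
  · rintro ⟨⟨hu, hs⟩, hint⟩
    choose z hz using hint
    have hz' : ∀ c, (z c : ℝ) = n * u c := fun c => by simpa using hz c
    have hval : ∀ t : Fin (2 * k + 1), ∃ y : Fin (n + 1),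
        ((y : ℕ) : ℝ) = n * solution fst snd u t := by
      intro t
      have h1 : ((∑ c, variableForm fst snd t c * z c : ℤ) : ℝ) = n * solution fst snd u t := by
        push_cast
        simp only [hz', solution, Finset.mul_sum]
        exact Finset.sum_congr rfl fun c _ => by ring
      set m : ℤ := ∑ c, variableForm fst snd t c * z c
      have h2 : 0 ≤ m := by
        have : (0 : ℝ) ≤ m := by rw [h1]; exact mul_nonneg (by positivity) (hs t).1
        exact_mod_cast this
      have h3 : m ≤ n := by
        have : (m : ℝ) ≤ n := by
          rw [h1]; exact mul_le_of_le_one_right (by positivity) (hs t).2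
        exact_mod_cast this
      refine ⟨⟨m.toNat, by omega⟩, ?_⟩
      rw [← h1]
      have : ((m.toNat : ℤ) : ℝ) = m := by rw [Int.toNat_of_nonneg h2]
      exact_mod_cast this
    choose x hx using hval
    have hxs : x ∈ solutionPaths w (n + 1) := by
      refine Finset.mem_filter.2 ⟨Finset.mem_univ _, fun i j hij hw => ?_⟩
      have := h.solves_solution u i j hij hw
      have h2 : (((x i.castSucc : ℕ) : ℝ) - ((x i.succ : ℕ) : ℝ)) +
          (((x j.castSucc : ℕ) : ℝ) - ((x j.succ : ℕ) : ℝ)) = 0 := by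
        rw [hx, hx, hx, hx]
        linear_combination -(n : ℝ) * this
      simp only [steps]
      exact_mod_cast h2
    refine ⟨x, hxs, ?_⟩
    funext c
    induction c using Fin.cases with
    | zero => simp [undetermined, hx, solution_zero, hn]
    | succ a =>
      simp only [undetermined, Fin.cons_succ, hx, Fin.val_succ]
      rw [h.solution_fst_succ, inv_mul_cancel_left₀ hn]
  · rintro ⟨x, hx, rfl⟩
    refine ⟨⟨fun c => ?_, fun t => ?_⟩, fun c => ?_⟩
    · induction c using Fin.cases with
      | zero => exact scaled_mem_Icc _
      | succ a => exact scaled_mem_Icc _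
    · rw [← h.solution_undetermined hx t]; exact scaled_mem_Icc _
    · induction c using Fin.cases with
      | zero => exact ⟨(x 0 : ℕ), by simp [undetermined, hn]⟩
      | succ a => exact ⟨(x (fst a).succ : ℕ), by simp [undetermined, hn]⟩

/-- The section is bounded and convex, so its frontier is null and lattice points count its volume.
-/
theorem IsOccurrences.tendsto_card_solutionPaths (h : IsOccurrences w fst snd) :
    Tendsto (fun n : ℕ => ((solutionPaths w (n + 1)).card : ℝ) / (n : ℝ) ^ (k + 1)) atTop
      (𝓝 (toeplitzVolume w)) := by
  have := tendsto_card_div_pow_atTop_volume (toeplitzSection w) h.isBounded_toeplitzSection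
    h.isClosed_toeplitzSection.measurableSet (h.convex_toeplitzSection.addHaar_frontier volume)
  refine this.congr' ?_
  filter_upwards [eventually_ne_atTop 0] with n hn
  have : NeZero n := ⟨hn⟩
  rw [Fintype.card_fin, Nat.card_coe_set_eq]
  congr 2
  have h1 := h.image_undetermined (n := n)
  rw [Submodule.coe_pointwise_smul] at h1
  rw [h1, (h.undetermined_injOn hn).ncard_image, Set.ncard_coe_finset]

theorem IsOccurrences.tendsto_card_solutionPaths' (h : IsOccurrences w fst snd) :
    Tendsto (fun n : ℕ => ((solutionPaths w (n + 1)).card : ℝ) / ((n + 1 : ℕ) : ℝ) ^ (k + 1)) atTop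
      (𝓝 (toeplitzVolume w)) := by
  have h1 : Tendsto (fun n : ℕ => ((n : ℝ) / ((n : ℝ) + 1)) ^ (k + 1)) atTop (𝓝 (1 ^ (k + 1))) :=
    (tendsto_natCast_div_add_atTop (1 : ℝ)).pow _
  have h2 := h.tendsto_card_solutionPaths.mul h1
  rw [one_pow, mul_one] at h2
  refine h2.congr' ?_
  filter_upwards [eventually_ne_atTop 0] with n hn
  have : (n : ℝ) ≠ 0 := Nat.cast_ne_zero.2 hn
  have h3 : (n : ℝ) + 1 ≠ 0 := by positivity
  push_cast
  rw [div_pow]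
  field_simp

end SectionVolume

/-! ### Pair loops sorted by partition words -/

section PairLoops

variable {k : ℕ} {w : Fin (2 * k) → Fin k} {fst snd : Fin k → Fin (2 * k)} {N : ℕ}

theorem IsOccurrences.filter_eq (h : IsOccurrences w fst snd) (a : Fin k) :
    (Finset.univ.filter fun i => w i = a) = {fst a, snd a} := by
  ext i; simp [h.iff i a]

theorem IsOccurrences.solutionPaths_subset_loops (h : IsOccurrences w fst snd) :
    solutionPaths w N ⊆ loops N (2 * k) := by
  intro x hx
  refine Finset.mem_filter.2 ⟨Finset.mem_univ _, ?_⟩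
  have h1 : ∑ i, steps x i = 0 := by
    rw [← Finset.sum_fiberwise (s := Finset.univ) (g := w)]
    refine Finset.sum_eq_zero fun a _ => ?_
    rw [h.filter_eq, Finset.sum_pair (h.lt a).ne]
    exact (Finset.mem_filter.1 hx).2 _ _ (h.lt a) (by rw [h.apply_fst, h.apply_snd])
  rw [sum_steps] at h1
  exact Fin.ext (by omega)

/-- The loops whose labels induce exactly the partition of the word `w`. -/
def kernelLoops (w : Fin (2 * k) → Fin k) (N : ℕ) : Finset (Fin (2 * k + 1) → Fin N) :=
  (loops N (2 * k)).filter fun x => ∀ i j, label x i = label x j ↔ w i = w j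

theorem IsOccurrences.image_label (h : IsOccurrences w fst snd) {x : Fin (2 * k + 1) → Fin N}
    (hx : ∀ i j, w i = w j → label x i = label x j) :
    Finset.univ.image (label x) = Finset.univ.image fun a => label x (fst a) := by
  ext v
  simp only [Finset.mem_image, Finset.mem_univ, true_and]
  constructor
  · rintro ⟨i, rfl⟩
    exact ⟨w i, hx _ _ (h.apply_fst _)⟩
  · rintro ⟨a, rfl⟩
    exact ⟨fst a, rfl⟩

/-- A solution path whose labels do not induce exactly `w` gives two letters the same label, leaving
at most `k - 1` labels and a starting point. -/
theorem IsOccurrences.card_solutionPaths_sdiff_le (h : IsOccurrences w fst snd) (hN : 0 < N) :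
    (solutionPaths w N \ kernelLoops w N).card ≤ (2 * k + 1) ^ (2 * k) * N ^ k := by
  rcases Nat.eq_zero_or_pos k with rfl | hk
  · rw [Finset.card_eq_zero.2]
    · exact Nat.zero_le _
    · rw [Finset.sdiff_eq_empty_iff_subset]
      exact fun x hx => Finset.mem_filter.2 ⟨h.solutionPaths_subset_loops hx, fun i => i.elim0⟩
  refine (card_paths_le_of_card_labels_le (q := k - 1) hN _ fun x hx => ?_).trans ?_
  · obtain ⟨hxs, hxk⟩ := Finset.mem_sdiff.1 hx
    have hlab : ∀ i j, w i = w j → label x i = label x j := by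
      intro i j hij
      rcases lt_trichotomy i j with hlt | rfl | hlt
      · have := (Finset.mem_filter.1 hxs).2 i j hlt hij
        simp only [label]; omega
      · rfl
      · have := (Finset.mem_filter.1 hxs).2 j i hlt hij.symm
        simp only [label]; omega
    rw [h.image_label hlab]
    have hninj : ¬ Set.InjOn (fun a => label x (fst a)) (Finset.univ : Finset (Fin k)) := by
      intro hinj
      refine hxk (Finset.mem_filter.2 ⟨h.solutionPaths_subset_loops hxs, fun i j => ⟨fun hij => ?_,
        hlab i j⟩⟩)
      refine hinj (by simp) (by simp) ?_
      simp only
      rw [hlab _ i (h.apply_fst _), hlab _ j (h.apply_fst _), hij]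
    have hlt : (Finset.univ.image fun a => label x (fst a)).card <
        (Finset.univ : Finset (Fin k)).card :=
      lt_of_le_of_ne Finset.card_image_le fun he => hninj (Finset.card_image_iff.1 he)
    rw [Finset.card_univ, Fintype.card_fin] at hlt
    omega
  · rw [Nat.sub_add_cancel hk]
    exact Nat.mul_le_mul_right _ (Nat.pow_le_pow_left (by omega) _)

/-- If two paired steps are not opposite, they are equal and nonzero; their label then enters the
closing relation with coefficient `±2` and is determined by the other `k - 1` labels. -/
theorem IsOccurrences.card_kernelLoops_sdiff_le (h : IsOccurrences w fst snd) (hN : 0 < N) :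
    (kernelLoops w N \ solutionPaths w N).card ≤ (2 * k + 3) ^ (2 * k) * N ^ k := by
  rcases Nat.eq_zero_or_pos k with rfl | hk
  · rw [Finset.card_eq_zero.2]
    · exact Nat.zero_le _
    · rw [Finset.sdiff_eq_empty_iff_subset]
      exact fun x hx => Finset.mem_filter.2 ⟨Finset.mem_univ _, fun i => i.elim0⟩
  refine (card_paths_le _).trans ?_
  have := card_le_of_card_nonzeroLabels_erase_le (q := k - 1) hN
    ((kernelLoops w N \ solutionPaths w N).image steps) Finset.univ (fun s hs => by
      obtain ⟨x, hx, rfl⟩ := Finset.mem_image.1 hs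
      obtain ⟨hxk, hxs⟩ := Finset.mem_sdiff.1 hx
      obtain ⟨hxl, hker⟩ := Finset.mem_filter.1 hxk
      have hex : ∃ i j, i < j ∧ w i = w j ∧ steps x i + steps x j ≠ 0 := by
        by_contra hcon
        push Not at hcon
        exact hxs (Finset.mem_filter.2 ⟨Finset.mem_univ _, hcon⟩)
      obtain ⟨i, j, hij, hw, hne⟩ := hex
      obtain ⟨h1, h2⟩ := h.pair_cases hij hw
      have hlab := (hker i j).2 hw
      refine ⟨natAbs_steps_lt x, sum_steps_eq_zero hxl, label x i, ?_, ?_⟩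
      · have hmem : label x i ∈ nonzeroLabels (steps x) := by
          refine Finset.mem_erase.2 ⟨?_, Finset.mem_image.2 ⟨i, Finset.mem_univ _, rfl⟩⟩
          simp only [label] at hlab ⊢
          omega
        rw [Finset.card_erase_of_mem hmem]
        have hc1 : (nonzeroLabels (steps x)).card ≤ (Finset.univ.image (label x)).card :=
          Finset.card_le_card (nonzeroLabels_subset _)
        rw [h.image_label fun i j => (hker i j).2] at hc1
        have hc2 : (Finset.univ.image fun a => label x (fst a)).card ≤
            (Finset.univ : Finset (Fin k)).card := Finset.card_image_le
        rw [Finset.card_univ, Fintype.card_fin] at hc2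
        omega
      · have hf : (Finset.univ.filter fun l => (steps x l).natAbs = label x i) = {i, j} := by
          have : (Finset.univ.filter fun l => (steps x l).natAbs = label x i) =
              Finset.univ.filter fun l => w l = w i :=
            Finset.filter_congr fun l _ => hker l i
          rw [this, h.filter_eq, ← h1, ← h2]
        rw [hf, Finset.sum_pair hij.ne]
        exact hne)
  rw [Fintype.card_fin] at this
  calc N * _ ≤ N * ((2 * (k - 1) + 3) ^ (2 * k) * N ^ (k - 1)) := Nat.mul_le_mul_left _ this
    _ = (2 * (k - 1) + 3) ^ (2 * k) * N ^ k := by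
        obtain ⟨m, rfl⟩ : ∃ m, k = m + 1 := ⟨k - 1, by omega⟩
        simp; ring
    _ ≤ _ := Nat.mul_le_mul_right _ (Nat.pow_le_pow_left (by omega) _)

theorem IsOccurrences.tendsto_card_kernelLoops (h : IsOccurrences w fst snd) :
    Tendsto (fun n : ℕ => ((kernelLoops w (n + 1)).card : ℝ) / ((n + 1 : ℕ) : ℝ) ^ (k + 1)) atTop
      (𝓝 (toeplitzVolume w)) := by
  set K : ℕ := (2 * k + 1) ^ (2 * k) + (2 * k + 3) ^ (2 * k)
  have hdiff : ∀ n : ℕ, |((kernelLoops w (n + 1)).card : ℝ) - (solutionPaths w (n + 1)).card| ≤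
      K * ((n + 1 : ℕ) : ℝ) ^ k := by
    intro n
    have h1 := h.card_solutionPaths_sdiff_le n.succ_pos
    have h2 := h.card_kernelLoops_sdiff_le n.succ_pos
    have h3 := Finset.card_sdiff_add_card_inter (solutionPaths w (n + 1)) (kernelLoops w (n + 1))
    have h4 := Finset.card_sdiff_add_card_inter (kernelLoops w (n + 1)) (solutionPaths w (n + 1))
    rw [Finset.inter_comm] at h4
    have h5 : (K : ℝ) * ((n + 1 : ℕ) : ℝ) ^ k = ((2 * k + 1) ^ (2 * k) * (n + 1) ^ k : ℕ) +
        ((2 * k + 3) ^ (2 * k) * (n + 1) ^ k : ℕ) := by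
      simp only [K]; push_cast; ring
    have h1' : ((solutionPaths w (n + 1) \ kernelLoops w (n + 1)).card : ℝ) ≤
      ((2 * k + 1) ^ (2 * k) * (n + 1) ^ k : ℕ) := by exact_mod_cast h1
    have h2' : ((kernelLoops w (n + 1) \ solutionPaths w (n + 1)).card : ℝ) ≤
      ((2 * k + 3) ^ (2 * k) * (n + 1) ^ k : ℕ) := by exact_mod_cast h2
    have p1 : (0 : ℝ) ≤ (solutionPaths w (n + 1) \ kernelLoops w (n + 1)).card := by positivity
    have p2 : (0 : ℝ) ≤ (kernelLoops w (n + 1) \ solutionPaths w (n + 1)).card := by positivity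
    rw [h5, ← h3, ← h4, abs_le]
    push_cast at h1' h2' ⊢
    constructor <;> linarith
  have hzero : Tendsto (fun n : ℕ => (((kernelLoops w (n + 1)).card : ℝ) -
      (solutionPaths w (n + 1)).card) / ((n + 1 : ℕ) : ℝ) ^ (k + 1)) atTop (𝓝 0) := by
    have hlim : Tendsto (fun n : ℕ => (K : ℝ) * (((n + 1 : ℕ) : ℝ))⁻¹) atTop (𝓝 (K * 0)) :=
      Tendsto.const_mul _ (tendsto_inv_atTop_zero.comp
        (tendsto_natCast_atTop_atTop.comp (tendsto_add_atTop_nat 1)))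
    rw [mul_zero] at hlim
    refine squeeze_zero_norm (fun n => ?_) hlim
    have hn : (0 : ℝ) < (n + 1 : ℕ) := Nat.cast_pos.2 n.succ_pos
    rw [norm_div, Real.norm_eq_abs, Real.norm_of_nonneg (by positivity), div_le_iff₀ (by positivity)]
    refine (hdiff n).trans (le_of_eq ?_)
    rw [pow_succ]
    field_simp
  have := hzero.add h.tendsto_card_solutionPaths'
  rw [zero_add] at this
  refine this.congr fun n => ?_
  rw [← add_div, sub_add_cancel]

/-- The partition determines the set of first occurrences, and alphabetic order makes `fst` its
increasing enumeration. -/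
theorem isPartitionWord_ext {w w' : Fin (2 * k) → Fin k} (hw : IsPartitionWord w)
    (hw' : IsPartitionWord w') (h : ∀ i j, w i = w j ↔ w' i = w' j) : w = w' := by
  obtain ⟨fst, snd, ho⟩ := hw.exists_occurrences
  obtain ⟨fst', snd', ho'⟩ := hw'.exists_occurrences
  have hr : ∀ {w : Fin (2 * k) → Fin k} {fst snd}, IsOccurrences w fst snd →
      Set.range fst = {i | ∀ j, w j = w i → i ≤ j} := by
    intro w fst snd ho
    ext i
    rw [Set.mem_ofPred_eq, ho.first_iff]
    constructor
    · rintro ⟨a, rfl⟩; rw [ho.apply_fst]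
    · exact fun hi => ⟨w i, hi.symm⟩
  have hfst : fst = fst' := by
    rw [← ho.mono.range_inj ho'.mono, hr ho, hr ho']
    ext i
    simp only [Set.mem_ofPred_eq, h]
  funext i
  have h1 : w' i = w' (fst (w i)) := (h _ _).1 (ho.apply_fst (w i)).symm
  rw [h1, hfst, ho'.apply_fst]

/-- The minima of the label classes, `k` in number as classes have two elements, are enumerated
increasingly; each position receives the index of the minimum of its class. -/
theorem exists_isPartitionWord {l : Fin (2 * k) → ℕ} (hl : ∀ i, multiplicity l i = 2) :
    ∃ w : Fin (2 * k) → Fin k, IsPartitionWord w ∧ ∀ i j, l i = l j ↔ w i = w j := by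
  classical
  set F : Finset (Fin (2 * k)) := Finset.univ.filter fun i => ∀ j, l j = l i → i ≤ j with hF
  have hFmem : ∀ {i}, i ∈ F ↔ ∀ j, l j = l i → i ≤ j := by simp [hF]
  have hinj : ∀ i ∈ F, ∀ j ∈ F, l i = l j → i = j := fun i hi j hj hij =>
    le_antisymm (hFmem.1 hi j hij.symm) (hFmem.1 hj i hij)
  have hmin : ∀ i, ∃ f ∈ F, l f = l i := by
    intro i
    have hne : (Finset.univ.filter fun j => l j = l i).Nonempty := ⟨i, by simp⟩
    refine ⟨_, hFmem.2 fun j hj => ?_, (Finset.mem_filter.1 (Finset.min'_mem _ hne)).2⟩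
    refine Finset.min'_le _ _ (Finset.mem_filter.2 ⟨Finset.mem_univ _, ?_⟩)
    rw [hj, (Finset.mem_filter.1 (Finset.min'_mem _ hne)).2]
  have hcard : F.card = k := by
    have h1 : F.image l = Finset.univ.image l := by
      refine Finset.Subset.antisymm (Finset.image_subset_image (Finset.subset_univ _)) ?_
      intro v hv
      obtain ⟨i, -, rfl⟩ := Finset.mem_image.1 hv
      obtain ⟨f, hf, hfi⟩ := hmin i
      exact Finset.mem_image.2 ⟨f, hf, hfi⟩
    have h2 : (F.image l).card = F.card :=
      Finset.card_image_of_injOn fun i hi j hj hij => hinj i hi j hj hij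
    have h3 := two_mul_card_image_eq hl
    rw [Fintype.card_fin, ← h1, h2] at h3
    omega
  let e := F.orderEmbOfFin hcard
  have heF : ∀ a, e a ∈ F := fun a => F.orderEmbOfFin_mem hcard a
  have hsurj : ∀ f ∈ F, ∃ a, e a = f := fun f hf => by
    have : f ∈ Set.range e := by rw [F.range_orderEmbOfFin hcard]; exact hf
    exact this
  have hex : ∀ i, ∃ a, l (e a) = l i := by
    intro i
    obtain ⟨f, hf, hfi⟩ := hmin i
    obtain ⟨a, rfl⟩ := hsurj f hf
    exact ⟨a, hfi⟩
  choose w hw using hex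
  have hwiff : ∀ i a, w i = a ↔ l i = l (e a) := by
    intro i a
    constructor
    · rintro rfl; exact (hw i).symm
    · intro h
      exact e.injective (hinj _ (heF _) _ (heF _) (by rw [hw, h]))
  refine ⟨w, ⟨fun a => ?_, fun a b hab => ⟨e a, (hwiff _ _).2 rfl, fun j hj => ?_⟩⟩,
    fun i j => ?_⟩
  · simp only [hwiff]; exact hl (e a)
  · have := hFmem.1 (heF b) j ((hwiff j b).1 hj)
    exact (e.strictMono hab).trans_le this
  · rw [hwiff, hw]

theorem card_pairLoops_eq : (pairLoops N (2 * k)).card =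
    ∑ w ∈ partitionWords k, (kernelLoops w N).card := by
  rw [← Finset.card_biUnion]
  · congr 1
    ext x
    simp only [Finset.mem_biUnion]
    constructor
    · intro hx
      obtain ⟨hxl, hxm⟩ := Finset.mem_filter.1 hx
      obtain ⟨w, hw, hker⟩ := exists_isPartitionWord hxm
      exact ⟨w, Finset.mem_filter.2 ⟨Finset.mem_univ _, hw⟩, Finset.mem_filter.2 ⟨hxl, hker⟩⟩
    · rintro ⟨w, hw, hx⟩
      obtain ⟨hxl, hker⟩ := Finset.mem_filter.1 hx
      refine Finset.mem_filter.2 ⟨hxl, fun i => ?_⟩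
      rw [multiplicity]
      simp only [hker]
      exact (Finset.mem_filter.1 hw).2.1 (w i)
  · intro w hw w' hw' hne
    simp only [Function.onFun]
    rw [Finset.disjoint_left]
    intro x hx hx'
    refine hne (isPartitionWord_ext (Finset.mem_filter.1 hw).2 (Finset.mem_filter.1 hw').2
      fun i j => ?_)
    rw [← (Finset.mem_filter.1 hx).2 i j, (Finset.mem_filter.1 hx').2 i j]

theorem tendsto_card_pairLoops (k : ℕ) :
    Tendsto (fun n : ℕ => ((pairLoops (n + 1) (2 * k)).card : ℝ) / ((n + 1 : ℕ) : ℝ) ^ (k + 1))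
      atTop (𝓝 (∑ w ∈ partitionWords k, toeplitzVolume w)) := by
  simp only [card_pairLoops_eq, Nat.cast_sum, Finset.sum_div]
  refine tendsto_finsetSum _ fun w hw => ?_
  obtain ⟨fst, snd, h⟩ := (Finset.mem_filter.1 hw).2.exists_occurrences
  exact h.tendsto_card_kernelLoops

/-- The positions of second occurrences determine the word: their complement consists of the first
occurrences, whose order is forced. The crude bound is small enough against `(2k)!` for the moment
method. -/
theorem card_partitionWords_le (k : ℕ) : (partitionWords k).card ≤ (2 * k) ^ k := by
  have hex : ∀ w ∈ partitionWords k, ∃ snd : Fin k → Fin (2 * k), ∃ fst,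
      IsOccurrences w fst snd := fun w hw => by
    obtain ⟨fst, snd, h⟩ := (Finset.mem_filter.1 hw).2.exists_occurrences
    exact ⟨snd, fst, h⟩
  rcases Nat.eq_zero_or_pos k with rfl | hk
  · simpa using Finset.card_le_univ (partitionWords 0)
  have : Nonempty (Fin (2 * k)) := ⟨⟨0, by omega⟩⟩
  choose! snd fst h using hex
  have hr : ∀ w ∈ partitionWords k, Set.range (fst w) = (Set.range (snd w))ᶜ := by
    intro w hw
    ext i
    have hi := ((h w hw).iff i (w i)).1 rfl
    simp only [Set.mem_range, Set.mem_compl_iff, not_exists]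
    constructor
    · rintro ⟨a, rfl⟩ b hb
      have h1 := (h w hw).apply_fst a
      have h2 := (h w hw).apply_snd b
      rw [hb, h1] at h2
      subst h2
      exact ((h w hw).lt a).ne' hb
    · intro hn
      rcases hi with hi | hi
      · exact ⟨_, hi.symm⟩
      · exact absurd hi.symm (hn _)
  have hinj : Set.InjOn snd (partitionWords k : Set (Fin (2 * k) → Fin k)) := by
    intro w hw w' hw' he
    have hf : fst w = fst w' := by
      rw [← (h w hw).mono.range_inj (h w' hw').mono, hr w hw, hr w' hw', he]
    funext i
    have := ((h w hw).iff i (w i)).1 rfl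
    rw [hf, he] at this
    exact (((h w' hw').iff i (w i)).2 this).symm
  have := Finset.card_le_card_of_injOn snd
    (t := (Finset.univ : Finset (Fin k → Fin (2 * k)))) (fun _ _ => by simp) hinj
  simpa using this

theorem sum_toeplitzVolume_le (k : ℕ) :
    ∑ w ∈ partitionWords k, toeplitzVolume w ≤ (2 * k : ℝ) ^ k := by
  calc ∑ w ∈ partitionWords k, toeplitzVolume w ≤ ∑ w ∈ partitionWords k, (1 : ℝ) :=
        Finset.sum_le_sum fun w _ => toeplitzVolume_le_one w
    _ = (partitionWords k).card := by simp
    _ ≤ _ := by exact_mod_cast card_partitionWords_le k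

end PairLoops

/-! ### A factorial lower bound for the moments -/

section LowerBound

variable {k N : ℕ}

/-- The multiset of steps of a path, shifted into `Fin (2 * N)`. -/
def stepMultiset (y : Fin (k + 1) → Fin N) : Sym (Fin (2 * N)) k :=
  ⟨(Finset.univ : Finset (Fin k)).val.map fun i => ⟨(steps y i + N).toNat, by
    have := natAbs_steps_lt y i; omega⟩, by simp⟩

theorem map_steps_eq {y z : Fin (k + 1) → Fin N} (h : stepMultiset y = stepMultiset z) :
    (Finset.univ : Finset (Fin k)).val.map (steps y) =
      (Finset.univ : Finset (Fin k)).val.map (steps z) := by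
  have h1 := congrArg (fun s => Multiset.map (fun v : Fin (2 * N) => ((v : ℕ) : ℤ) - N) s.1) h
  simp only [stepMultiset, Multiset.map_map, Function.comp_def] at h1
  have h2 : ∀ (y : Fin (k + 1) → Fin N) i, (((steps y i + N).toNat : ℕ) : ℤ) - N = steps y i := by
    intro y i
    have := natAbs_steps_lt y i
    omega
  simpa only [h2] using h1

theorem exists_steps_eq {y z : Fin (k + 1) → Fin N} (h : stepMultiset y = stepMultiset z)
    (i : Fin k) : ∃ j, steps z j = steps y i := by
  have : steps y i ∈ (Finset.univ : Finset (Fin k)).val.map (steps z) := by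
    rw [← map_steps_eq h]
    exact Multiset.mem_map.2 ⟨i, by simp, rfl⟩
  obtain ⟨j, -, hj⟩ := Multiset.mem_map.1 this
  exact ⟨j, hj⟩

theorem last_eq_of_stepMultiset_eq {y z : Fin (k + 1) → Fin N} (h0 : y 0 = z 0)
    (h : stepMultiset y = stepMultiset z) : y (Fin.last k) = z (Fin.last k) := by
  have h1 : ∑ i, steps y i = ∑ i, steps z i := congrArg Multiset.sum (map_steps_eq h)
  rw [sum_steps, sum_steps, h0] at h1
  exact Fin.ext (by omega)

/-- Follow `y` and return along `z`. -/
def glue (p : (Fin (k + 1) → Fin N) × (Fin (k + 1) → Fin N)) : Fin (2 * k + 1) → Fin N := fun i =>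
  if h : (i : ℕ) ≤ k then p.1 ⟨i, by omega⟩ else p.2 ⟨2 * k - i, by omega⟩

theorem steps_glue_of_lt {p : (Fin (k + 1) → Fin N) × (Fin (k + 1) → Fin N)} (i : Fin k) :
    steps (glue p) ⟨i, by omega⟩ = steps p.1 i := by
  have := i.2
  have h1 : (i : ℕ) + 1 ≤ k := i.2
  simp only [steps, glue, Fin.val_castSucc, Fin.val_succ, i.2.le, h1, dif_pos]
  rfl

/-- The return leg runs `p.2` backwards, which reverses the order and the sign of its steps. The
common endpoint is needed at the junction, where `glue` takes its value from `p.1`. -/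
theorem steps_glue_of_ge {p : (Fin (k + 1) → Fin N) × (Fin (k + 1) → Fin N)}
    (hp : p.1 (Fin.last k) = p.2 (Fin.last k)) (j : Fin k) :
    steps (glue p) ⟨2 * k - 1 - j, by omega⟩ = -steps p.2 j := by
  have hj := j.2
  have h1 : ¬ (2 * k - 1 - (j : ℕ) + 1 ≤ k) := by omega
  have e1 : glue p (Fin.succ ⟨2 * k - 1 - j, by omega⟩) = p.2 j.castSucc := by
    simp only [glue, Fin.val_succ]
    rw [dif_neg h1]
    exact congrArg p.2 (Fin.ext (by
      change 2 * k - (2 * k - 1 - (j : ℕ) + 1) = (j : ℕ); omega))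
  have e2 : glue p (Fin.castSucc ⟨2 * k - 1 - j, by omega⟩) = p.2 j.succ := by
    simp only [glue, Fin.val_castSucc]
    split_ifs with h2
    · have h3 : (j : ℕ) + 1 = k := by omega
      have h4 : (⟨2 * k - 1 - j, by omega⟩ : Fin (k + 1)) = Fin.last k := Fin.ext (by simp; omega)
      have h5 : j.succ = Fin.last k := Fin.ext (by simp; omega)
      rw [h4, h5, hp]
    · exact congrArg p.2 (Fin.ext (by
        change 2 * k - (2 * k - 1 - (j : ℕ)) = (j : ℕ) + 1; omega))
  simp only [steps, e1, e2]
  ring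

/-- Pairs of paths with the same starting point and the same multiset of steps. -/
def returnPairs (k N : ℕ) : Finset ((Fin (k + 1) → Fin N) × (Fin (k + 1) → Fin N)) :=
  Finset.univ.filter fun p => p.1 0 = p.2 0 ∧ stepMultiset p.1 = stepMultiset p.2

/-- Every step of one leg has a partner of the same length in the other leg, so no label is
isolated. -/
theorem glue_mem {p : (Fin (k + 1) → Fin N) × (Fin (k + 1) → Fin N)} (hp : p ∈ returnPairs k N) :
    glue p ∈ (loops N (2 * k)).filter fun x => ∀ i, 2 ≤ multiplicity (label x) i := by
  obtain ⟨h0, hs⟩ := (Finset.mem_filter.1 hp).2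
  have hlast := last_eq_of_stepMultiset_eq h0 hs
  have hl1 : ∀ i : Fin k, label (glue p) ⟨i, by omega⟩ = label p.1 i := fun i => by
    simp only [label, steps_glue_of_lt]
  have hl2 : ∀ j : Fin k, label (glue p) ⟨2 * k - 1 - j, by omega⟩ = label p.2 j := fun j => by
    simp only [label, steps_glue_of_ge hlast, Int.natAbs_neg]
  refine Finset.mem_filter.2 ⟨Finset.mem_filter.2 ⟨Finset.mem_univ _, ?_⟩, fun i => ?_⟩
  · have e0 : glue p 0 = p.1 0 := dif_pos (Nat.zero_le k)
    have e1 : glue p (Fin.last (2 * k)) = p.2 0 := by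
      simp only [glue]
      split_ifs with h
      · have hk : k = 0 := by rw [Fin.val_last] at h; omega
        subst hk
        exact h0
      · exact congrArg p.2 (Fin.ext (Nat.sub_self (2 * k)))
    rw [e0, e1, h0]
  · have hex : ∃ j, j ≠ i ∧ label (glue p) j = label (glue p) i := by
      rcases Nat.lt_or_ge i k with hi | hi
      · obtain ⟨j, hj⟩ := exists_steps_eq hs ⟨i, hi⟩
        refine ⟨⟨2 * k - 1 - j, by omega⟩, fun he => ?_, ?_⟩
        · have := congrArg Fin.val he
          simp only at this
          omega
        · rw [hl2, label, hj]
          exact (hl1 ⟨i, hi⟩).symm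
      · have h2 := i.2
        obtain ⟨j, hj⟩ := exists_steps_eq hs.symm ⟨2 * k - 1 - i, by omega⟩
        refine ⟨⟨j, by omega⟩, fun he => ?_, ?_⟩
        · have := congrArg Fin.val he
          simp only at this
          omega
        · rw [hl1, label, hj]
          have := hl2 ⟨2 * k - 1 - i, by omega⟩
          rw [label] at this
          rw [← label, ← this, label]
          congr 2
          exact Fin.ext (by simp; omega)
    obtain ⟨j, hji, hj⟩ := hex
    have : ({j, i} : Finset _) ⊆ Finset.univ.filter fun l => label (glue p) l = label (glue p) i := by
      intro l hl
      simp only [Finset.mem_insert, Finset.mem_singleton] at hl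
      rcases hl with rfl | rfl <;> simp [hj]
    exact (Finset.card_pair hji).symm.le.trans (Finset.card_le_card this)

theorem glue_injOn : Set.InjOn (glue (k := k) (N := N)) (returnPairs k N : Set _) := by
  intro p hp q hq h
  obtain ⟨h0, hs⟩ := (Finset.mem_filter.1 hp).2
  obtain ⟨h0', hs'⟩ := (Finset.mem_filter.1 hq).2
  have hy : p.1 = q.1 := by
    funext i
    have := congrFun h ⟨i, by omega⟩
    simp only [glue, Nat.lt_succ_iff.1 i.2, dif_pos] at this
    exact this
  refine Prod.ext hy (funext fun i => ?_)
  rcases Nat.lt_or_ge i k with hi | hi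
  · have := congrFun h ⟨2 * k - i, by omega⟩
    have hn : ¬ (2 * k - (i : ℕ) ≤ k) := by omega
    simp only [glue, hn, dif_neg, not_false_eq_true] at this
    have he : (⟨2 * k - (2 * k - i), by omega⟩ : Fin (k + 1)) = i := Fin.ext (by simp; omega)
    rwa [he] at this
  -- The glued path does not store the endpoint of `p.2`; it is the endpoint of `p.1`, since starts
  -- and step multisets agree.
  · have he : i = Fin.last k := Fin.ext (by simp; omega)
    rw [he, ← last_eq_of_stepMultiset_eq h0 hs, hy, last_eq_of_stepMultiset_eq h0' hs']

theorem card_returnPairs_le (hN : 0 < N) : (returnPairs k N).card ≤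
    (pairLoops N (2 * k)).card + (2 * (2 * k) + 1) ^ (2 * k) * N ^ k := by
  have h1 := Finset.card_le_card_of_injOn glue (fun p hp => glue_mem hp) (glue_injOn (k := k) (N := N))
  refine h1.trans ?_
  have h2 := card_degenerateLoops_le hN (2 * k)
  rw [show (2 * k + 1) / 2 = k by omega] at h2
  refine le_trans (Finset.card_le_card ?_) ((Finset.card_union_le _ _).trans
    (Nat.add_le_add_left h2 _))
  intro x hx
  obtain ⟨hxl, hx2⟩ := Finset.mem_filter.1 hx
  by_cases h : ∀ i, multiplicity (label x) i = 2
  · exact Finset.mem_union_left _ (Finset.mem_filter.2 ⟨hxl, h⟩)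
  · exact Finset.mem_union_right _ (Finset.mem_filter.2 ⟨hxl, hx2, h⟩)

/-- Cauchy–Schwarz over the fibres of the map from a path to its starting point and multiset of
steps; return pairs are pairs in the same fibre. -/
theorem sq_card_le_card_mul_card_returnPairs :
    (N ^ (k + 1)) ^ 2 ≤ (N * (2 * N).multichoose k) * (returnPairs k N).card := by
  classical
  let f : (Fin (k + 1) → Fin N) → Fin N × Sym (Fin (2 * N)) k := fun y => (y 0, stepMultiset y)
  have h1 : ∑ c, (Finset.univ.filter fun y => f y = c).card = N ^ (k + 1) := by
    have := Finset.card_eq_sum_card_fiberwise (s := (Finset.univ : Finset (Fin (k + 1) → Fin N)))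
      (t := Finset.univ) (f := f) (fun _ _ => by simp)
    rw [← this]
    simp
  have h2 : ∑ c, (Finset.univ.filter fun y => f y = c).card ^ 2 = (returnPairs k N).card := by
    have hm : ∀ p ∈ returnPairs k N, f p.1 ∈ (Finset.univ : Finset (Fin N × Sym (Fin (2 * N)) k)) :=
      fun _ _ => by simp
    rw [Finset.card_eq_sum_card_fiberwise hm]
    refine Finset.sum_congr rfl fun c _ => ?_
    rw [sq, ← Finset.card_product]
    congr 1
    ext p
    simp only [returnPairs, Finset.mem_product, Finset.mem_filter, Finset.mem_univ, true_and, f,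
      Prod.ext_iff]
    constructor
    · rintro ⟨⟨a, b⟩, c, d⟩
      exact ⟨⟨a.trans c.symm, b.trans d.symm⟩, a, b⟩
    · rintro ⟨⟨a, b⟩, c, d⟩
      exact ⟨⟨c, d⟩, a.symm.trans c, b.symm.trans d⟩
  have h3 := sq_sum_le_card_mul_sum_sq (s := (Finset.univ : Finset (Fin N × Sym (Fin (2 * N)) k)))
    (f := fun c => (Finset.univ.filter fun y => f y = c).card)
  rw [h1, h2] at h3
  simpa [Fintype.card_prod, Sym.card_sym_eq_multichoose] using h3

/-- Dividing `N ^ (2 * k + 2)` by about `N * (2 * N) ^ k / k !` classes leaves at least about `N ^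
(k + 1) * k ! / 2 ^ k` return pairs; these inject into pair loops up to `O(N ^ k)` degenerate ones.
-/
theorem factorial_div_le_sum_toeplitzVolume (k : ℕ) :
    (k ! : ℝ) / 2 ^ k ≤ ∑ w ∈ partitionWords k, toeplitzVolume w := by
  set K : ℝ := (2 * (2 * k) + 1) ^ (2 * k)
  have hkey : ∀ n : ℕ, (k ! : ℝ) * (((n + 1 : ℕ) : ℝ) / (2 * ((n + 1 : ℕ) : ℝ) + k)) ^ k ≤
      ((pairLoops (n + 1) (2 * k)).card : ℝ) / ((n + 1 : ℕ) : ℝ) ^ (k + 1) +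
        K * (((n + 1 : ℕ) : ℝ))⁻¹ := by
    intro n
    set N := n + 1
    have hN : (0 : ℝ) < (N : ℕ) := Nat.cast_pos.2 n.succ_pos
    have h1 : ((N : ℝ) ^ (k + 1)) ^ 2 ≤ (N * ((2 * N).multichoose k : ℝ)) *
        (returnPairs k N).card := by
      exact_mod_cast sq_card_le_card_mul_card_returnPairs (k := k) (N := N)
    have h2 : ((returnPairs k N).card : ℝ) ≤ (pairLoops N (2 * k)).card + K * (N : ℝ) ^ k := by
      have := card_returnPairs_le (k := k) (N := N) n.succ_pos
      simp only [K]
      exact_mod_cast this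
    have h3 : ((2 * N).multichoose k : ℝ) ≤ (2 * (N : ℝ) + k) ^ k / k ! := by
      rw [Nat.multichoose_eq]
      refine (Nat.choose_le_pow_div k _).trans ?_
      gcongr
      have : 2 * N + k - 1 ≤ 2 * N + k := Nat.sub_le _ _
      exact_mod_cast this
    have h4 : ((N : ℝ) ^ (k + 1)) ^ 2 ≤ (N * ((2 * (N : ℝ) + k) ^ k / k !)) *
        ((pairLoops N (2 * k)).card + K * (N : ℝ) ^ k) :=
      h1.trans (by gcongr)
    have hb : 0 < 2 * (N : ℝ) + k := by positivity
    have hk : (0 : ℝ) < k ! := by positivity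
    rw [div_pow, ← mul_div_assoc, div_le_iff₀ (by positivity)]
    have h5 : ((pairLoops N (2 * k)).card / (N : ℝ) ^ (k + 1) + K * (N : ℝ)⁻¹) =
        ((pairLoops N (2 * k)).card + K * (N : ℝ) ^ k) / (N : ℝ) ^ (k + 1) := by
      rw [add_div, pow_succ]
      field_simp
    rw [h5, div_mul_eq_mul_div, le_div_iff₀ (by positivity)]
    have h6 : (N : ℝ) * ((k ! : ℝ) * (N : ℝ) ^ k * (N : ℝ) ^ (k + 1)) ≤ (N : ℝ) *
        ((((pairLoops N (2 * k)).card : ℝ) + K * (N : ℝ) ^ k) * (2 * (N : ℝ) + k) ^ k) := by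
      calc (N : ℝ) * ((k ! : ℝ) * (N : ℝ) ^ k * (N : ℝ) ^ (k + 1)) =
            (k ! : ℝ) * ((N : ℝ) ^ (k + 1)) ^ 2 := by ring
        _ ≤ (k ! : ℝ) * ((N * ((2 * (N : ℝ) + k) ^ k / k !)) *
              ((pairLoops N (2 * k)).card + K * (N : ℝ) ^ k)) :=
            mul_le_mul_of_nonneg_left h4 hk.le
        _ = _ := by field_simp
    exact le_of_mul_le_mul_left h6 hN
  have hN : Tendsto (fun n : ℕ => ((n + 1 : ℕ) : ℝ)) atTop atTop :=
    tendsto_natCast_atTop_atTop.comp (tendsto_add_atTop_nat 1)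
  have hinv : Tendsto (fun n : ℕ => (((n + 1 : ℕ) : ℝ))⁻¹) atTop (𝓝 0) :=
    tendsto_inv_atTop_zero.comp hN
  have hr : Tendsto (fun n : ℕ => ((n + 1 : ℕ) : ℝ) / (2 * ((n + 1 : ℕ) : ℝ) + k)) atTop
      (𝓝 (1 / 2)) := by
    have : Tendsto (fun n : ℕ => 1 / (2 + k * (((n + 1 : ℕ) : ℝ))⁻¹)) atTop
        (𝓝 (1 / (2 + k * 0))) :=
      Tendsto.div tendsto_const_nhds (tendsto_const_nhds.add (hinv.const_mul _)) (by simp)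
    rw [mul_zero, add_zero] at this
    refine this.congr fun n => ?_
    have : ((n + 1 : ℕ) : ℝ) ≠ 0 := Nat.cast_ne_zero.2 n.succ_ne_zero
    field_simp
  have hL := (hr.pow k).const_mul (k ! : ℝ)
  have hR := (tendsto_card_pairLoops k).add (hinv.const_mul K)
  rw [mul_zero, add_zero] at hR
  have := le_of_tendsto_of_tendsto' hL hR hkey
  rwa [one_div, inv_pow, ← div_eq_mul_inv] at this

end LowerBound

/-! ### The method of moments -/

section MomentMethod

/-- The Taylor remainder of `exp` along an imaginary direction. -/
theorem norm_exp_mul_sub_sum_le {c : ℂ} (hre : c.re = 0) (hc : ‖c‖ = 1) (N : ℕ) {y : ℝ}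
    (hy : 0 ≤ y) :
    ‖Complex.exp (y * c) - ∑ j ∈ Finset.range N, (y * c) ^ j / (j ! : ℂ)‖ ≤ y ^ N / N ! := by
  induction N generalizing y with
  | zero => simp [Complex.norm_exp, hre]
  | succ N ih =>
    -- The derivative of a Taylor remainder is `c` times the preceding remainder, and `B'` is the
    -- preceding bound.
    have key := image_norm_le_of_norm_deriv_right_le_deriv_boundary (a := 0) (b := y)
      (f := fun s : ℝ => Complex.exp (s * c) - ∑ j ∈ Finset.range (N + 1), (s * c) ^ j / (j ! : ℂ))
      (f' := fun s : ℝ => c * (Complex.exp (s * c) -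
        ∑ j ∈ Finset.range N, (s * c) ^ j / (j ! : ℂ)))
      (B := fun s => s ^ (N + 1) / (N + 1)!) (B' := fun s => s ^ N / N !) ?_ ?_ ?_ ?_ ?_
    · exact key ⟨hy, le_rfl⟩
    · fun_prop
    · intro s _
      apply HasDerivAt.hasDerivWithinAt
      have h0 : HasDerivAt (fun s : ℝ => (s : ℂ) * c) c s := by
        simpa using (Complex.ofRealCLM.hasDerivAt (x := s)).mul_const c
      have h1 : HasDerivAt (fun s : ℝ => Complex.exp ((s : ℂ) * c)) (Complex.exp (s * c) * c) s :=
        h0.cexp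
      have h2 : HasDerivAt (fun s : ℝ => ∑ j ∈ Finset.range (N + 1), ((s : ℂ) * c) ^ j / (j ! : ℂ))
          (∑ j ∈ Finset.range (N + 1), (j * ((s : ℂ) * c) ^ (j - 1) * c) / (j ! : ℂ)) s :=
        HasDerivAt.fun_sum fun j _ => (h0.pow j).div_const _
      refine (h1.sub h2).congr_deriv (Eq.symm ?_)
      rw [Finset.sum_range_succ', mul_sub, mul_comm c, Finset.mul_sum]
      congr 1
      simp only [Nat.cast_zero, zero_mul, zero_div, add_zero, Nat.add_sub_cancel]
      refine Finset.sum_congr rfl fun j _ => ?_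
      rw [Nat.factorial_succ]
      have : (j ! : ℂ) ≠ 0 := Nat.cast_ne_zero.2 (Nat.factorial_ne_zero j)
      have : ((j : ℂ) + 1) ≠ 0 := Nat.cast_add_one_ne_zero j
      push_cast
      field_simp
    · rw [Finset.sum_range_succ']
      simp
    · intro s
      refine ((hasDerivAt_pow (N + 1) s).div_const ((N + 1)! : ℝ)).congr_deriv ?_
      rw [Nat.factorial_succ]
      have : (N ! : ℝ) ≠ 0 := Nat.cast_ne_zero.2 (Nat.factorial_ne_zero N)
      have : ((N : ℝ) + 1) ≠ 0 := Nat.cast_add_one_ne_zero N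
      push_cast
      field_simp
    · intro s hs
      rw [norm_mul, hc, one_mul]
      exact ih hs.1

theorem norm_exp_mul_I_sub_sum_le (N : ℕ) (y : ℝ) :
    ‖Complex.exp (y * Complex.I) - ∑ j ∈ Finset.range N, (y * Complex.I) ^ j / (j ! : ℂ)‖ ≤
      |y| ^ N / N ! := by
  rcases le_total 0 y with hy | hy
  · rw [abs_of_nonneg hy]
    exact norm_exp_mul_sub_sum_le (by simp) (by simp) N hy
  · rw [abs_of_nonpos hy]
    simpa using norm_exp_mul_sub_sum_le (c := -Complex.I) (by simp) (by simp) N (neg_nonneg.2 hy)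

/-- The measure `μ` has finite moments of all orders, given by the sequence `m`. -/
def HasMoments (μ : Measure ℝ) (m : ℕ → ℝ) : Prop :=
  ∀ r : ℕ, Integrable (fun x : ℝ => x ^ r) μ ∧ ∫ x, x ^ r ∂μ = m r

theorem HasMoments.norm_charFun_sub_sum_le {μ : Measure ℝ} [IsProbabilityMeasure μ] {m : ℕ → ℝ}
    (h : HasMoments μ m) (t : ℝ) (K : ℕ) :
    ‖charFun μ t - ∑ j ∈ Finset.range (2 * K), (t * Complex.I) ^ j / (j ! : ℂ) * (m j : ℂ)‖ ≤
      t ^ (2 * K) / (2 * K)! * m (2 * K) := by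
  have hint : ∀ j, Integrable (fun x : ℝ => (t * Complex.I) ^ j / (j ! : ℂ) * ((x ^ j : ℝ) : ℂ)) μ :=
    fun j => ((h j).1.ofReal (𝕜 := ℂ)).const_mul _
  have hexp : Integrable (fun x : ℝ => Complex.exp (t * x * Complex.I)) μ := by
    refine (integrable_const (1 : ℝ)).mono' (by fun_prop) (ae_of_all _ fun x => ?_)
    rw [← Complex.ofReal_mul, Complex.norm_exp_ofReal_mul_I]
  have hsum : ∑ j ∈ Finset.range (2 * K), (t * Complex.I) ^ j / (j ! : ℂ) * (m j : ℂ) =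
      ∫ x, ∑ j ∈ Finset.range (2 * K), (t * Complex.I) ^ j / (j ! : ℂ) * ((x ^ j : ℝ) : ℂ) ∂μ := by
    rw [integral_finsetSum _ fun j _ => hint j]
    refine Finset.sum_congr rfl fun j _ => ?_
    rw [integral_const_mul, integral_complex_ofReal, (h j).2]
  rw [hsum, charFun_apply_real, ← integral_sub hexp (integrable_finsetSum _ fun j _ => hint j),
    ← (h (2 * K)).2, ← integral_const_mul]
  refine norm_integral_le_of_norm_le ((h (2 * K)).1.const_mul _) (ae_of_all _ fun x => ?_)
  have := norm_exp_mul_I_sub_sum_le (2 * K) (t * x)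
  rw [(even_two_mul K).pow_abs, mul_pow] at this
  convert this using 1
  · congr 2
    · push_cast; rfl
    · refine Finset.sum_congr rfl fun j _ => ?_
      push_cast
      ring
  · ring

/-- The Taylor remainders of order `2 * K` are bounded by moments, which converge. Hence one `K`,
chosen for the limit, serves all large `n`, and finitely many moments remain. -/
theorem tendsto_charFun_of_hasMoments {μ : ℕ → ProbabilityMeasure ℝ} {γ : ProbabilityMeasure ℝ}
    {m : ℕ → ℝ} {M : ℕ → ℕ → ℝ} (hγ : HasMoments γ m) (hμ : ∀ n, HasMoments (μ n) (M n))
    (hM : ∀ r, Tendsto (fun n => M n r) atTop (𝓝 (m r)))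
    (hm : ∀ t : ℝ, Tendsto (fun K : ℕ => t ^ (2 * K) / (2 * K)! * m (2 * K)) atTop (𝓝 0)) (t : ℝ) :
    Tendsto (fun n => charFun (μ n : Measure ℝ) t) atTop (𝓝 (charFun (γ : Measure ℝ) t)) := by
  rw [Metric.tendsto_atTop]
  intro ε hε
  obtain ⟨K, hK⟩ := ((hm t).eventually (gt_mem_nhds (show 0 < ε / 4 by positivity))).exists
  have h1 : Tendsto (fun n => t ^ (2 * K) / (2 * K)! * M n (2 * K)) atTop
      (𝓝 (t ^ (2 * K) / (2 * K)! * m (2 * K))) := (hM _).const_mul _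
  have h2 : Tendsto (fun n => ∑ j ∈ Finset.range (2 * K),
      (t * Complex.I) ^ j / (j ! : ℂ) * (M n j : ℂ)) atTop
      (𝓝 (∑ j ∈ Finset.range (2 * K), (t * Complex.I) ^ j / (j ! : ℂ) * (m j : ℂ))) :=
    tendsto_finsetSum _ fun j _ =>
      ((Complex.continuous_ofReal.tendsto _).comp (hM j)).const_mul _
  obtain ⟨N, hN⟩ := eventually_atTop.1 ((h1.eventually (gt_mem_nhds hK)).and
    (Metric.tendsto_nhds.1 h2 (ε / 4) (by positivity)))
  refine ⟨N, fun n hn => ?_⟩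
  obtain ⟨a1, a2⟩ := hN n hn
  have b1 := (hμ n).norm_charFun_sub_sum_le t K
  have b2 := hγ.norm_charFun_sub_sum_le t K
  rw [dist_eq_norm] at a2 ⊢
  set p := ∑ j ∈ Finset.range (2 * K), (t * Complex.I) ^ j / (j ! : ℂ) * (M n j : ℂ)
  set q := ∑ j ∈ Finset.range (2 * K), (t * Complex.I) ^ j / (j ! : ℂ) * (m j : ℂ)
  rw [norm_sub_rev] at b2
  calc ‖charFun (μ n : Measure ℝ) t - charFun (γ : Measure ℝ) t‖
      = ‖(charFun (μ n : Measure ℝ) t - p) + (p - q) + (q - charFun (γ : Measure ℝ) t)‖ := by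
        congr 1; ring
    _ ≤ ‖charFun (μ n : Measure ℝ) t - p‖ + ‖p - q‖ + ‖q - charFun (γ : Measure ℝ) t‖ :=
        norm_add₃_le
    _ < ε := by linarith

/-- Truncation of a real number to the interval `[-K, K]`. -/
noncomputable def clamp (K a : ℝ) : ℝ := max (-K) (min K a)

theorem abs_clamp_le {K : ℝ} (hK : 0 ≤ K) (a : ℝ) : |clamp K a| ≤ K := by
  unfold clamp
  exact abs_le.2 ⟨le_max_left _ _, max_le (by linarith) (min_le_left _ _)⟩

/-- Where truncation acts, `K ≤ |a|`, and the error is at most `|a| ≤ a ^ 2 / K`. Applied to powers,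
this controls truncation by a moment of twice the order. -/
theorem abs_sub_clamp_le {K : ℝ} (hK : 0 < K) (a : ℝ) : |a - clamp K a| ≤ a ^ 2 / K := by
  unfold clamp
  rw [le_div_iff₀ hK]
  rcases le_total a K with h | h
  · rw [min_eq_right h]
    rcases le_total (-K) a with h' | h'
    · rw [max_eq_right h']; simp; positivity
    · rw [max_eq_left h', abs_of_nonpos (by linarith)]; nlinarith
  · rw [min_eq_left h, max_eq_right (by linarith), abs_of_nonneg (by linarith)]; nlinarith

theorem continuous_clamp (K : ℝ) : Continuous (clamp K) := by
  unfold clamp; fun_prop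

theorem clamp_eq_self {K a : ℝ} (h : |a| ≤ K) : clamp K a = a := by
  have := abs_le.1 h
  rw [clamp, min_eq_right this.2, max_eq_right this.1]

/-- The bounded continuous function `x ↦ clamp K (x ^ r)`. -/
noncomputable def clampPow (K : ℝ) (hK : 0 ≤ K) (r : ℕ) : BoundedContinuousFunction ℝ ℝ :=
  BoundedContinuousFunction.ofNormedAddCommGroup (fun x => clamp K (x ^ r))
    ((continuous_clamp K).comp (continuous_pow r)) K fun _ => abs_clamp_le hK _

theorem integrable_clamp_pow (μ : Measure ℝ) [IsFiniteMeasure μ] {K : ℝ} (hK : 0 ≤ K) (r : ℕ) :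
    Integrable (fun x : ℝ => clamp K (x ^ r)) μ :=
  (clampPow K hK r).integrable μ

theorem tendsto_integral_clamp_pow {ι : Type*} {l : Filter ι} {μ : ι → ProbabilityMeasure ℝ}
    {γ : ProbabilityMeasure ℝ} (h : Tendsto μ l (𝓝 γ)) {K : ℝ} (hK : 0 ≤ K) (r : ℕ) :
    Tendsto (fun i => ∫ x, clamp K (x ^ r) ∂(μ i : Measure ℝ)) l
      (𝓝 (∫ x, clamp K (x ^ r) ∂(γ : Measure ℝ))) :=
  ProbabilityMeasure.tendsto_iff_forall_integral_tendsto.1 h (clampPow K hK r)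

theorem abs_integral_pow_sub_integral_clamp_le {μ : Measure ℝ} [IsFiniteMeasure μ] {r : ℕ}
    (h1 : Integrable (fun x : ℝ => x ^ r) μ) (h2 : Integrable (fun x : ℝ => x ^ (2 * r)) μ)
    {K : ℝ} (hK : 0 < K) :
    |∫ x, x ^ r ∂μ - ∫ x, clamp K (x ^ r) ∂μ| ≤ (∫ x, x ^ (2 * r) ∂μ) / K := by
  rw [← integral_sub h1 (integrable_clamp_pow μ hK.le r), ← integral_div, ← Real.norm_eq_abs]
  refine norm_integral_le_of_norm_le (h2.div_const _) (ae_of_all _ fun x => ?_)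
  have := abs_sub_clamp_le hK (x ^ r)
  rwa [← pow_mul, mul_comm r] at this

/-- The truncated powers are bounded and continuous, so their integrals pass to the limit and stay
below `m (2 * r)`; Fatou's lemma removes the truncation. -/
theorem integrable_pow_of_tendsto {ι : Type*} {l : Filter ι} [l.NeBot]
    {μ : ι → ProbabilityMeasure ℝ} {γ : ProbabilityMeasure ℝ} {M : ι → ℕ → ℝ} {m : ℕ → ℝ}
    (h : Tendsto μ l (𝓝 γ)) (hμ : ∀ i, HasMoments (μ i) (M i))
    (hM : ∀ r, Tendsto (fun i => M i r) l (𝓝 (m r))) (r : ℕ) :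
    Integrable (fun x : ℝ => x ^ (2 * r)) (γ : Measure ℝ) := by
  have hpos : ∀ x : ℝ, 0 ≤ x ^ (2 * r) := fun x => (even_two_mul r).pow_nonneg x
  have hclamp : ∀ (K : ℕ) (x : ℝ), 0 ≤ clamp K (x ^ (2 * r)) := fun K x =>
    le_max_of_le_right (le_min (Nat.cast_nonneg K) (hpos x))
  have hle : ∀ K : ℕ, ∫ x, clamp K (x ^ (2 * r)) ∂(γ : Measure ℝ) ≤ m (2 * r) := by
    intro K
    refine le_of_tendsto_of_tendsto (tendsto_integral_clamp_pow h (Nat.cast_nonneg K) (2 * r))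
      (hM (2 * r)) (Eventually.of_forall fun i => ?_)
    show _ ≤ M i (2 * r)
    rw [← (hμ i (2 * r)).2]
    refine integral_mono (integrable_clamp_pow _ (Nat.cast_nonneg K) _) (hμ i (2 * r)).1 fun x => ?_
    exact max_le ((neg_nonpos.2 (Nat.cast_nonneg K)).trans (hpos x)) (min_le_right _ _)
  refine ⟨by fun_prop, ?_⟩
  rw [hasFiniteIntegral_iff_ofReal (ae_of_all _ hpos)]
  refine lt_of_le_of_lt ?_ (ENNReal.ofReal_lt_top (r := m (2 * r)))
  calc ∫⁻ x, ENNReal.ofReal (x ^ (2 * r)) ∂(γ : Measure ℝ)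
      = ∫⁻ x, liminf (fun K : ℕ => ENNReal.ofReal (clamp K (x ^ (2 * r)))) atTop
          ∂(γ : Measure ℝ) := by
        refine lintegral_congr fun x => ?_
        refine (Tendsto.liminf_eq (tendsto_const_nhds.congr' ?_)).symm
        obtain ⟨N, hN⟩ := exists_nat_ge |x ^ (2 * r)|
        filter_upwards [eventually_ge_atTop N] with K hK
        rw [clamp_eq_self (hN.trans (Nat.cast_le.2 hK))]
    _ ≤ liminf (fun K : ℕ => ∫⁻ x, ENNReal.ofReal (clamp K (x ^ (2 * r))) ∂(γ : Measure ℝ))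
          atTop := lintegral_liminf_le fun K =>
            (((continuous_clamp K).comp (continuous_pow (2 * r))).measurable).ennreal_ofReal
    _ ≤ ENNReal.ofReal (m (2 * r)) := by
        refine liminf_le_of_frequently_le' (Frequently.of_forall fun K => ?_)
        rw [← ofReal_integral_eq_lintegral_ofReal (integrable_clamp_pow _ (Nat.cast_nonneg K) _)
          (ae_of_all _ (hclamp K))]
        exact ENNReal.ofReal_le_ofReal (hle K)

/-- The truncation error at level `K + 1` is bounded by moments of order `2 * r` along the whole
family, so limits may be taken before the level tends to infinity. A general filter is allowed
because an ultrafilter is used below. -/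
theorem hasMoments_of_tendsto {ι : Type*} {l : Filter ι} [l.NeBot]
    {μ : ι → ProbabilityMeasure ℝ} {γ : ProbabilityMeasure ℝ} {M : ι → ℕ → ℝ} {m : ℕ → ℝ}
    (h : Tendsto μ l (𝓝 γ)) (hμ : ∀ i, HasMoments (μ i) (M i))
    (hM : ∀ r, Tendsto (fun i => M i r) l (𝓝 (m r))) : HasMoments γ m := by
  have heven := integrable_pow_of_tendsto h hμ hM
  intro r
  have hint : Integrable (fun x : ℝ => x ^ r) (γ : Measure ℝ) := by
    refine ((integrable_const (1 : ℝ)).add (heven r)).mono' (by fun_prop) (ae_of_all _ fun x => ?_)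
    rw [Real.norm_eq_abs, Pi.add_apply, mul_comm, pow_mul, ← sq_abs (x ^ r)]
    nlinarith [sq_nonneg (|x ^ r| - 1)]
  refine ⟨hint, ?_⟩
  set J := ∫ x, x ^ (2 * r) ∂(γ : Measure ℝ)
  have key : ∀ K : ℕ, |∫ x, x ^ r ∂(γ : Measure ℝ) - m r| ≤ (J + m (2 * r)) / ((K : ℝ) + 1) := by
    intro K
    have hK : (0 : ℝ) < (K : ℝ) + 1 := by positivity
    have h1 := abs_integral_pow_sub_integral_clamp_le hint (heven r) hK
    have h2 : |m r - ∫ x, clamp ((K : ℝ) + 1) (x ^ r) ∂(γ : Measure ℝ)| ≤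
        m (2 * r) / ((K : ℝ) + 1) := by
      refine le_of_tendsto_of_tendsto
        ((hM r).sub (tendsto_integral_clamp_pow h hK.le r)).abs ((hM (2 * r)).div_const _)
        (Eventually.of_forall fun i => ?_)
      have := abs_integral_pow_sub_integral_clamp_le (hμ i r).1 (hμ i (2 * r)).1 hK
      rwa [(hμ i r).2, (hμ i (2 * r)).2] at this
    rw [abs_sub_comm] at h2
    rw [add_div]
    exact (abs_sub_le _ _ _).trans (add_le_add h1 h2)
  have hlim : Tendsto (fun K : ℕ => (J + m (2 * r)) / ((K : ℝ) + 1)) atTop (𝓝 0) := by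
    have := (tendsto_one_div_add_atTop_nhds_zero_nat (𝕜 := ℝ)).const_mul (J + m (2 * r))
    simpa [div_eq_mul_inv] using this
  have := ge_of_tendsto' hlim key
  exact sub_eq_zero.1 (abs_nonpos_iff.1 this)

theorem isTightMeasureSet_of_integral_sq_le {S : Set (ProbabilityMeasure ℝ)} {C : ℝ}
    (h : ∀ μ ∈ S, Integrable (fun x : ℝ => x ^ 2) (μ : Measure ℝ) ∧
      ∫ x, x ^ 2 ∂(μ : Measure ℝ) ≤ C) :
    IsTightMeasureSet {((μ : ProbabilityMeasure ℝ) : Measure ℝ) | μ ∈ S} := by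
  refine isTightMeasureSet_of_tendsto_measure_norm_gt ?_
  have hlim : Tendsto (fun r : ℝ => ENNReal.ofReal (C / r ^ 2)) atTop (𝓝 0) := by
    rw [← ENNReal.ofReal_zero]
    exact ENNReal.tendsto_ofReal
      (tendsto_const_nhds.div_atTop (tendsto_pow_atTop two_ne_zero))
  refine tendsto_of_tendsto_of_tendsto_of_le_of_le' tendsto_const_nhds hlim
    (Eventually.of_forall fun _ => zero_le) ?_
  filter_upwards [eventually_gt_atTop 0] with r hr
  refine iSup₂_le ?_
  rintro _ ⟨μ, hμ, rfl⟩
  obtain ⟨hint, hle⟩ := h μ hμ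
  have hmark := mul_meas_ge_le_integral_of_nonneg (ae_of_all _ fun x => sq_nonneg x) hint (r ^ 2)
  have hsub : {x : ℝ | r < ‖x‖} ⊆ {x : ℝ | r ^ 2 ≤ x ^ 2} := by
    intro x hx
    have hx : r < |x| := hx
    show r ^ 2 ≤ x ^ 2
    rw [← sq_abs x]
    gcongr
  have h2 : (μ : Measure ℝ).real {x : ℝ | r < ‖x‖} ≤ C / r ^ 2 := by
    rw [le_div_iff₀ (by positivity), mul_comm]
    refine le_trans (le_trans ?_ hmark) hle
    gcongr
    exact measure_ne_top _ _
  rw [← ofReal_measureReal]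
  exact ENNReal.ofReal_le_ofReal h2

/-- Convergence of all moments of a sequence of probability measures produces a probability measure
with the limiting moments. -/
theorem exists_hasMoments_of_tendsto {μ : ℕ → ProbabilityMeasure ℝ} {M : ℕ → ℕ → ℝ} {m : ℕ → ℝ}
    (hμ : ∀ i, HasMoments (μ i) (M i)) (hM : ∀ r, Tendsto (fun i => M i r) atTop (𝓝 (m r))) :
    ∃ γ : ProbabilityMeasure ℝ, HasMoments γ m := by
  obtain ⟨C, hC⟩ := (hM 2).bddAbove_range
  have htight : IsTightMeasureSet
      {((ν : ProbabilityMeasure ℝ) : Measure ℝ) | ν ∈ Set.range μ} := by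
    refine isTightMeasureSet_of_integral_sq_le (C := C) ?_
    rintro _ ⟨i, rfl⟩
    exact ⟨(hμ i 2).1, (hμ i 2).2.trans_le (hC ⟨i, rfl⟩)⟩
  -- Prokhorov: in the compact closure an ultrafilter finer than `atTop` converges, which replaces
  -- the choice of a subsequence.
  obtain ⟨γ, -, hγ⟩ := (isCompact_closure_of_isTightMeasureSet htight).ultrafilter_le_nhds'
    ((hyperfilter ℕ).map μ)
    (by
      rw [Ultrafilter.mem_map]
      exact Filter.mem_of_superset Filter.univ_mem fun i _ => subset_closure ⟨i, rfl⟩)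
  refine ⟨γ, hasMoments_of_tendsto (l := (hyperfilter ℕ : Filter ℕ)) (μ := μ) (M := M) hγ hμ
    fun r => (hM r).mono_left ?_⟩
  rw [← Nat.cofinite_eq_atTop]
  exact hyperfilter_le_cofinite

end MomentMethod

/-! ### The limit law and convergence for bounded noise -/

section LimitLaw

/-- The moments of the limiting spectral distribution. -/
noncomputable def limitMoments : ℕ → ℝ :=
  evenMoments fun k => ∑ w ∈ partitionWords k, toeplitzVolume w

theorem limitMoments_two_mul (k : ℕ) :
    limitMoments (2 * k) = ∑ w ∈ partitionWords k, toeplitzVolume w := by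
  rw [limitMoments, evenMoments, if_pos (even_two_mul k), Nat.mul_div_cancel_left k two_pos]

theorem limitMoments_of_odd {r : ℕ} (hr : ¬ Even r) : limitMoments r = 0 := by
  simp [limitMoments, evenMoments, hr]

/-- The moment is at most `(2 * (K + 1)) ^ K` and `(2 * K)!` is at least `K ! * (K + 1) ^ K`; what
remains is a term of an exponential series. -/
theorem tendsto_limitMoments_taylor (t : ℝ) :
    Tendsto (fun K : ℕ => t ^ (2 * K) / (2 * K)! * limitMoments (2 * K)) atTop (𝓝 0) := by
  refine squeeze_zero (fun K => ?_) (fun K => ?_)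
    (FloorSemiring.tendsto_pow_div_factorial_atTop (2 * t ^ 2))
  · rw [limitMoments_two_mul]
    have := Finset.sum_nonneg fun w (_ : w ∈ partitionWords K) => toeplitzVolume_nonneg w
    have := (even_two_mul K).pow_nonneg t
    positivity
  · rw [limitMoments_two_mul]
    have ht : 0 ≤ t ^ (2 * K) := (even_two_mul K).pow_nonneg t
    have hfac : (K ! : ℝ) * ((K : ℝ) + 1) ^ K ≤ (2 * K)! := by
      have := Nat.factorial_mul_pow_le_factorial (m := K) (n := K)
      rw [← two_mul] at this
      exact_mod_cast this
    have hK : (0 : ℝ) < K ! := Nat.cast_pos.2 (Nat.factorial_pos K)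
    have hK1 : (0 : ℝ) < ((K : ℝ) + 1) ^ K := by positivity
    calc t ^ (2 * K) / (2 * K)! * ∑ w ∈ partitionWords K, toeplitzVolume w
        ≤ t ^ (2 * K) / (K ! * ((K : ℝ) + 1) ^ K) * (2 * ((K : ℝ) + 1)) ^ K := by
          refine mul_le_mul (div_le_div_of_nonneg_left ht (by positivity) hfac)
            ((sum_toeplitzVolume_le K).trans ?_)
            (Finset.sum_nonneg fun w _ => toeplitzVolume_nonneg w) (by positivity)
          gcongr
          linarith
      _ = (2 * t ^ 2) ^ K / K ! := by
          rw [mul_pow, mul_pow, pow_mul]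
          field_simp

theorem tendsto_charFun_of_tendsto_moments {μ : ℕ → ProbabilityMeasure ℝ}
    {γ : ProbabilityMeasure ℝ} {M : ℕ → ℕ → ℝ} (hγ : HasMoments γ limitMoments)
    (hμ : ∀ n, HasMoments (μ n) (M n))
    (hM : ∀ r, Tendsto (fun n => M n r) atTop (𝓝 (limitMoments r))) (t : ℝ) :
    Tendsto (fun n => charFun (μ n : Measure ℝ) t) atTop (𝓝 (charFun (γ : Measure ℝ) t)) :=
  tendsto_charFun_of_hasMoments hγ hμ hM tendsto_limitMoments_taylor t

/-- The reflected measure has the same moments because the odd ones vanish. Moment convergence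
applied to a constant sequence shows that the moments determine the measure. -/
theorem map_neg_eq_of_hasMoments {γ : ProbabilityMeasure ℝ} (hγ : HasMoments γ limitMoments) :
    (γ : Measure ℝ).map (fun t => -t) = (γ : Measure ℝ) := by
  have hmeas : Measurable fun t : ℝ => -t := measurable_neg
  let γ' : ProbabilityMeasure ℝ :=
    ⟨(γ : Measure ℝ).map (fun t => -t), Measure.isProbabilityMeasure_map hmeas.aemeasurable⟩
  have hpow : ∀ r : ℕ, (fun x : ℝ => (-x) ^ r) = fun x => (-1) ^ r * x ^ r := fun r => by
    ext x; rw [neg_pow]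
  have hγ' : HasMoments γ' limitMoments := by
    intro r
    refine ⟨?_, ?_⟩
    · refine (integrable_map_measure (by fun_prop) hmeas.aemeasurable).2 ?_
      show Integrable (fun x : ℝ => (-x) ^ r) _
      rw [hpow]
      exact (hγ r).1.const_mul _
    · show ∫ x, x ^ r ∂((γ : Measure ℝ).map (fun t => -t)) = _
      rw [integral_map hmeas.aemeasurable (by fun_prop), hpow, integral_const_mul, (hγ r).2]
      by_cases hr : Even r
      · rw [hr.neg_one_pow, one_mul]
      · rw [limitMoments_of_odd hr, mul_zero]
  refine Measure.ext_of_charFun (funext fun t => ?_)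
  exact tendsto_nhds_unique tendsto_const_nhds
    (tendsto_charFun_of_tendsto_moments (μ := fun _ => γ') hγ (fun _ => hγ')
      (fun _ => tendsto_const_nhds) t)

/-- Support in `[-R, R]` would bound the even moments by a geometric sequence, against the lower
bound `k ! / 2 ^ k`. -/
theorem not_isBounded_support_of_hasMoments {γ : ProbabilityMeasure ℝ}
    (hγ : HasMoments γ limitMoments) : ¬ Bornology.IsBounded (γ : Measure ℝ).support := by
  intro hb
  obtain ⟨R, hR⟩ := hb.subset_closedBall 0
  have hae : ∀ᵐ x ∂(γ : Measure ℝ), |x| ≤ R := by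
    filter_upwards [Measure.support_mem_ae (μ := (γ : Measure ℝ))] with x hx
    simpa using hR hx
  have hle : ∀ k : ℕ, limitMoments (2 * k) ≤ (R ^ 2) ^ k := by
    intro k
    rw [← (hγ (2 * k)).2]
    calc ∫ x, x ^ (2 * k) ∂(γ : Measure ℝ) ≤ ∫ _, (R ^ 2) ^ k ∂(γ : Measure ℝ) := by
          refine integral_mono_ae (hγ (2 * k)).1 (integrable_const _) ?_
          filter_upwards [hae] with x hx
          rw [pow_mul]
          exact pow_le_pow_left₀ (sq_nonneg x) (sq_le_sq' (neg_le_of_abs_le hx) (le_of_abs_le hx)) k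
      _ = (R ^ 2) ^ k := by simp
  obtain ⟨k, hk⟩ := ((FloorSemiring.tendsto_pow_div_factorial_atTop (2 * R ^ 2)).eventually
    (gt_mem_nhds one_pos)).exists
  have h1 := (factorial_div_le_sum_toeplitzVolume k).trans
    ((limitMoments_two_mul k).symm.trans_le (hle k))
  rw [div_le_iff₀ (by positivity), ← mul_pow, mul_comm] at h1
  rw [div_lt_one (Nat.cast_pos.2 (Nat.factorial_pos k))] at hk
  exact absurd h1 (not_le.2 hk)

/-- There is a sequence of independent fair signs. -/
theorem exists_isBoundedNoise : ∃ (P : Measure (ℕ → Bool)) (_ : IsProbabilityMeasure P)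
    (Y : ℕ → (ℕ → Bool) → ℝ), IsBoundedNoise Y P 1 := by
  let ν : Measure Bool := (PMF.uniformOfFintype Bool).toMeasure
  let f : Bool → ℝ := fun b => if b then 1 else -1
  have hf : Measurable f := measurable_of_finite f
  have hlaw : ∀ i, Measure.map (fun ω : ℕ → Bool => ω i) (Measure.infinitePi fun _ : ℕ => ν) = ν :=
    fun i => Measure.infinitePi_map_eval (fun _ : ℕ => ν) i
  have hint : ∀ g : ℝ → ℝ, ∫ ω : ℕ → Bool, g (f (ω 1)) ∂(Measure.infinitePi fun _ : ℕ => ν) =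
      (g 1 + g (-1)) / 2 := by
    intro g
    have hmap := integral_map (μ := Measure.infinitePi fun _ : ℕ => ν)
      (measurable_pi_apply (X := fun _ => Bool) 1).aemeasurable
      (f := fun b => g (f b)) (measurable_of_finite _).aestronglyMeasurable
    rw [← hmap, hlaw 1, PMF.integral_eq_sum]
    simp [f]
    ring
  refine ⟨Measure.infinitePi fun _ => ν, inferInstance, fun i ω => f (ω i), ?_, ?_, ?_, ?_, ?_, ?_⟩
  · exact fun i => hf.comp (measurable_pi_apply i)
  · exact iIndepFun_infinitePi fun _ => hf
  · intro i
    refine IdentDistrib.comp (f := fun ω : ℕ → Bool => ω i) (g := fun ω : ℕ → Bool => ω 1)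
      ⟨(measurable_pi_apply i).aemeasurable, (measurable_pi_apply 1).aemeasurable, ?_⟩ hf
    rw [hlaw, hlaw]
  · intro i ω
    by_cases h : ω i <;> simp [f, h]
  · simpa using hint id
  · exact (hint fun x => x ^ 2).trans (by norm_num)

theorem hasMoments_toeplitzMeasure (n : ℕ) [NeZero n] (x : ℕ → ℝ) :
    HasMoments (toeplitzMeasure n x) fun r => ∫ t, t ^ r ∂(toeplitzMeasure n x : Measure ℝ) :=
  fun _ => ⟨integrable_spectralMeasure _ _, rfl⟩

/-- Existence of the limiting spectral distribution of random Toeplitz matrices. -/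
theorem exists_hasMoments_limitMoments : ∃ γ : ProbabilityMeasure ℝ, HasMoments γ limitMoments := by
  obtain ⟨P, hP, Y, hY⟩ := exists_isBoundedNoise
  -- A single good realisation suffices, as its limiting moments are deterministic.
  obtain ⟨ω, hω⟩ := (hY.ae_tendsto_moments tendsto_card_pairLoops).exists
  exact exists_hasMoments_of_tendsto
    (fun m => hasMoments_toeplitzMeasure ((m + 1) ^ 2) fun k => Y k ω) hω

theorem norm_charFun_toeplitzMeasure_sub_le_of_le {n N : ℕ} [NeZero n] [NeZero N] {x : ℕ → ℝ}
    {C : ℝ} (hx : ∀ k, |x k| ≤ C) (h : N ≤ n) (t : ℝ) :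
    ‖charFun (toeplitzMeasure n x : Measure ℝ) t - charFun (toeplitzMeasure N x : Measure ℝ) t‖ ≤
      |t| * √(3 * C ^ 2 * (((n : ℝ) - N) / n)) + 2 * (((n : ℝ) - N) / n) := by
  obtain ⟨m, rfl⟩ := Nat.exists_eq_add_of_le h
  convert norm_charFun_toeplitzMeasure_add_size_sub_le hx t using 7 <;> push_cast <;> ring

/-- If `s + 1` is the integer square root, the distance down to its square is at most `2 * (s + 1)`,
while `n + 1` is at least `(s + 1) ^ 2`. -/
theorem sub_sq_sqrt_div_le (n : ℕ) :
    (((n + 1 : ℕ) : ℝ) - (((n + 1).sqrt - 1 + 1) ^ 2 : ℕ)) / (n + 1 : ℕ) ≤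
      2 / (((n + 1).sqrt - 1 : ℕ) + 1 : ℝ) := by
  have hs : 1 ≤ (n + 1).sqrt := Nat.le_sqrt.2 (by omega)
  obtain ⟨s, hs'⟩ := Nat.exists_eq_add_of_le' hs
  have h1 := Nat.sqrt_le' (n + 1)
  have h2 := Nat.sqrt_le_add (n + 1)
  rw [hs'] at h1 h2 ⊢
  simp only [Nat.add_sub_cancel]
  have h1' : ((s : ℝ) + 1) ^ 2 ≤ (n + 1 : ℕ) := by exact_mod_cast h1
  have h2' : ((n + 1 : ℕ) : ℝ) ≤ (s + 1) * (s + 1) + (s + 1) + (s + 1) := by exact_mod_cast h2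
  rw [div_le_div_iff₀ (by positivity) (by positivity)]
  push_cast at *
  nlinarith

/-- Convergence along squares extends to all sizes by padding from the largest square below; the
relative gap tends to zero. -/
theorem IsBoundedNoise.ae_tendsto_charFun {Ω : Type*} [MeasurableSpace Ω] {P : Measure Ω}
    [IsProbabilityMeasure P] {Y : ℕ → Ω → ℝ} {C : ℝ} (h : IsBoundedNoise Y P C)
    {γ : ProbabilityMeasure ℝ} (hγ : HasMoments γ limitMoments) :
    ∀ᵐ ω ∂P, ∀ t : ℝ, Tendsto
      (fun n => charFun (toeplitzMeasure (n + 1) fun k => Y k ω : Measure ℝ) t) atTop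
      (𝓝 (charFun (γ : Measure ℝ) t)) := by
  filter_upwards [h.ae_tendsto_moments tendsto_card_pairLoops] with ω hω t
  have hsq := tendsto_charFun_of_tendsto_moments hγ
    (fun m => hasMoments_toeplitzMeasure ((m + 1) ^ 2) fun k => Y k ω) hω t
  have hinv : Tendsto (fun s : ℕ => 2 / ((s : ℝ) + 1)) atTop (𝓝 0) :=
    tendsto_const_nhds.div_atTop (tendsto_atTop_add_const_right _ _ tendsto_natCast_atTop_atTop)
  have hbound : Tendsto (fun s : ℕ => |t| * √(3 * C ^ 2 * (2 / ((s : ℝ) + 1))) +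
      2 * (2 / ((s : ℝ) + 1)) +
      ‖charFun (toeplitzMeasure ((s + 1) ^ 2) fun k => Y k ω : Measure ℝ) t -
        charFun (γ : Measure ℝ) t‖) atTop (𝓝 0) := by
    have h1 := ((hinv.const_mul (3 * C ^ 2)).sqrt.const_mul |t|).add (hinv.const_mul 2)
    have h2 := (tendsto_iff_norm_sub_tendsto_zero.1 hsq)
    simpa using h1.add h2
  have hsqrt : Tendsto (fun n : ℕ => (n + 1).sqrt - 1) atTop atTop := by
    refine tendsto_atTop_atTop.2 fun b => ⟨(b + 1) ^ 2, fun n hn => ?_⟩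
    have : b + 1 ≤ (n + 1).sqrt := Nat.le_sqrt'.2 (by omega)
    omega
  refine tendsto_iff_norm_sub_tendsto_zero.2
    (squeeze_zero (fun _ => norm_nonneg _) (fun n => ?_) (hbound.comp hsqrt))
  have hs : 1 ≤ (n + 1).sqrt := Nat.le_sqrt.2 (by omega)
  have hle : ((n + 1).sqrt - 1 + 1) ^ 2 ≤ n + 1 := by
    rw [Nat.sub_add_cancel hs]
    exact Nat.sqrt_le' (n + 1)
  have h1 := norm_charFun_toeplitzMeasure_sub_le_of_le (x := fun k => Y k ω)
    (fun k => h.bound k ω) hle t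
  have h2 := sub_sq_sqrt_div_le n
  set s := (n + 1).sqrt - 1
  refine (norm_sub_le_norm_sub_add_norm_sub _
    (charFun (toeplitzMeasure ((s + 1) ^ 2) fun k => Y k ω : Measure ℝ) t) _).trans ?_
  refine add_le_add_left (h1.trans ?_) _
  gcongr

end LimitLaw

/-! ### From bounded noise to finite variance -/

section Truncation

/-- A bounded continuous `L²` approximation is recentred and divided by its standard deviation,
which stays away from zero. -/
theorem exists_bounded_approx {ν : Measure ℝ} [IsProbabilityMeasure ν] {f : ℝ → ℝ}
    (hf : MemLp f 2 ν) (hmean : ∫ x, f x ∂ν = 0) (hvar : ∫ x, f x ^ 2 ∂ν = 1) {ε : ℝ}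
    (hε : 0 < ε) :
    ∃ g : ℝ → ℝ, Measurable g ∧ (∃ C, ∀ x, |g x| ≤ C) ∧ ∫ x, g x ∂ν = 0 ∧ ∫ x, g x ^ 2 ∂ν = 1 ∧
      Integrable (fun x => (f x - g x) ^ 2) ν ∧ ∫ x, (f x - g x) ^ 2 ∂ν ≤ ε := by
  obtain ⟨h, happrox, hmem⟩ := MemLp.exists_boundedContinuous_integral_rpow_sub_le (μ := ν)
    (p := 2) two_pos (by simpa using hf) (show 0 < min (1 / 4) (ε / 2) by positivity)
  simp only [Real.rpow_two, Real.norm_eq_abs, sq_abs] at happrox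
  replace hmem : MemLp (⇑h) 2 ν := by simpa using hmem
  have hif : Integrable f ν := hf.integrable one_le_two
  have hih : Integrable (⇑h) ν := hmem.integrable one_le_two
  set c := ∫ x, h x ∂ν
  set h₀ : ℝ → ℝ := fun x => h x - c
  have hmem₀ : MemLp h₀ 2 ν := hmem.sub (memLp_const c)
  have hih₀ : Integrable h₀ ν := hmem₀.integrable one_le_two
  have hmean₀ : ∫ x, h₀ x ∂ν = 0 := by
    rw [integral_sub hih (integrable_const c)]
    simp [c]
  have hsqf : Integrable (fun x => f x ^ 2) ν := hf.integrable_sq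
  have hsq₀ : Integrable (fun x => h₀ x ^ 2) ν := hmem₀.integrable_sq
  have hmul : Integrable (fun x => f x * h₀ x) ν := hf.integrable_mul hmem₀
  set a := ∫ x, f x * h₀ x ∂ν
  set v := ∫ x, h₀ x ^ 2 ∂ν
  have hquad : ∀ s : ℝ, Integrable (fun x => (f x - s * h₀ x) ^ 2) ν ∧
      ∫ x, (f x - s * h₀ x) ^ 2 ∂ν = 1 - 2 * s * a + s ^ 2 * v := by
    intro s
    have heq : (fun x => (f x - s * h₀ x) ^ 2) =
        fun x => (f x ^ 2 - 2 * s * (f x * h₀ x)) + s ^ 2 * h₀ x ^ 2 := by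
      ext x; ring
    rw [heq]
    have hdiff : Integrable (fun x => f x ^ 2 - 2 * s * (f x * h₀ x)) ν :=
      hsqf.sub (hmul.const_mul _)
    refine ⟨hdiff.add (hsq₀.const_mul _), ?_⟩
    rw [integral_add hdiff (hsq₀.const_mul _),
      integral_sub hsqf (hmul.const_mul _), integral_const_mul, integral_const_mul, hvar]
  have hδ : 1 - 2 * a + v ≤ min (1 / 4) (ε / 2) := by
    have h1 := (hquad 1).2
    simp only [one_mul, mul_one, one_pow] at h1
    rw [← h1]
    refine le_trans ?_ happrox
    have hsub : MemLp (fun x => f x - h x) 2 ν := hf.sub hmem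
    have heq : (fun x => (f x - h₀ x) ^ 2) =
        fun x => ((f x - h x) ^ 2 + 2 * c * (f x - h x)) + c ^ 2 := by
      ext x; simp only [h₀]; ring
    have hlin : Integrable (fun x => 2 * c * (f x - h x)) ν := (hif.sub hih).const_mul _
    have hadd : Integrable (fun x => (f x - h x) ^ 2 + 2 * c * (f x - h x)) ν :=
      hsub.integrable_sq.add hlin
    rw [heq, integral_add hadd (integrable_const _),
      integral_add hsub.integrable_sq hlin, integral_const_mul,
      integral_sub hif hih, hmean]
    simp only [integral_const, probReal_univ, smul_eq_mul, one_mul]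
    change _ + 2 * c * (0 - c) + c ^ 2 ≤ _
    -- As `f` has mean zero, recentring lowers the squared distance by exactly `c ^ 2`.
    nlinarith [sq_nonneg c]
  have hv : 1 / 4 ≤ v := by
    have h2 : 0 ≤ 1 - 2 * 2 * a + 2 ^ 2 * v := by
      rw [← (hquad 2).2]
      exact integral_nonneg fun x => sq_nonneg _
    have := hδ.trans (min_le_left _ _)
    linarith
  set σ := √v
  have hσ2 : σ ^ 2 = v := Real.sq_sqrt (by linarith)
  have hσ : 1 / 2 ≤ σ := Real.le_sqrt_of_sq_le (by linarith)
  have hσ0 : σ ≠ 0 := by linarith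
  obtain ⟨hint, hval⟩ := hquad σ⁻¹
  refine ⟨fun x => σ⁻¹ * h₀ x, ?_, ⟨σ⁻¹ * (‖h‖ + |c|), fun x => ?_⟩, ?_, ?_, hint, ?_⟩
  · exact (h.continuous.measurable.sub_const c).const_mul _
  · rw [abs_mul, abs_of_nonneg (by positivity)]
    gcongr
    exact (abs_sub _ _).trans (by gcongr; exact h.norm_coe_le_norm x)
  · rw [integral_const_mul, hmean₀, mul_zero]
  · simp only [mul_pow]
    rw [integral_const_mul]
    change σ⁻¹ ^ 2 * v = 1
    rw [← hσ2]
    field_simp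
  · rw [hval, ← hσ2]
    have hδ' : 1 - 2 * a + σ ^ 2 ≤ ε / 2 := hσ2 ▸ hδ.trans (min_le_right _ _)
    -- The numerator is at most `ε / 2 - (1 - σ) ^ 2`, and `σ ≥ 1 / 2` absorbs the denominator.
    have heq : 1 - 2 * σ⁻¹ * a + σ⁻¹ ^ 2 * σ ^ 2 = (2 * σ - 2 * a) / σ := by
      field_simp
      ring
    rw [heq, div_le_iff₀ (by linarith)]
    nlinarith [sq_nonneg (1 - σ)]

variable {Ω : Type*} [MeasurableSpace Ω] {P : Measure Ω} [IsProbabilityMeasure P]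
  {X : ℕ → Ω → ℝ}

/-- Three errors: removing the mean and the bounded-noise comparison tend to zero; replacing `X - c`
by `g(X)` costs at most `|t| * √(2 * ε)` in the limit, by the strong law. -/
theorem ae_eventually_norm_charFun_sub_lt (hX : ∀ i, Measurable (X i)) (hind : iIndepFun X P)
    (hid : ∀ i, IdentDistrib (X i) (X 1) P P) (hvar : variance (X 1) P = 1)
    {γ : ProbabilityMeasure ℝ} (hγ : HasMoments γ limitMoments) {ε : ℝ} (hε : 0 < ε) :
    ∀ᵐ ω ∂P, ∀ t : ℝ, ∀ η > |t| * √(2 * ε), ∀ᶠ n : ℕ in atTop,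
      ‖charFun (toeplitzMeasure (n + 1) fun k => X k ω : Measure ℝ) t -
        charFun (γ : Measure ℝ) t‖ < η := by
  -- Without square integrability the extended variance is infinite and `variance` takes its default
  -- value zero, not one.
  have hL2 : MemLp (X 1) 2 P := by
    by_contra hcon
    have := evariance_eq_top (hX 1).aestronglyMeasurable hcon
    rw [variance, this] at hvar
    simp at hvar
  set c := ∫ ω, X 1 ω ∂P
  set ν := P.map (X 1)
  have : IsProbabilityMeasure ν := Measure.isProbabilityMeasure_map (hX 1).aemeasurable
  have hintν : ∀ f : ℝ → ℝ, Measurable f → ∫ x, f x ∂ν = ∫ ω, f (X 1 ω) ∂P := fun f hf =>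
    integral_map (hX 1).aemeasurable hf.aestronglyMeasurable
  have hfm : Measurable fun x : ℝ => x - c := measurable_id.sub_const c
  obtain ⟨g, hg, ⟨C, hC⟩, hg0, hg1, hgi, hgε⟩ := exists_bounded_approx (ν := ν)
    (f := fun x => x - c)
    ((memLp_map_measure_iff hfm.aestronglyMeasurable (hX 1).aemeasurable).2
      (hL2.sub (memLp_const c)))
    (by
      rw [hintν _ hfm, integral_sub (hL2.integrable one_le_two) (integrable_const c)]
      simp [c])
    (by
      rw [hintν _ (hfm.pow_const 2), ← hvar, variance_eq_integral (hX 1).aemeasurable])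
    hε
  have hY : IsBoundedNoise (fun k ω => g (X k ω)) P C :=
    ⟨fun i => hg.comp (hX i), hind.comp (fun _ => g) fun _ => hg, fun i => (hid i).comp hg,
      fun i ω => hC _, by rw [← hintν _ hg, hg0], by rw [← hintν _ (hg.pow_const 2), hg1]⟩
  have hdm : Measurable fun x : ℝ => (x - c - g x) ^ 2 := (hfm.sub hg).pow_const 2
  have hint1 : Integrable (fun ω => (X 1 ω - c - g (X 1 ω)) ^ 2) P :=
    (integrable_map_measure hdm.aestronglyMeasurable (hX 1).aemeasurable).1 hgi
  have hid' : ∀ i j, IdentDistrib (fun ω => (X i ω - c - g (X i ω)) ^ 2)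
      (fun ω => (X j ω - c - g (X j ω)) ^ 2) P P := fun i j =>
    ((hid i).trans (hid j).symm).comp hdm
  have hslln := strong_law_ae_real (fun k ω => (X k ω - c - g (X k ω)) ^ 2)
    ((hid' 0 1).integrable_iff.2 hint1)
    (fun i j hij => (hind.comp (fun _ => fun x => (x - c - g x) ^ 2) fun _ => hdm).indepFun hij)
    (fun i => hid' i 0)
  rw [(hid' 0 1).integral_eq, ← hintν _ hdm] at hslln
  filter_upwards [hslln, hY.ae_tendsto_charFun hγ] with ω h1 h2 t η hη
  set δ := ∫ x, (x - c - g x) ^ 2 ∂ν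
  have hb1 : Tendsto (fun n : ℕ => |t| * |c| / √((n + 1 : ℕ) : ℝ)) atTop (𝓝 0) :=
    tendsto_const_nhds.div_atTop (Real.tendsto_sqrt_atTop.comp
      (tendsto_natCast_atTop_atTop.comp (tendsto_add_atTop_nat 1)))
  have hb2 : Tendsto (fun n : ℕ => |t| * √(2 * ((∑ k ∈ Finset.range (n + 1),
      (X k ω - c - g (X k ω)) ^ 2) / (n + 1 : ℕ)))) atTop (𝓝 (|t| * √(2 * δ))) :=
    ((h1.comp (tendsto_add_atTop_nat 1)).const_mul 2).sqrt.const_mul |t|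
  have hb3 := tendsto_iff_norm_sub_tendsto_zero.1 (h2 t)
  have hsum := (hb1.add hb2).add hb3
  have hlt : 0 + |t| * √(2 * δ) + 0 < η := by
    rw [zero_add, add_zero]
    refine lt_of_le_of_lt ?_ hη
    gcongr
  filter_upwards [hsum.eventually (gt_mem_nhds hlt)] with n hn
  refine lt_of_le_of_lt ?_ hn
  have e1 := norm_charFun_toeplitzMeasure_add_const_sub_le (n := n + 1)
    (fun k => X k ω - c) c t
  simp only [sub_add_cancel] at e1
  have e2 := norm_charFun_toeplitzMeasure_sub_le (n := n + 1) (fun k => X k ω - c)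
    (fun k => g (X k ω)) t
  exact (norm_sub_le_norm_sub_add_norm_sub _
    (charFun (toeplitzMeasure (n + 1) fun k => g (X k ω) : Measure ℝ) t) _).trans
    (add_le_add_left ((norm_sub_le_norm_sub_add_norm_sub _
      (charFun (toeplitzMeasure (n + 1) fun k => X k ω - c : Measure ℝ) t) _).trans
      (add_le_add e1 e2)) _)

/-- Almost sure weak convergence of the spectral measures of random Toeplitz matrices. -/
theorem ae_tendsto_toeplitzMeasure (hX : ∀ i, Measurable (X i)) (hind : iIndepFun X P)
    (hid : ∀ i, IdentDistrib (X i) (X 1) P P) (hvar : variance (X 1) P = 1)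
    {γ : ProbabilityMeasure ℝ} (hγ : HasMoments γ limitMoments) :
    ∀ᵐ ω ∂P, Tendsto (fun n : ℕ => toeplitzMeasure (n + 1) fun k => X k ω) atTop (𝓝 γ) := by
  have hall : ∀ᵐ ω ∂P, ∀ j : ℕ, ∀ t : ℝ, ∀ η > |t| * √(2 * (1 / ((j : ℝ) + 1))),
      ∀ᶠ n : ℕ in atTop,
      ‖charFun (toeplitzMeasure (n + 1) fun k => X k ω : Measure ℝ) t -
        charFun (γ : Measure ℝ) t‖ < η :=
    ae_all_iff.2 fun j => ae_eventually_norm_charFun_sub_lt hX hind hid hvar hγ (by positivity)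
  filter_upwards [hall] with ω hω
  refine ProbabilityMeasure.tendsto_iff_tendsto_charFun.2 fun t => ?_
  refine Metric.tendsto_nhds.2 fun η hη => ?_
  have hlim : Tendsto (fun j : ℕ => |t| * √(2 * (1 / ((j : ℝ) + 1)))) atTop (𝓝 0) := by
    simpa using
      ((tendsto_one_div_add_atTop_nhds_zero_nat (𝕜 := ℝ)).const_mul 2).sqrt.const_mul |t|
  obtain ⟨j, hj⟩ := (hlim.eventually (gt_mem_nhds hη)).exists
  simpa only [dist_eq_norm] using hω j t η hj

end Truncation

/-! ### The unit circle, the torus and the cube -/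

section Circle

/-- The representative in `[0, 1)` of a point of the circle. -/
noncomputable def circleRep (y : UnitAddCircle) : ℝ := (AddCircle.equivIco 1 0 y : ℝ)

theorem circleRep_mem (y : UnitAddCircle) : circleRep y ∈ Set.Ico (0 : ℝ) 1 := by
  obtain ⟨h0, h1⟩ := (AddCircle.equivIco (1 : ℝ) 0 y).2
  exact ⟨h0, h1.trans_eq (zero_add 1)⟩

theorem coe_circleRep (y : UnitAddCircle) : ((circleRep y : ℝ) : UnitAddCircle) = y :=
  AddCircle.coe_equivIco

theorem circleRep_eq {v : ℝ} (hv : v ∈ Set.Ico (0 : ℝ) 1) {y : UnitAddCircle}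
    (h : (v : UnitAddCircle) = y) : circleRep y = v := by
  rw [← h]
  exact AddCircle.equivIco_coe_of_mem (by rwa [zero_add])

theorem circleRep_injective : Function.Injective circleRep := fun x y h => by
  rw [← coe_circleRep x, h, coe_circleRep]

theorem measurable_circleRep : Measurable circleRep :=
  measurable_subtype_coe.comp (AddCircle.measurableEquivIco 1 0).measurable

theorem circleRep_sub_of_le {x y : UnitAddCircle} (h : circleRep y ≤ circleRep x) :
    circleRep (x - y) = circleRep x - circleRep y := by
  have hx := circleRep_mem x
  have hy := circleRep_mem y
  refine circleRep_eq ⟨by linarith, by linarith [hx.2, hy.1]⟩ ?_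
  rw [AddCircle.coe_sub, coe_circleRep, coe_circleRep]

theorem circleRep_sub_of_lt {x y : UnitAddCircle} (h : circleRep x < circleRep y) :
    circleRep (x - y) = circleRep x - circleRep y + 1 := by
  have hx := circleRep_mem x
  have hy := circleRep_mem y
  refine circleRep_eq ⟨by linarith [hx.1, hy.2], by linarith⟩ ?_
  rw [AddCircle.coe_add, AddCircle.coe_sub, coe_circleRep, coe_circleRep, AddCircle.coe_period,
    add_zero]

theorem circleRep_zero : circleRep 0 = 0 := circleRep_eq ⟨le_rfl, one_pos⟩ (AddCircle.coe_zero 1)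

theorem circleRep_pos {y : UnitAddCircle} (h : y ≠ 0) : 0 < circleRep y :=
  (circleRep_mem y).1.lt_of_ne fun h0 => h (circleRep_injective (h0.symm.trans circleRep_zero.symm))

theorem circleRep_neg {y : UnitAddCircle} (h : y ≠ 0) : circleRep (-y) = 1 - circleRep y := by
  have := circleRep_sub_of_lt (x := 0) (y := y) (by rw [circleRep_zero]; exact circleRep_pos h)
  rw [zero_sub, circleRep_zero] at this
  linarith

theorem volume_circle_singleton_zero : volume ({0} : Set UnitAddCircle) = 0 := by
  rw [← Metric.closedBall_zero, AddCircle.volume_closedBall]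
  simp

variable {ι κ : Type*} [Fintype ι] [Fintype κ]

theorem volume_torus_univ : volume (Set.univ : Set (ι → UnitAddCircle)) = 1 := by
  rw [volume_pi, Measure.pi_univ]
  simp

/-- A continuous surjective homomorphism carries Haar measure to Haar measure, and the total masses
agree. Permutations, increments and sign changes below are of this kind. -/
theorem measurePreserving_torus_hom {f : (ι → UnitAddCircle) →+ (κ → UnitAddCircle)}
    (hf : Continuous f) (hsurj : Function.Surjective f) : MeasurePreserving f volume volume :=
  f.measurePreserving hf hsurj (by rw [volume_torus_univ, volume_torus_univ])

theorem ae_torus_ne_zero (f : (ι → UnitAddCircle) →+ UnitAddCircle) (hf : Continuous f)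
    (hsurj : Function.Surjective f) : ∀ᵐ u : ι → UnitAddCircle, f u ≠ 0 := by
  have hmp : MeasurePreserving f volume volume :=
    f.measurePreserving hf hsurj (by rw [volume_torus_univ, UnitAddCircle.measure_univ])
  have := hmp.measure_preimage (measurableSet_singleton (0 : UnitAddCircle)).nullMeasurableSet
  rw [volume_circle_singleton_zero] at this
  rw [ae_iff]
  simpa [Set.preimage] using this

theorem ae_torus_apply_ne_zero (i : ι) : ∀ᵐ u : ι → UnitAddCircle, u i ≠ 0 :=
  ae_torus_ne_zero (Pi.evalAddMonoidHom (fun _ : ι => UnitAddCircle) i) (continuous_apply i)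
    (Function.surjective_eval i)

theorem ae_torus_injective : ∀ᵐ u : ι → UnitAddCircle, Function.Injective u := by
  classical
  have h : ∀ i j : ι, i ≠ j → ∀ᵐ u : ι → UnitAddCircle, u i ≠ u j := by
    intro i j hij
    have := ae_torus_ne_zero (Pi.evalAddMonoidHom (fun _ : ι => UnitAddCircle) i -
      Pi.evalAddMonoidHom (fun _ : ι => UnitAddCircle) j)
      ((continuous_apply i).sub (continuous_apply j))
      (fun y => ⟨Pi.single i y, by simp [hij.symm]⟩)
    filter_upwards [this] with u hu heq
    exact hu (by simp [heq])
  have h' : ∀ᵐ u : ι → UnitAddCircle, ∀ i j : ι, i ≠ j → u i ≠ u j := by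
    refine ae_all_iff.2 fun i => ae_all_iff.2 fun j => ?_
    by_cases hij : i = j
    · simp [hij]
    · filter_upwards [h i j hij] with u hu _ using hu
  filter_upwards [h'] with u hu i j hij
  by_contra hne
  exact hu i j hne hij

theorem volume_real_torus_univ : volume.real (Set.univ : Set (ι → UnitAddCircle)) = 1 := by
  rw [Measure.real, volume_torus_univ, ENNReal.toReal_one]

/-- The unit cube and the torus have the same volumes. -/
theorem volume_real_torus_preimage {s : Set (ι → ℝ)} (hs : MeasurableSet s)
    (hsub : s ⊆ {u | ∀ i, u i ∈ Set.Icc (0 : ℝ) 1}) :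
    volume.real {y : ι → UnitAddCircle | (fun i => circleRep (y i)) ∈ s} = volume.real s := by
  have hmp : MeasurePreserving (fun (u : ι → ℝ) i => ((u i : ℝ) : UnitAddCircle))
      (volume.restrict (Set.univ.pi fun _ => Set.Ico (0 : ℝ) 1)) volume := by
    rw [volume_pi, Measure.restrict_pi_pi]
    refine measurePreserving_pi _ _ fun _ => ?_
    have := AddCircle.measurePreserving_mk 1 0
    rwa [zero_add, Measure.restrict_congr_set Ioc_ae_eq_Icc,
      ← Measure.restrict_congr_set Ico_ae_eq_Icc] at this
  have hmeas : MeasurableSet {y : ι → UnitAddCircle | (fun i => circleRep (y i)) ∈ s} :=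
    (measurable_pi_iff.2 fun i => measurable_circleRep.comp (measurable_pi_apply i)) hs
  rw [Measure.real, ← hmp.measure_preimage hmeas.nullMeasurableSet,
    Measure.restrict_apply (hmp.measurable hmeas), Measure.real]
  congr 1
  have heq : ((fun (u : ι → ℝ) i => ((u i : ℝ) : UnitAddCircle)) ⁻¹'
      {y : ι → UnitAddCircle | (fun i => circleRep (y i)) ∈ s}) ∩
      (Set.univ.pi fun _ => Set.Ico (0 : ℝ) 1) = s ∩ Set.univ.pi fun _ => Set.Ico (0 : ℝ) 1 := by
    ext u
    refine and_congr_left fun hu => ?_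
    have : (fun i => circleRep ((u i : ℝ) : UnitAddCircle)) = u :=
      funext fun i => circleRep_eq (hu i trivial) rfl
    simp [this]
  have hae : (Set.univ.pi fun _ : ι => Set.Ico (0 : ℝ) 1) =ᵐ[volume]
      Set.univ.pi fun _ : ι => Set.Icc (0 : ℝ) 1 := Measure.pi_Ico_ae_eq_pi_Icc
  rw [heq, measure_congr ((ae_eq_refl s).inter hae), Set.inter_eq_left.2]
  intro u hu i _
  exact hsub hu i

end Circle

/-! ### Rises and relative order -/

section Rises

/-- The number of rises of a finite sequence, the first position always counting as a rise. -/
def riseCount {α : Type*} [LinearOrder α] {n : ℕ} (f : Fin n → α) : ℕ :=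
  (Finset.univ.filter fun i : Fin n => ∀ j : Fin n, (j : ℕ) + 1 = (i : ℕ) → f j < f i).card

theorem riseCount_congr {α β : Type*} [LinearOrder α] [LinearOrder β] {n : ℕ} {f : Fin n → α}
    {g : Fin n → β} (h : ∀ i j, f i < f j ↔ g i < g j) : riseCount f = riseCount g := by
  simp only [riseCount, h]

theorem riseCount_succ {p : ℕ} (f : Fin (p + 1) → ℝ) :
    (riseCount f : ℝ) = 1 + ∑ i : Fin p, if f i.castSucc < f i.succ then 1 else 0 := by
  rw [riseCount, Finset.card_filter, Fin.sum_univ_succ]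
  push_cast
  congr 1
  · simp
  · refine Finset.sum_congr rfl fun i _ => ?_
    congr 1
    refine propext ⟨fun h => h i.castSucc (by simp), fun h j hj => ?_⟩
    have : j = i.castSucc := Fin.ext (by simpa using hj)
    rwa [this]

theorem exists_perm_lt_iff {α : Type*} [LinearOrder α] {n : ℕ} {f : Fin n → α}
    (hf : Function.Injective f) : ∃ σ : Equiv.Perm (Fin n), ∀ i j, f i < f j ↔ σ i < σ j := by
  have hmono : StrictMono (f ∘ Tuple.sort f) :=
    (Tuple.monotone_sort f).strictMono_of_injective (hf.comp (Tuple.sort f).injective)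
  refine ⟨(Tuple.sort f)⁻¹, fun i j => ?_⟩
  rw [← hmono.lt_iff_lt]
  simp

theorem perm_eq_of_lt_iff {n : ℕ} {σ τ : Equiv.Perm (Fin n)} (h : ∀ i j, σ i < σ j ↔ τ i < τ j) :
    σ = τ := by
  let e : Fin n ≃o Fin n :=
    { toEquiv := σ⁻¹.trans τ
      map_rel_iff' := fun {a b} => by
        have := not_congr (h (σ⁻¹ b) (σ⁻¹ a))
        simpa using this.symm }
  have he : e = OrderIso.refl _ := Subsingleton.elim _ _
  ext i
  have : e (σ i) = σ i := by rw [he]; rfl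
  have h2 : e (σ i) = τ i := by simp [e]
  rw [← this, h2]

end Rises

/-! ### Eulerian numbers as volumes of solids -/

section EulerianVolume

variable {n : ℕ}

/-- The part of the torus on which the coordinates are ordered as the values of `σ`. -/
def orderCell (σ : Equiv.Perm (Fin n)) : Set (Fin n → UnitAddCircle) :=
  {x | ∀ i j, circleRep (x i) < circleRep (x j) ↔ σ i < σ j}

theorem measurableSet_orderCell (σ : Equiv.Perm (Fin n)) : MeasurableSet (orderCell σ) := by
  have : orderCell σ = ⋂ i, ⋂ j, {x | circleRep (x i) < circleRep (x j) ↔ σ i < σ j} := by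
    ext x; simp [orderCell]
  rw [this]
  refine MeasurableSet.iInter fun i => MeasurableSet.iInter fun j => ?_
  have hlt : MeasurableSet {x : Fin n → UnitAddCircle | circleRep (x i) < circleRep (x j)} :=
    measurableSet_lt (measurable_circleRep.comp (measurable_pi_apply i))
      (measurable_circleRep.comp (measurable_pi_apply j))
  exact hlt.iff (MeasurableSet.const _)

theorem disjoint_orderCell {σ τ : Equiv.Perm (Fin n)} (h : σ ≠ τ) :
    Disjoint (orderCell σ) (orderCell τ) :=
  Set.disjoint_left.2 fun _ hσ hτ => h (perm_eq_of_lt_iff fun i j => (hσ i j).symm.trans (hτ i j))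

theorem volume_real_orderCell_eq (σ : Equiv.Perm (Fin n)) :
    volume.real (orderCell σ) = volume.real (orderCell (1 : Equiv.Perm (Fin n))) := by
  let f : (Fin n → UnitAddCircle) →+ (Fin n → UnitAddCircle) :=
    { toFun := fun x i => x (σ⁻¹ i)
      map_zero' := rfl
      map_add' := fun _ _ => rfl }
  have hf : Continuous f := continuous_pi fun i => continuous_apply _
  have hmp := measurePreserving_torus_hom hf fun y => ⟨fun i => y (σ i), by ext i; simp [f]⟩
  rw [← hmp.measureReal_preimage (measurableSet_orderCell 1).nullMeasurableSet]
  congr 1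
  ext x
  constructor
  · intro hx i j
    simpa [f] using hx (σ⁻¹ i) (σ⁻¹ j)
  · intro hx i j
    simpa [f] using hx (σ i) (σ j)

theorem ae_exists_mem_orderCell :
    ∀ᵐ x : Fin n → UnitAddCircle, ∃ σ : Equiv.Perm (Fin n), x ∈ orderCell σ := by
  filter_upwards [ae_torus_injective] with x hx
  exact exists_perm_lt_iff (circleRep_injective.comp hx)

theorem volume_real_biUnion_orderCell (S : Finset (Equiv.Perm (Fin n))) :
    volume.real (⋃ σ ∈ S, orderCell σ) =
      S.card * volume.real (orderCell (1 : Equiv.Perm (Fin n))) := by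
  rw [measureReal_biUnion_finset (fun σ _ τ _ h => disjoint_orderCell h)
    (fun σ _ => measurableSet_orderCell σ), Finset.sum_congr rfl fun σ _ =>
    volume_real_orderCell_eq σ]
  simp

/-- The `n !` order cells are disjoint, have equal volume by permuting coordinates, and fill the
torus up to a null set. -/
theorem volume_real_orderCell_one :
    volume.real (orderCell (1 : Equiv.Perm (Fin n))) = 1 / (n ! : ℝ) := by
  have h := volume_real_biUnion_orderCell (n := n) Finset.univ
  have huniv : volume.real (⋃ σ ∈ (Finset.univ : Finset (Equiv.Perm (Fin n))), orderCell σ) = 1 := by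
    refine Eq.trans ?_ (volume_real_torus_univ (ι := Fin n))
    refine measureReal_congr (eventuallyEq_univ.2 ?_)
    filter_upwards [ae_exists_mem_orderCell (n := n)] with x hx
    simpa using hx
  rw [huniv, Finset.card_univ, Fintype.card_perm, Fintype.card_fin] at h
  rw [eq_div_iff (Nat.cast_ne_zero.2 (Nat.factorial_ne_zero n)), mul_comm, ← h]

theorem volume_real_riseCount_eq (m : ℕ) :
    volume.real {x : Fin n → UnitAddCircle | riseCount (fun i => circleRep (x i)) = m} =
      (eulerianNumber n m : ℝ) / n ! := by
  have hnum : eulerianNumber n m =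
      (Finset.univ.filter fun σ : Equiv.Perm (Fin n) => riseCount σ = m).card := rfl
  rw [hnum, div_eq_mul_one_div, ← volume_real_orderCell_one, ← volume_real_biUnion_orderCell]
  refine measureReal_congr ?_
  filter_upwards [ae_exists_mem_orderCell (n := n)] with x ⟨σ, hσ⟩
  refine propext ?_
  have hrise : riseCount (fun i => circleRep (x i)) = riseCount σ := riseCount_congr hσ
  change riseCount (fun i => circleRep (x i)) = m ↔ x ∈ ⋃ τ ∈ _, orderCell τ
  rw [Set.mem_iUnion₂, hrise]
  refine ⟨fun h => ⟨σ, by simpa using h, hσ⟩, ?_⟩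
  rintro ⟨τ, hτ, hx⟩
  have : σ = τ := perm_eq_of_lt_iff fun i j => (hσ i j).symm.trans (hx i j)
  simpa [this] using hτ

/-- The increments of a sequence of points of the circle that starts from the origin. -/
def circleIncrements (p : ℕ) :
    (Fin (p + 1) → UnitAddCircle) →+ (Fin (p + 1) → UnitAddCircle) where
  toFun x := Fin.cons (x 0) fun i : Fin p => x i.succ - x i.castSucc
  map_zero' := by
    ext i
    refine Fin.cases ?_ (fun j => ?_) i <;> simp
  map_add' x y := by
    ext i
    refine Fin.cases ?_ (fun j => ?_) i
    · simp
    · simp only [Fin.cons_succ, Pi.add_apply]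
      abel

theorem circleIncrements_zero {p : ℕ} (x : Fin (p + 1) → UnitAddCircle) :
    circleIncrements p x 0 = x 0 := rfl

theorem circleIncrements_succ {p : ℕ} (x : Fin (p + 1) → UnitAddCircle) (i : Fin p) :
    circleIncrements p x i.succ = x i.succ - x i.castSucc := rfl

theorem measurePreserving_circleIncrements (p : ℕ) :
    MeasurePreserving (circleIncrements p) volume volume := by
  refine measurePreserving_torus_hom (continuous_pi fun i => ?_) fun y => ?_
  · refine Fin.cases (continuous_apply 0) (fun j => ?_) i
    exact (continuous_apply j.succ).sub (continuous_apply j.castSucc)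
  · refine ⟨fun i => Fin.partialSum y i.succ, ?_⟩
    ext i
    refine Fin.cases ?_ (fun j => ?_) i
    · rw [circleIncrements_zero, Fin.partialSum_succ]
      simp
    · rw [circleIncrements_succ, Fin.partialSum_succ, Fin.succ_castSucc, add_sub_cancel_left]

/-- The differences telescope, except that each descent wraps once around the circle and adds one.
-/
theorem sum_circleRep_circleIncrements {p : ℕ} {x : Fin (p + 1) → UnitAddCircle}
    (hx : Function.Injective x) :
    ∑ i, circleRep (circleIncrements p x i) =
      circleRep (x (Fin.last p)) + ((p : ℝ) + 1 - riseCount fun i => circleRep (x i)) := by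
  have hstep : ∀ i : Fin p, circleRep (circleIncrements p x i.succ) =
      circleRep (x i.succ) - circleRep (x i.castSucc) +
        (1 - if circleRep (x i.castSucc) < circleRep (x i.succ) then 1 else 0) := by
    intro i
    rw [circleIncrements_succ]
    split_ifs with h
    · rw [circleRep_sub_of_le h.le]; ring
    · have hne : circleRep (x i.succ) ≠ circleRep (x i.castSucc) := fun he =>
        (Fin.castSucc_lt_succ (i := i)).ne' (hx (circleRep_injective he))
      rw [circleRep_sub_of_lt (lt_of_le_of_ne (not_lt.1 h) hne)]; ring
  rw [Fin.sum_univ_succ, circleIncrements_zero, Finset.sum_congr rfl fun i _ => hstep i,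
    riseCount_succ, Finset.sum_add_distrib, Finset.sum_sub_distrib, Finset.sum_sub_distrib]
  have h1 := Fin.sum_univ_succ fun i => circleRep (x i)
  have h2 := Fin.sum_univ_castSucc fun i => circleRep (x i)
  simp only [Finset.sum_const, Finset.card_univ, Fintype.card_fin, nsmul_eq_mul, mul_one]
  linarith

/-- Almost surely the last point lies strictly between 0 and 1, so the condition says that there are
exactly `b` descents, that is, `a` rises. -/
theorem volume_real_sum_circleRep_mem {p : ℕ} (a b : ℕ) (hab : a + b = p + 1) :
    volume.real {y : Fin (p + 1) → UnitAddCircle |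
      ∑ i, circleRep (y i) - b ∈ Set.Icc (0 : ℝ) 1} = (eulerianNumber (p + 1) a : ℝ) / (p + 1)! := by
  have hmeas : MeasurableSet {y : Fin (p + 1) → UnitAddCircle |
      ∑ i, circleRep (y i) - b ∈ Set.Icc (0 : ℝ) 1} :=
    ((Finset.measurable_fun_sum _ fun i _ =>
      measurable_circleRep.comp (measurable_pi_apply i)).sub_const (b : ℝ)) measurableSet_Icc
  rw [← volume_real_riseCount_eq,
    ← (measurePreserving_circleIncrements p).measureReal_preimage hmeas.nullMeasurableSet]
  refine measureReal_congr ?_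
  filter_upwards [ae_torus_injective, ae_torus_apply_ne_zero (Fin.last p)] with x hinj hlast
  refine propext ?_
  change ∑ i, circleRep (circleIncrements p x i) - b ∈ Set.Icc (0 : ℝ) 1 ↔
    riseCount (fun i => circleRep (x i)) = a
  rw [sum_circleRep_circleIncrements hinj]
  have hpos := circleRep_pos hlast
  have hlt := (circleRep_mem (x (Fin.last p))).2
  have hab' : (a : ℝ) + b = p + 1 := by exact_mod_cast hab
  set r := riseCount fun i => circleRep (x i)
  constructor
  · rintro ⟨h0, h1⟩
    have e1 : (r : ℝ) < (a + 1 : ℕ) := by push_cast; linarith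
    have e2 : (a : ℝ) < (r + 1 : ℕ) := by push_cast; linarith
    have e1' := Nat.cast_lt.1 e1
    have e2' := Nat.cast_lt.1 e2
    omega
  · intro h
    rw [h]
    constructor <;> linarith

/-- Reflecting the coordinates in `B` replaces `u` by `1 - u`, which turns the signed sum into a
plain sum shifted by `B.card`. Coordinates outside `A ∪ B` are forgotten by the same surjective
homomorphism. -/
theorem volume_real_eulerianSolid {d : ℕ} {A B : Finset (Fin d)} (hdisj : Disjoint A B)
    (hcard : A.card = B.card + 1) :
    volume.real (eulerianSolid A B) =
      (eulerianNumber (A.card + B.card) A.card : ℝ) / (A.card + B.card)! := by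
  obtain ⟨p, hp⟩ : ∃ p, A.card + B.card = p + 1 := ⟨B.card + B.card, by omega⟩
  have hU : (A ∪ B).card = p + 1 := by rw [Finset.card_union_of_disjoint hdisj, hp]
  let e : {i // i ∈ A ∪ B} ≃ Fin (p + 1) := (A ∪ B).equivFinOfCardEq hU
  have hsolid : MeasurableSet (eulerianSolid A B) := by
    refine MeasurableSet.inter ?_ ?_
    · change MeasurableSet {u : Fin d → ℝ | ∀ i, u i ∈ Set.Icc (0 : ℝ) 1}
      rw [Set.ofPred_forall]
      exact MeasurableSet.iInter fun i => measurable_pi_apply i measurableSet_Icc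
    · exact ((Finset.measurable_fun_sum _ fun i _ => measurable_pi_apply i).sub
        (Finset.measurable_fun_sum _ fun i _ => measurable_pi_apply i)) measurableSet_Icc
  rw [← volume_real_torus_preimage hsolid fun u hu => hu.1, hp,
    ← volume_real_sum_circleRep_mem A.card B.card hp]
  let f : (Fin d → UnitAddCircle) →+ (Fin (p + 1) → UnitAddCircle) :=
    { toFun := fun u j => if ((e.symm j : Fin d)) ∈ A then u (e.symm j) else - u (e.symm j)
      map_zero' := by ext j; simp
      map_add' := fun u v => by
        ext j
        simp only [Pi.add_apply]
        split_ifs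
        · rfl
        · rw [neg_add] }
  have hfapply : ∀ u j, f u j =
      if ((e.symm j : Fin d)) ∈ A then u (e.symm j) else - u (e.symm j) := fun _ _ => rfl
  have hf : Continuous f := by
    refine continuous_pi fun j => ?_
    simp only [hfapply]
    split_ifs
    · exact continuous_apply _
    · exact (continuous_apply _).neg
  have hsurj : Function.Surjective f := by
    intro y
    refine ⟨fun i => if h : i ∈ A ∪ B then (if i ∈ A then y (e ⟨i, h⟩) else - y (e ⟨i, h⟩)) else 0,
      ?_⟩
    ext j
    rw [hfapply]
    have hj : (e.symm j : Fin d) ∈ A ∪ B := (e.symm j).2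
    by_cases hA : (e.symm j : Fin d) ∈ A <;> simp only [hA, hj, dif_pos, if_true, if_false,
      Subtype.coe_eta, Equiv.apply_symm_apply, neg_neg]
  have hmeas : MeasurableSet {y : Fin (p + 1) → UnitAddCircle |
      ∑ i, circleRep (y i) - B.card ∈ Set.Icc (0 : ℝ) 1} :=
    ((Finset.measurable_fun_sum _ fun i _ =>
      measurable_circleRep.comp (measurable_pi_apply i)).sub_const (B.card : ℝ)) measurableSet_Icc
  rw [← (measurePreserving_torus_hom hf hsurj).measureReal_preimage hmeas.nullMeasurableSet]
  refine measureReal_congr ?_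
  filter_upwards [ae_all_iff.2 fun i => ae_torus_apply_ne_zero (ι := Fin d) i] with u hu
  refine propext ?_
  have hsum : ∑ j, circleRep (f u j) - B.card =
      ∑ i ∈ A, circleRep (u i) - ∑ i ∈ B, circleRep (u i) := by
    have h1 : ∑ j, circleRep (f u j) =
        ∑ i ∈ A ∪ B, if i ∈ A then circleRep (u i) else 1 - circleRep (u i) := by
      rw [← Finset.sum_coe_sort (A ∪ B), ← Equiv.sum_comp e.symm]
      refine Finset.sum_congr rfl fun j _ => ?_
      rw [hfapply]
      split_ifs
      · rfl
      · exact circleRep_neg (hu _)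
    rw [h1, Finset.sum_union hdisj, Finset.sum_congr rfl fun i (hi : i ∈ A) => if_pos hi,
      Finset.sum_congr rfl fun i (hi : i ∈ B) => if_neg (Finset.disjoint_right.1 hdisj hi),
      Finset.sum_sub_distrib]
    simp only [Finset.sum_const, nsmul_eq_mul, mul_one]
    ring
  change ((fun i => circleRep (u i)) ∈ eulerianSolid A B) ↔
    ∑ j, circleRep (f u j) - B.card ∈ Set.Icc (0 : ℝ) 1
  rw [hsum]
  exact ⟨fun h => h.2, fun h => ⟨fun i => Set.Ico_subset_Icc_self (circleRep_mem _), h⟩⟩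

end EulerianVolume

end ToeplitzSpectrum

open ToeplitzSpectrum in
theorem theorem1p1 :
    (∃ γ : ProbabilityMeasure ℝ,
      -- almost sure weak convergence, with a limit that does not depend on the i.i.d. sequence
      (∀ (Ω : Type*) [MeasurableSpace Ω] (P : Measure Ω) [IsProbabilityMeasure P]
        (X : ℕ → Ω → ℝ), (∀ i, Measurable (X i)) → iIndepFun X P →
        (∀ i, IdentDistrib (X i) (X 1) P P) → variance (X 1) P = 1 →
        ∀ᵐ ω ∂P, Tendsto
          (fun n : ℕ => spectralMeasure (scaledToeplitz (n + 1) fun i => X i ω)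
            (scaledToeplitz_isHermitian (n + 1) fun i => X i ω))
          atTop (𝓝 γ)) ∧
      -- the limit is symmetric and has unbounded support
      (γ : Measure ℝ).map (fun t => -t) = (γ : Measure ℝ) ∧
      ¬ Bornology.IsBounded (γ : Measure ℝ).support ∧
      -- its even moments
      ∀ k : ℕ, Integrable (fun t : ℝ => t ^ (2 * k)) (γ : Measure ℝ) ∧
        ∫ t, t ^ (2 * k) ∂(γ : Measure ℝ) = ∑ w ∈ partitionWords k, toeplitzVolume w) ∧
    -- the cube sections are intersections of solids whose volumes are given by Eulerian numbers
    (∀ (k : ℕ), ∀ w ∈ partitionWords k, ∃ A B : Fin k → Finset (Fin (k + 1)),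
      toeplitzSection w = (unitCube (k + 1) ∩ ⋂ a, eulerianSolid (A a) (B a)) ∧
      ∀ a, Disjoint (A a) (B a) ∧ (A a).card = (B a).card + 1 ∧
        volume.real (eulerianSolid (A a) (B a)) =
          (eulerianNumber ((A a).card + (B a).card) (A a).card : ℝ) /
            ((A a).card + (B a).card)!) := by
  refine ⟨?_, fun k w hw => ?_⟩
  · obtain ⟨γ, hγ⟩ := exists_hasMoments_limitMoments
    refine ⟨γ, ?_, map_neg_eq_of_hasMoments hγ, not_isBounded_support_of_hasMoments hγ, fun k =>
      ⟨(hγ (2 * k)).1, (hγ (2 * k)).2.trans (limitMoments_two_mul k)⟩⟩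
    intro Ω _ P _ X hX hind hid hvar
    exact ae_tendsto_toeplitzMeasure hX hind hid hvar hγ
  · obtain ⟨fst, snd, h⟩ := (Finset.mem_filter.1 hw).2.exists_occurrences
    refine ⟨plusSet fst snd, minusSet fst snd, h.toeplitzSection_eq, fun a => ?_⟩
    exact ⟨disjoint_plusSet_minusSet a, h.card_plusSet a,
      volume_real_eulerianSolid (disjoint_plusSet_minusSet a) (h.card_plusSet a)⟩
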